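/- **Setting.** Let $d\ge 1$, let $u:\mathbb R^d\to\mathbb R$ be differentiable, put $h=\nabla u$, and let $m,L,l>0$ be such that for all $x,y\in\mathbb R^d$ $$\langle h(x)-h(y),x-y\rangle\ge 2m|x-y|^2,\qquad |h(x)-h(y)|\le L(1+|x|+|y|)^l|x-y|.$$ For a step size $\lambda>0$ let $r_\lambda=(L+m)(1/\sqrt\lambda)^{1/(l+2)}$, $g(x)=h(x)-mx$, $R_\lambda=\sup_{B(0,r_\lambda)}|g|$, and define the tamed drift $h_\lambda(x)=t(x)g(x)+R_\lambda s(x)x+mx$, where $t(x)=1$ if $|x|\le r_\lambda-1$, $t(x)=r_\lambda-|x|$ if $r_\lambda-1<|x|<r_\lambda$, $t(x)=0$ if $|x|\ge r_\lambda$; and $s(x)=0$ if $|x|\le r_\lambda-2$, $s(x)=|x|-r_\lambda+2$ if $r_\lambda-2<|x|<r_\lambda-1$, $s(x)=1$ if $r_\lambda-1\le|x|\le r_\lambda$, $s(x)=r_\lambda/|x|$ if $|x|\ge r_\lambda$ (earlier cases take precedence). Let $M_\lambda$ be the (smallest) Lipschitz constant of $h_\lambda$. For $\gamma>0$ let $\psi_0(t)=e^{-\gamma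 t}$, $\psi_1(t)=\frac{1-e^{-\gamma t}}{\gamma}$, $\psi_2(t)=\frac{\gamma t+e^{-\gamma t}-1}{\gamma^2}$. The tamed stochastic exponential scheme started at $(\theta_0,v_0)$ is $$v_{n+1}=\psi_0(\lambda)v_n-\psi_1(\lambda)h_\lambda(\theta_n)+\sqrt{2\gamma}\,\Xi_{n+1},\qquad \theta_{n+1}=\theta_n+\psi_1(\lambda)v_n-\psi_2(\lambda)h_\lambda(\theta_n)+\sqrt{2\gamma}\,\Xi'_{n+1},$$ where the pairs $(\Xi_j,\Xi'_j)_{j\ge1}$ are i.i.d. and independent of $(\theta_0,v_0)$, and for each $j$ the coordinate pairs $((\Xi_j)_i,(\Xi'_j)_i)$, $1\le i\le d$, are i.i.d. centered Gaussian vectors in $\mathbb R^2$ with covariance matrix $\int_0^\lambda(\psi_0(t),\psi_1(t))^\top(\psi_0(t),\psi_1(t))\,dt$. A probability measure $\mu$ on a Euclidean space satisfies a log-Sobolev inequality (LSI) with constant $C$ if $$\int f^2\log f^2\,d\mu-\Big(\int f^2d\mu\Big)\log\Big(\int f^2d\mu\Big)\le 2C\int|\nabla f|^2d\mu$$ for all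 bounded $C^1$ functions $f$ with bounded gradient. Let $M(x,v)=(x,x+\frac2\gamma v)$, a map into $\mathbb R^{2d}$ with its Euclidean norm. **Theorem.** There are absolute constants $c_0>0$ and $K\ge0$ such that in the above setting, whenever $\gamma\ge5\sqrt{M_\lambda}$, $0<\lambda\le\frac1{2\gamma}$, and the law of $M(\theta_0,v_0)$ satisfies an LSI with constant $C_{LSI,0}$, then for every $n\ge0$ the law of $M(\theta_n,v_n)$ satisfies an LSI with a constant $$C_{LSI,n}\le\Big(1-\frac{c_0m}{\gamma}\lambda\Big)^nC_{LSI,0}+\frac1{c_0m}+K\lambda\gamma .$$ -/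

import Mathlib

open MeasureTheory ProbabilityTheory

noncomputable section

namespace TamedKinetic

/-! ### Log-Sobolev inequality -/

/-- The entropy `Ent_μ(g) = ∫ g log g dμ - (∫ g dμ) log (∫ g dμ)`, with `0 log 0 = 0`. -/
def entropy {F : Type*} [MeasurableSpace F] (μ : Measure F) (g : F → ℝ) : ℝ :=
  (∫ z, g z * Real.log (g z) ∂μ) - (∫ z, g z ∂μ) * Real.log (∫ z, g z ∂μ)

/-- `μ` satisfies a log-Sobolev inequality with constant `C`:
`Ent_μ(f²) ≤ 2 C ∫ |∇f|² dμ` for every bounded `C¹` function `f` with bounded gradient.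
In this normalization the constant of a Gaussian law is the operator norm of its covariance.
For a probability measure `μ` all the integrals are finite. -/
def SatisfiesLSI {F : Type*} [NormedAddCommGroup F] [InnerProductSpace ℝ F] [CompleteSpace F]
    [MeasurableSpace F] (μ : Measure F) (C : ℝ) : Prop :=
  ∀ f : F → ℝ, ContDiff ℝ 1 f → (∃ B : ℝ, ∀ z, |f z| ≤ B) → (∃ B : ℝ, ∀ z, ‖gradient f z‖ ≤ B) →
    entropy μ (fun z => f z ^ 2) ≤ 2 * C * ∫ z, ‖gradient f z‖ ^ 2 ∂μ

/-! ### The assumptions on the drift -/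

section Drift

variable {d : ℕ}

/-- Strong monotonicity: `⟨h x - h y, x - y⟩ ≥ 2 m |x - y|²`. -/
def StronglyMonotone (h : EuclideanSpace ℝ (Fin d) → EuclideanSpace ℝ (Fin d)) (m : ℝ) : Prop :=
  ∀ x y, 2 * m * ‖x - y‖ ^ 2 ≤ inner ℝ (h x - h y) (x - y)

/-- Polynomial local Lipschitz continuity: `|h x - h y| ≤ L (1 + |x| + |y|)^l |x - y|`. -/
def PolyLipschitz (h : EuclideanSpace ℝ (Fin d) → EuclideanSpace ℝ (Fin d)) (L l : ℝ) : Prop :=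
  ∀ x y, ‖h x - h y‖ ≤ L * (1 + ‖x‖ + ‖y‖) ^ l * ‖x - y‖

/-! ### The tamed drift -/

/-- The radius `r_λ = (L + m) (1/√λ)^(1/(l+2))`. -/
def tameRadius (m L l lam : ℝ) : ℝ := (L + m) * (1 / √lam) ^ (1 / (l + 2))

/-- `g(x) = h(x) - m x`. -/
def shifted (h : EuclideanSpace ℝ (Fin d) → EuclideanSpace ℝ (Fin d)) (m : ℝ)
    (x : EuclideanSpace ℝ (Fin d)) : EuclideanSpace ℝ (Fin d) := h x - m • x

/-- `sup_{B(0,r)} |g|`. -/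
def supBall (g : EuclideanSpace ℝ (Fin d) → EuclideanSpace ℝ (Fin d)) (r : ℝ) : ℝ :=
  sSup ((fun x => ‖g x‖) '' Metric.ball 0 r)

/-- The cutoff `t`, as a function of `ρ = |x|`. -/
def cutoffT (r ρ : ℝ) : ℝ :=
  if ρ ≤ r - 1 then 1 else if ρ < r then r - ρ else 0

/-- The cutoff `s`, as a function of `ρ = |x|`. -/
def cutoffS (r ρ : ℝ) : ℝ :=
  if ρ ≤ r - 2 then 0 else if ρ < r - 1 then ρ - r + 2 else if ρ ≤ r then 1 else r / ρ

/-- The tamed drift `h_λ(x) = t(x) g(x) + R_λ s(x) x + m x`. -/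
def tamedDrift (h : EuclideanSpace ℝ (Fin d) → EuclideanSpace ℝ (Fin d)) (m L l lam : ℝ)
    (x : EuclideanSpace ℝ (Fin d)) : EuclideanSpace ℝ (Fin d) :=
  cutoffT (tameRadius m L l lam) ‖x‖ • shifted h m x
    + (supBall (shifted h m) (tameRadius m L l lam) * cutoffS (tameRadius m L l lam) ‖x‖) • x
    + m • x

/-- The (smallest) Lipschitz constant of a Lipschitz map. -/
def lipConst (f : EuclideanSpace ℝ (Fin d) → EuclideanSpace ℝ (Fin d)) : NNReal :=
  sInf {K : NNReal | LipschitzWith K f}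

end Drift

/-! ### The stochastic exponential scheme -/

/-- `ψ₀(t) = e^{-γt}`. -/
def psi0 (γ t : ℝ) : ℝ := Real.exp (-γ * t)

/-- `ψ₁(t) = ∫₀ᵗ ψ₀ = (1 - e^{-γt})/γ`. -/
def psi1 (γ t : ℝ) : ℝ := (1 - Real.exp (-γ * t)) / γ

/-- `ψ₂(t) = ∫₀ᵗ ψ₁ = (γt + e^{-γt} - 1)/γ²`. -/
def psi2 (γ t : ℝ) : ℝ := (γ * t + Real.exp (-γ * t) - 1) / γ ^ 2

/-- `∫₀^λ (ψ₀(t), ψ₁(t))ᵀ (ψ₀(t), ψ₁(t)) dt`. -/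
def noiseCov (γ lam : ℝ) : Matrix (Fin 2) (Fin 2) ℝ :=
  !![∫ t in (0 : ℝ)..lam, psi0 γ t * psi0 γ t, ∫ t in (0 : ℝ)..lam, psi0 γ t * psi1 γ t;
     ∫ t in (0 : ℝ)..lam, psi1 γ t * psi0 γ t, ∫ t in (0 : ℝ)..lam, psi1 γ t * psi1 γ t]

/-- The noise `(Ξ n, Ξ' n)` (used in the step from `n` to `n + 1`) and the initial condition
`(θ₀, V₀)` of the scheme: the noise vectors are independent in `n` and independent of the initial
condition, and for each `n` the coordinate pairs `(Ξ n ω i, Ξ' n ω i)`, `i < d`, are independent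
centered Gaussian vectors in the plane with covariance `noiseCov γ lam`. -/
structure IsSchemeInput {d : ℕ} {Ω : Type*} [MeasurableSpace Ω] (P : Measure Ω) (γ lam : ℝ)
    (θ₀ V₀ : Ω → EuclideanSpace ℝ (Fin d)) (Ξ Ξ' : ℕ → Ω → EuclideanSpace ℝ (Fin d)) : Prop where
  measurable_θ₀ : Measurable θ₀
  measurable_V₀ : Measurable V₀
  measurable_Ξ : ∀ n, Measurable (Ξ n)
  measurable_Ξ' : ∀ n, Measurable (Ξ' n)
  indep_init : IndepFun (fun ω => (θ₀ ω, V₀ ω)) (fun ω (n : ℕ) => (Ξ n ω, Ξ' n ω)) P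
  indep_steps : iIndepFun (fun (n : ℕ) ω => (Ξ n ω, Ξ' n ω)) P
  indep_coords : ∀ n, iIndepFun (fun (i : Fin d) ω => (Ξ n ω i, Ξ' n ω i)) P
  law_coords : ∀ (n : ℕ) (i : Fin d),
    HasLaw (fun ω => !₂[Ξ n ω i, Ξ' n ω i]) (multivariateGaussian 0 (noiseCov γ lam)) P

/-- The iterates `(θ_n, v_n)` of the stochastic exponential scheme with drift `b`, friction `γ` and
step size `lam`. -/
def expScheme {d : ℕ} {Ω : Type*}
    (b : EuclideanSpace ℝ (Fin d) → EuclideanSpace ℝ (Fin d)) (γ lam : ℝ)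
    (θ₀ V₀ : Ω → EuclideanSpace ℝ (Fin d)) (Ξ Ξ' : ℕ → Ω → EuclideanSpace ℝ (Fin d)) :
    ℕ → Ω → EuclideanSpace ℝ (Fin d) × EuclideanSpace ℝ (Fin d)
  | 0, ω => (θ₀ ω, V₀ ω)
  | n + 1, ω =>
    let z := expScheme b γ lam θ₀ V₀ Ξ Ξ' n ω
    (z.1 + psi1 γ lam • z.2 - psi2 γ lam • b z.1 + √(2 * γ) • Ξ' n ω,
     psi0 γ lam • z.2 - psi1 γ lam • b z.1 + √(2 * γ) • Ξ n ω)

/-- The change of coordinates `(x, v) ↦ (x, x + (2/γ) v)`, with values in `ℝ^{2d}` carrying the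
Euclidean norm `|(x, y)|² = |x|² + |y|²`. -/
def coordM {d : ℕ} (γ : ℝ) (z : EuclideanSpace ℝ (Fin d) × EuclideanSpace ℝ (Fin d)) :
    WithLp 2 (EuclideanSpace ℝ (Fin d) × EuclideanSpace ℝ (Fin d)) :=
  WithLp.toLp 2 (z.1, z.1 + (2 / γ) • z.2)

end TamedKinetic

end

noncomputable section

open MeasureTheory ProbabilityTheory Filter Topology

namespace TamedKinetic

/-! ### Entropy -/

/-! In the coordinates `coordM` one step of the scheme reads Z' = S(Z) + N, where S = `stepMap` is
deterministic and N = `stepNoise` is a Gaussian vector independent of Z. A κ-Lipschitz map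
multiplies an LSI constant by κ² (`SatisfiesLSI.map_lipschitz`), and adding N costs at most 36λ/γ
(`addsForm_stepNoise`). With κ² = ρ = 1 - mλ/(5γ) (`lipschitzWith_stepMap`) the constants obey C' =
ρC + 36λ/γ, whose fixed point is 180/m. Hence c₀ = 1/180 works, even with K = 0.

Contraction. The friction shrinks the difference of the two coordinates, and strong monotonicity of
the drift shrinks the rest. The quadratic error terms in the drift are absorbed if the drift b is
cocoercive, |Δb|² ≤ 7M⟨Δb, Δx⟩, and γ² ≥ 25M (`contraction_estimate`). A Lipschitz gradient of a
convex function is cocoercive, but the tamed drift is not a gradient in the annulus r - 1 < |x| < r.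
There its increment is a sum of three increments that are cocoercive separately: a positive multiple
of a convex gradient, a perturbation of R·id of size at most R, and m·id
(`monoCoco_tamedField_annulus`). Away from finitely many spheres these estimates are local, and they
are integrated along segments (`monoCoco_of_locally`).

Noise. Subadditivity of entropy (`entropy_prod_le`) adds energies under convolution. It also yields
an LSI for the standard Gaussian on the line: a two-point inequality is tensorized over a random
walk and passed to the limit by the central limit theorem (`entropy_gaussianReal_sq_le`). This costs
a factor 2 against the optimal constant, which is harmless here. Energies are kept as general forms
(`FormLSI`, `AddsForm`) because a Gaussian in direction e contributes 2⟨e, ξ⟩²; summing such forms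
over the coordinates gives a multiple of |ξ|² independent of the dimension. -/

lemma exists_bound_mul_log (B : ℝ) :
    ∃ C : ℝ, 0 ≤ C ∧ ∀ x : ℝ, 0 ≤ x → x ≤ B → |x * Real.log x| ≤ C := by
  obtain ⟨C, hC⟩ := (isCompact_Icc (a := (0 : ℝ)) (b := B)).exists_bound_of_continuousOn
    (Real.continuous_mul_log.continuousOn)
  exact ⟨max C 0, le_max_right _ _, fun x h0 h1 => (hC x ⟨h0, h1⟩).trans (le_max_left _ _)⟩

lemma integral_mem_Icc_of_bound {α : Type*} [MeasurableSpace α] {μ : Measure α}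
    [IsProbabilityMeasure μ] {g : α → ℝ} (hg : Measurable g) {a B : ℝ} (h0 : ∀ z, a ≤ g z)
    (h1 : ∀ z, g z ≤ B) : a ≤ ∫ z, g z ∂μ ∧ ∫ z, g z ∂μ ≤ B := by
  have hi : Integrable g μ := Integrable.of_bound hg.aestronglyMeasurable (max |a| |B|)
    (ae_of_all _ fun z => abs_le_max_abs_abs (h0 z) (h1 z))
  constructor
  · simpa using integral_mono (integrable_const a) hi h0
  · simpa using integral_mono hi (integrable_const B) h1

lemma integrable_of_measurable_of_abs_le {α : Type*} [MeasurableSpace α] {μ : Measure α}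
    [IsFiniteMeasure μ] {g : α → ℝ} (hg : Measurable g) {B : ℝ} (h : ∀ z, |g z| ≤ B) :
    Integrable g μ :=
  Integrable.of_bound hg.aestronglyMeasurable B (ae_of_all _ h)

/-- Provides the domination needed to integrate partial entropies and to pass to limits under the
integral. -/
lemma abs_entropy_le {α : Type*} [MeasurableSpace α] {μ : Measure α} [IsProbabilityMeasure μ]
    {g : α → ℝ} (hg : Measurable g) {B C : ℝ} (h0 : ∀ z, 0 ≤ g z) (h1 : ∀ z, g z ≤ B)
    (hC : ∀ x : ℝ, 0 ≤ x → x ≤ B → |x * Real.log x| ≤ C) : |entropy μ g| ≤ 2 * C := by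
  have hE := integral_mem_Icc_of_bound (μ := μ) hg h0 h1
  have h2 := hC _ hE.1 hE.2
  have h3 : |∫ z, g z * Real.log (g z) ∂μ| ≤ C := by
    have := norm_integral_le_of_norm_le_const (μ := μ) (f := fun z => g z * Real.log (g z)) (C := C)
      (ae_of_all _ fun z => hC _ (h0 z) (h1 z))
    simpa using this
  unfold entropy
  calc _ ≤ _ := abs_sub _ _
    _ ≤ 2 * C := by linarith

/-- Entropy is continuous along uniformly bounded pointwise convergent sequences. -/
lemma tendsto_entropy {α : Type*} [MeasurableSpace α] {μ : Measure α} [IsProbabilityMeasure μ]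
    {g : ℕ → α → ℝ} {g' : α → ℝ} (hg : ∀ n, Measurable (g n)) {B : ℝ} (h0 : ∀ n z, 0 ≤ g n z)
    (h1 : ∀ n z, g n z ≤ B) (hlim : ∀ z, Tendsto (fun n => g n z) atTop (𝓝 (g' z))) :
    Tendsto (fun n => entropy μ (g n)) atTop (𝓝 (entropy μ g')) := by
  obtain ⟨C, -, hC⟩ := exists_bound_mul_log B
  have hE : Tendsto (fun n => ∫ z, g n z ∂μ) atTop (𝓝 (∫ z, g' z ∂μ)) := by
    refine tendsto_integral_of_dominated_convergence (fun _ => B)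
      (fun n => (hg n).aestronglyMeasurable) (integrable_const _) (fun n => ae_of_all _ fun z => ?_)
      (ae_of_all _ hlim)
    rw [Real.norm_of_nonneg (h0 n z)]; exact h1 n z
  refine Tendsto.sub ?_ ((Real.continuous_mul_log.tendsto _).comp hE)
  refine tendsto_integral_of_dominated_convergence (fun _ => C)
    (fun n => ((hg n).mul (Real.measurable_log.comp (hg n))).aestronglyMeasurable)
    (integrable_const _) (fun n => ae_of_all _ fun z => hC _ (h0 n z) (h1 n z))
    (ae_of_all _ fun z => (Real.continuous_mul_log.tendsto _).comp (hlim z))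

lemma entropy_map {α β : Type*} [MeasurableSpace α] [MeasurableSpace β] {μ : Measure α}
    {φ : α → β} (hφ : Measurable φ) {g : β → ℝ} (hg : Measurable g) :
    entropy (μ.map φ) g = entropy μ (fun z => g (φ z)) := by
  have h : Measurable fun z => g z * Real.log (g z) := hg.mul (Real.measurable_log.comp hg)
  unfold entropy
  rw [integral_map hφ.aemeasurable hg.aestronglyMeasurable,
    integral_map hφ.aemeasurable h.aestronglyMeasurable]

/-- Jensen's inequality for x log x. -/
lemma entropy_nonneg {α : Type*} [MeasurableSpace α] {μ : Measure α} [IsProbabilityMeasure μ]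
    {g : α → ℝ} (hg : Measurable g) {B : ℝ} (h0 : ∀ z, 0 ≤ g z) (h1 : ∀ z, g z ≤ B) :
    0 ≤ entropy μ g := by
  obtain ⟨C, -, hC⟩ := exists_bound_mul_log B
  have := Real.convexOn_mul_log.map_integral_le (μ := μ) (f := g)
    Real.continuous_mul_log.continuousOn isClosed_Ici (ae_of_all _ h0)
    (integrable_of_measurable_of_abs_le hg fun z => by rw [abs_of_nonneg (h0 z)]; exact h1 z)
    (integrable_of_measurable_of_abs_le (hg.mul (Real.measurable_log.comp hg))
      fun z => hC _ (h0 z) (h1 z))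
  exact sub_nonneg.2 this

lemma sub_le_mul_log_div {a b : ℝ} (ha : 0 < a) (hb : 0 < b) :
    a - b ≤ a * (Real.log a - Real.log b) := by
  have h := Real.log_le_sub_one_of_pos (div_pos hb ha)
  rw [Real.log_div hb.ne' ha.ne'] at h
  have h2 := mul_le_mul_of_nonneg_left h ha.le
  have h3 : a * (b / a - 1) = b - a := by field_simp
  linarith

/-! ### Subadditivity of entropy on product spaces. -/

section Tensorization

variable {α β : Type*} [MeasurableSpace α] [MeasurableSpace β] {μ : Measure α} {ν : Measure β}
  [IsProbabilityMeasure μ] [IsProbabilityMeasure ν]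

lemma measurable_entropy_right {g : α × β → ℝ} (hg : Measurable g) :
    Measurable fun x => entropy ν fun y => g (x, y) := by
  have h1 : Measurable fun x => ∫ y, g (x, y) ∂ν :=
    (hg.stronglyMeasurable.integral_prod_right' (ν := ν)).measurable
  have h2 : Measurable fun x => ∫ y, g (x, y) * Real.log (g (x, y)) ∂ν :=
    ((hg.mul (Real.measurable_log.comp hg)).stronglyMeasurable.integral_prod_right'
      (ν := ν)).measurable
  exact h2.sub (h1.mul (Real.measurable_log.comp h1))

lemma measurable_entropy_left {g : α × β → ℝ} (hg : Measurable g) :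
    Measurable fun y => entropy μ fun x => g (x, y) :=
  measurable_entropy_right (hg.comp measurable_swap)

/-- After cancellation the claim says that the relative entropy of g with respect to the normalized
product r(x)k(y)/E of its marginals is nonnegative. The lower bound δ keeps every logarithm bounded.
-/
lemma entropy_prod_le_of_pos {g : α × β → ℝ} (hg : Measurable g) {δ B : ℝ} (hδ : 0 < δ)
    (h0 : ∀ p, δ ≤ g p) (h1 : ∀ p, g p ≤ B) :
    entropy (μ.prod ν) g ≤ (∫ x, entropy ν (fun y => g (x, y)) ∂μ)
      + ∫ y, entropy μ (fun x => g (x, y)) ∂ν := by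
  have hlogb : ∀ x, δ ≤ x → x ≤ B → |Real.log x| ≤ max |Real.log δ| |Real.log B| :=
    fun x h h' => abs_le_max_abs_abs (Real.log_le_log hδ h) (Real.log_le_log (hδ.trans_le h) h')
  set D := max |Real.log δ| |Real.log B|
  have hgabs : ∀ p, |g p| ≤ B := fun p => by
    rw [abs_of_nonneg (hδ.le.trans (h0 p))]; exact h1 p
  set r : α → ℝ := fun x => ∫ y, g (x, y) ∂ν with hr
  set k : β → ℝ := fun y => ∫ x, g (x, y) ∂μ with hk
  set E : ℝ := ∫ p, g p ∂μ.prod ν with hE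
  have hrm : Measurable r := (hg.stronglyMeasurable.integral_prod_right' (ν := ν)).measurable
  have hkm : Measurable k := (hg.stronglyMeasurable.integral_prod_left' (μ := μ)).measurable
  have hrb : ∀ x, δ ≤ r x ∧ r x ≤ B := fun x =>
    integral_mem_Icc_of_bound (hg.comp (by fun_prop)) (fun y => h0 _) (fun y => h1 _)
  have hkb : ∀ y, δ ≤ k y ∧ k y ≤ B := fun y =>
    integral_mem_Icc_of_bound (hg.comp (by fun_prop)) (fun y => h0 _) (fun y => h1 _)
  have hEb : δ ≤ E ∧ E ≤ B := integral_mem_Icc_of_bound hg h0 h1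
  have hEpos := hδ.trans_le hEb.1
  have hgi : Integrable g (μ.prod ν) := integrable_of_measurable_of_abs_le hg hgabs
  have hmulb : ∀ p (c : ℝ), |c| ≤ D → |g p * c| ≤ B * D := fun p c hc => by
    rw [abs_mul]; exact mul_le_mul (hgabs p) hc (abs_nonneg _) ((abs_nonneg _).trans (hgabs p))
  have hlm := Real.measurable_log
  have i1 : Integrable (fun p => g p * Real.log (g p)) (μ.prod ν) :=
    integrable_of_measurable_of_abs_le (hg.mul (hlm.comp hg))
      fun p => hmulb p _ (hlogb _ (h0 p) (h1 p))
  have i2 : Integrable (fun p => g p * Real.log (r p.1)) (μ.prod ν) :=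
    integrable_of_measurable_of_abs_le (hg.mul (hlm.comp (hrm.comp measurable_fst)))
      fun p => hmulb p _ (hlogb _ (hrb _).1 (hrb _).2)
  have i3 : Integrable (fun p => g p * Real.log (k p.2)) (μ.prod ν) :=
    integrable_of_measurable_of_abs_le (hg.mul (hlm.comp (hkm.comp measurable_snd)))
      fun p => hmulb p _ (hlogb _ (hkb _).1 (hkb _).2)
  have e2 : ∫ p, g p * Real.log (r p.1) ∂μ.prod ν = ∫ x, r x * Real.log (r x) ∂μ := by
    rw [integral_prod _ i2]; simp only [integral_mul_const, hr]
  have e3 : ∫ p, g p * Real.log (k p.2) ∂μ.prod ν = ∫ y, k y * Real.log (k y) ∂ν := by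
    rw [integral_prod_symm _ i3]; simp only [integral_mul_const, hk]
  have er : ∫ x, r x ∂μ = E := by rw [hE, integral_prod _ hgi]
  have ek : ∫ y, k y ∂ν = E := by rw [hE, integral_prod_symm _ hgi]
  have hri : Integrable r μ := hgi.integral_prod_left
  have hki : Integrable k ν := hgi.integral_prod_right
  have irk : Integrable (fun p : α × β => r p.1 * k p.2) (μ.prod ν) := hri.mul_prod hki
  have erk : ∫ p, r p.1 * k p.2 ∂μ.prod ν = E * E := by
    rw [integral_prod_mul, er, ek]
  -- Pointwise a - b ≤ a(log a - log b) with a = g and b = rk/E; both a and b have integral E.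
  have key : 0 ≤ ∫ p, ((g p * Real.log (g p) - g p * Real.log (r p.1) - g p * Real.log (k p.2)
      + g p * Real.log E) - (g p - r p.1 * k p.2 / E)) ∂μ.prod ν := by
    refine integral_nonneg fun p => ?_
    have hrp := hδ.trans_le (hrb p.1).1
    have hkp := hδ.trans_le (hkb p.2).1
    have hgp := hδ.trans_le (h0 p)
    have := sub_le_mul_log_div hgp (div_pos (mul_pos hrp hkp) hEpos)
    rw [Real.log_div (mul_pos hrp hkp).ne' hEpos.ne', Real.log_mul hrp.ne' hkp.ne'] at this
    simp only [Pi.zero_apply]; linarith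
  have j1 : Integrable (fun p => g p * Real.log (g p) - g p * Real.log (r p.1)) (μ.prod ν) :=
    i1.sub i2
  have j2 : Integrable (fun p => g p * Real.log (g p) - g p * Real.log (r p.1)
      - g p * Real.log (k p.2)) (μ.prod ν) := j1.sub i3
  have j3 : Integrable (fun p => g p * Real.log (g p) - g p * Real.log (r p.1)
      - g p * Real.log (k p.2) + g p * Real.log E) (μ.prod ν) := j2.add (hgi.mul_const _)
  have j4 : Integrable (fun p => g p - r p.1 * k p.2 / E) (μ.prod ν) := hgi.sub (irk.div_const _)
  rw [integral_sub j3 j4, integral_add j2 (hgi.mul_const _), integral_sub j1 i3,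
    integral_sub i1 i2, integral_sub hgi (irk.div_const _), integral_mul_const, integral_div,
    e2, e3, erk, mul_div_cancel_right₀ _ hEpos.ne'] at key
  have hmlr : Integrable (fun x => r x * Real.log (r x)) μ := by
    refine integrable_of_measurable_of_abs_le (hrm.mul (hlm.comp hrm)) (B := B * D) fun x => ?_
    rw [abs_mul]
    exact mul_le_mul (by rw [abs_of_nonneg (hδ.le.trans (hrb x).1)]; exact (hrb x).2)
      (hlogb _ (hrb _).1 (hrb _).2) (abs_nonneg _) (hδ.le.trans ((hrb x).1.trans (hrb x).2))
  have hmlk : Integrable (fun x => k x * Real.log (k x)) ν := by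
    refine integrable_of_measurable_of_abs_le (hkm.mul (hlm.comp hkm)) (B := B * D) fun x => ?_
    rw [abs_mul]
    exact mul_le_mul (by rw [abs_of_nonneg (hδ.le.trans (hkb x).1)]; exact (hkb x).2)
      (hlogb _ (hkb _).1 (hkb _).2) (abs_nonneg _) (hδ.le.trans ((hkb x).1.trans (hkb x).2))
  have f1 : ∫ x, entropy ν (fun y => g (x, y)) ∂μ
      = (∫ p, g p * Real.log (g p) ∂μ.prod ν) - ∫ x, r x * Real.log (r x) ∂μ := by
    rw [integral_prod _ i1, ← integral_sub i1.integral_prod_left hmlr]; rfl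
  have f2 : ∫ y, entropy μ (fun x => g (x, y)) ∂ν
      = (∫ p, g p * Real.log (g p) ∂μ.prod ν) - ∫ y, k y * Real.log (k y) ∂ν := by
    rw [integral_prod_symm _ i1, ← integral_sub i1.integral_prod_right hmlk]; rfl
  rw [f1, f2, entropy]
  linarith

/-- Subadditivity (tensorization) of the entropy. -/
theorem entropy_prod_le {g : α × β → ℝ} (hg : Measurable g) {B : ℝ}
    (h0 : ∀ p, 0 ≤ g p) (h1 : ∀ p, g p ≤ B) :
    entropy (μ.prod ν) g ≤ (∫ x, entropy ν (fun y => g (x, y)) ∂μ)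
      + ∫ y, entropy μ (fun x => g (x, y)) ∂ν := by
  -- The positive case is applied to g + ε with ε ≤ 1, hence the bound B + 1.
  obtain ⟨C, -, hC⟩ := exists_bound_mul_log (B + 1)
  set ε : ℕ → ℝ := fun n => 1 / ((n : ℝ) + 1) with hε
  have hεpos : ∀ n, 0 < ε n := fun n => by positivity
  have hε1 : ∀ n, ε n ≤ 1 := fun n => by
    rw [hε]; exact (div_le_one (by positivity)).2 (by linarith [n.cast_nonneg (α := ℝ)])
  have hεlim : ∀ c : ℝ, Tendsto (fun n => c + ε n) atTop (𝓝 c) := fun c => by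
    simpa [hε] using (tendsto_const_nhds (x := c)).add
      (tendsto_one_div_add_atTop_nhds_zero_nat (𝕜 := ℝ))
  have hgm : ∀ n, Measurable fun p => g p + ε n := fun n => hg.add_const _
  have hn0 : ∀ n p, 0 ≤ g p + ε n := fun n p => add_nonneg (h0 p) (hεpos n).le
  have hn1 : ∀ n p, g p + ε n ≤ B + 1 := fun n p => add_le_add (h1 p) (hε1 n)
  refine le_of_tendsto_of_tendsto' (tendsto_entropy (μ := μ.prod ν) hgm hn0 hn1
    (fun p => hεlim (g p))) (Tendsto.add ?_ ?_) (fun n => entropy_prod_le_of_pos (hgm n) (hεpos n)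
      (fun p => le_add_of_nonneg_left (h0 p)) (hn1 n))
  · refine tendsto_integral_of_dominated_convergence (fun _ => 2 * C)
      (fun n => (measurable_entropy_right (hgm n)).aestronglyMeasurable) (integrable_const _)
      (fun n => ae_of_all _ fun x => ?_) (ae_of_all _ fun x => ?_)
    · exact abs_entropy_le ((hgm n).comp (by fun_prop)) (fun y => hn0 n _) (fun y => hn1 n _) hC
    · exact tendsto_entropy (fun n => (hgm n).comp (by fun_prop)) (fun n y => hn0 n _)
        (fun n y => hn1 n _) (fun y => hεlim _)
  · refine tendsto_integral_of_dominated_convergence (fun _ => 2 * C)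
      (fun n => (measurable_entropy_left (hgm n)).aestronglyMeasurable) (integrable_const _)
      (fun n => ae_of_all _ fun x => ?_) (ae_of_all _ fun x => ?_)
    · exact abs_entropy_le ((hgm n).comp (by fun_prop)) (fun y => hn0 n _) (fun y => hn1 n _) hC
    · exact tendsto_entropy (fun n => (hgm n).comp (by fun_prop)) (fun n y => hn0 n _)
        (fun n y => hn1 n _) (fun y => hεlim _)

end Tensorization

/-- Subadditivity of the entropy for convolutions. -/
lemma entropy_conv_le {F : Type*} [AddMonoid F] [MeasurableSpace F] [MeasurableAdd₂ F]
    {μ ν : Measure F} [IsProbabilityMeasure μ] [IsProbabilityMeasure ν]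
    {g : F → ℝ} (hg : Measurable g) {B : ℝ} (h0 : ∀ z, 0 ≤ g z) (h1 : ∀ z, g z ≤ B) :
    entropy (μ ∗ ν) g ≤ (∫ x, entropy ν (fun y => g (x + y)) ∂μ)
      + ∫ y, entropy μ (fun x => g (x + y)) ∂ν := by
  rw [Measure.conv, entropy_map measurable_add hg]
  exact entropy_prod_le (g := fun p => g (p.1 + p.2)) (hg.comp measurable_add) (fun p => h0 _)
    (fun p => h1 _)

end TamedKinetic
end

noncomputable section

open MeasureTheory ProbabilityTheory Filter Topology
open scoped ENNReal

namespace TamedKinetic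

/-! ### The log-Sobolev inequality for the standard Gaussian law on the line -/

lemma mul_log_sub_log_le {A s : ℝ} (hA : 0 ≤ A) (hs : 0 < s) :
    A * (Real.log A - Real.log s) ≤ A * (A / s - 1) := by
  rcases hA.eq_or_lt with rfl | hA
  · simp
  · have := Real.log_le_sub_one_of_pos (div_pos hA hs)
    rw [Real.log_div hA.ne' hs.ne'] at this
    exact mul_le_mul_of_nonneg_left this hA.le

/-- With s the mean of a² and b², log t ≤ t - 1 bounds the entropy by variance over mean, which is
(a-b)²(a+b)²/(2(a²+b²)); then (a+b)² ≤ 2(a²+b²). -/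
lemma two_point_entropy_le (a b : ℝ) :
    (a ^ 2 * Real.log (a ^ 2) + b ^ 2 * Real.log (b ^ 2)) / 2
      - (a ^ 2 + b ^ 2) / 2 * Real.log ((a ^ 2 + b ^ 2) / 2) ≤ (a - b) ^ 2 := by
  rcases (by positivity : 0 ≤ a ^ 2 + b ^ 2).eq_or_lt with h | h
  · have ha : a = 0 := by nlinarith [sq_nonneg a, sq_nonneg b]
    have hb : b = 0 := by nlinarith [sq_nonneg a, sq_nonneg b]
    simp [ha, hb]
  · have hs : 0 < (a ^ 2 + b ^ 2) / 2 := by linarith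
    have h1 := mul_log_sub_log_le (sq_nonneg a) hs
    have h2 := mul_log_sub_log_le (sq_nonneg b) hs
    have h3 : (a ^ 2 * (a ^ 2 / ((a ^ 2 + b ^ 2) / 2) - 1)
        + b ^ 2 * (b ^ 2 / ((a ^ 2 + b ^ 2) / 2) - 1)) / 2 ≤ (a - b) ^ 2 := by
      have : (a ^ 2 * (a ^ 2 / ((a ^ 2 + b ^ 2) / 2) - 1)
        + b ^ 2 * (b ^ 2 / ((a ^ 2 + b ^ 2) / 2) - 1)) / 2
          = (a - b) ^ 2 * (a + b) ^ 2 / (2 * (a ^ 2 + b ^ 2)) := by field_simp; ring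
      rw [this, div_le_iff₀ (by linarith)]
      exact mul_le_mul_of_nonneg_left (by nlinarith [sq_nonneg (a - b)]) (sq_nonneg _)
    linarith

/-- The uniform law on `{h, -h}`. -/
def signMeasure (h : ℝ) : Measure ℝ :=
  (2⁻¹ : ℝ≥0∞) • Measure.dirac h + (2⁻¹ : ℝ≥0∞) • Measure.dirac (-h)

instance (h : ℝ) : IsProbabilityMeasure (signMeasure h) :=
  ⟨by simp [signMeasure, ENNReal.inv_two_add_inv_two]⟩

lemma integral_signMeasure {G : Type*} [NormedAddCommGroup G] [NormedSpace ℝ G] [CompleteSpace G]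
    (h : ℝ) (φ : ℝ → G) :
    ∫ y, φ y ∂signMeasure h = (2⁻¹ : ℝ) • (φ h + φ (-h)) := by
  have hi : ∀ x, Integrable φ ((2⁻¹ : ℝ≥0∞) • Measure.dirac x) := fun x =>
    (integrable_dirac (by simp)).smul_measure (by simp)
  rw [signMeasure, integral_add_measure (hi _) (hi _)]
  simp [integral_smul_measure]

/-- The law of the sum of `n` independent uniform signs, scaled by `h`. -/
def signWalk (h : ℝ) : ℕ → Measure ℝ
  | 0 => Measure.dirac 0
  | n + 1 => signWalk h n ∗ signMeasure h

instance isProbabilityMeasure_signWalk (h : ℝ) : ∀ n, IsProbabilityMeasure (signWalk h n)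
  | 0 => by unfold signWalk; infer_instance
  | n + 1 => by
    have := isProbabilityMeasure_signWalk h n
    unfold signWalk; infer_instance

lemma entropy_signMeasure_sq_le (h : ℝ) (T : ℝ → ℝ) :
    entropy (signMeasure h) (fun y => T y ^ 2) ≤ (T h - T (-h)) ^ 2 := by
  unfold entropy
  simp only [integral_signMeasure, smul_eq_mul]
  have := two_point_entropy_le (T h) (T (-h))
  convert this using 2
  · ring
  · rw [show (2⁻¹ : ℝ) * (T h ^ 2 + T (-h) ^ 2) = (T h ^ 2 + T (-h) ^ 2) / 2 by ring]

/-- Each of the n signs contributes the squared jump of T across that sign. Bounding the jump by the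
average of W at its two endpoints turns each contribution into the integral of W against the law of
the full walk, so the n contributions are equal. -/
lemma entropy_signWalk_sq_le {h : ℝ} (n : ℕ) : ∀ {T W : ℝ → ℝ}, Measurable T → Measurable W →
    ∀ {B : ℝ}, (∀ x, |T x| ≤ B) → (∀ x, |W x| ≤ B) →
    (∀ x, (T (x + h) - T (x - h)) ^ 2 ≤ (W (x + h) + W (x - h)) / 2) →
    entropy (signWalk h n) (fun y => T y ^ 2) ≤ n * ∫ y, W y ∂signWalk h n := by
  induction n with
  | zero =>
    intro T W hT hW B hTB hWB hTW
    simp [signWalk, entropy]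
  | succ n ih =>
    intro T W hT hW B hTB hWB hTW
    have hsq : ∀ x, T x ^ 2 ≤ B ^ 2 := fun x => sq_le_sq' (abs_le.1 (hTB x)).1 (abs_le.1 (hTB x)).2
    have hWi : ∀ (μ : Measure ℝ) [IsProbabilityMeasure μ] (c : ℝ),
        Integrable (fun x => W (x + c)) μ := fun μ _ c =>
      integrable_of_measurable_of_abs_le (hW.comp (measurable_add_const c)) fun x => hWB _
    have hWc : ∫ y, W y ∂signWalk h (n + 1)
        = ((∫ x, W (x + h) ∂signWalk h n) + ∫ x, W (x - h) ∂signWalk h n) / 2 := by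
      rw [signWalk, integral_conv (by simpa using hWi _ 0)]
      simp only [integral_signMeasure, smul_eq_mul, ← sub_eq_add_neg]
      rw [integral_const_mul, integral_add (hWi _ _) (by simpa [sub_eq_add_neg] using hWi _ (-h))]
      ring
    have h1 : ∫ x, entropy (signMeasure h) (fun y => T (x + y) ^ 2) ∂signWalk h n
        ≤ ((∫ x, W (x + h) ∂signWalk h n) + ∫ x, W (x - h) ∂signWalk h n) / 2 := by
      have hWi' : Integrable (fun x => W (x - h)) (signWalk h n) := by
        simpa [sub_eq_add_neg] using hWi _ (-h)
      rw [← integral_add (hWi _ _) hWi', ← integral_div]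
      obtain ⟨C, -, hC⟩ := exists_bound_mul_log (B ^ 2)
      refine integral_mono (integrable_of_measurable_of_abs_le
        (measurable_entropy_right (g := fun p : ℝ × ℝ => T (p.1 + p.2) ^ 2)
          ((hT.comp measurable_add).pow_const 2))
        (fun x => abs_entropy_le ((hT.comp (measurable_const_add x)).pow_const 2)
          (fun _ => sq_nonneg _) (fun _ => hsq _) hC))
        (((hWi _ _).add hWi').div_const _) fun x => ?_
      exact (entropy_signMeasure_sq_le h fun y => T (x + y)).trans
        (by simpa [← sub_eq_add_neg] using hTW x)
    have h2 : ∫ y, entropy (signWalk h n) (fun x => T (x + y) ^ 2) ∂signMeasure h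
        ≤ n * (((∫ x, W (x + h) ∂signWalk h n) + ∫ x, W (x - h) ∂signWalk h n) / 2) := by
      -- The hypotheses on T and W are translation invariant, so the induction hypothesis holds for
      -- every shift.
      have key : ∀ c, entropy (signWalk h n) (fun x => T (x + c) ^ 2)
          ≤ n * ∫ x, W (x + c) ∂signWalk h n := fun c => by
        refine ih (T := fun x => T (x + c)) (W := fun x => W (x + c))
          (hT.comp (measurable_add_const c)) (hW.comp (measurable_add_const c))
          (fun x => hTB _) (fun x => hWB _) fun x => ?_
        have := hTW (x + c)
        simpa only [add_right_comm x c h, add_sub_right_comm x c h] using this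
      have k1 := key h
      have k2 := key (-h)
      simp only [integral_signMeasure, smul_eq_mul, ← sub_eq_add_neg] at k2 ⊢
      linarith
    have h3 := entropy_conv_le (μ := signWalk h n) (ν := signMeasure h)
      (hT.pow_const 2) (fun x => sq_nonneg _) hsq
    rw [hWc]
    push_cast
    change entropy (signWalk h n ∗ signMeasure h) _ ≤ _
    linarith

/-- Puts the walk in the form (char. function at t/√n)ⁿ for which the limit is known. -/
lemma charFun_signWalk (h : ℝ) (n : ℕ) (t : ℝ) :
    charFun (signWalk h n) t = charFun (signMeasure 1) (h * t) ^ n := by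
  induction n with
  | zero => simp [signWalk]
  | succ n ih =>
    rw [signWalk, charFun_conv, ih, pow_succ]
    congr 1
    simp only [charFun_apply_real, integral_signMeasure]
    push_cast
    ring_nf

/-- The central limit theorem for fair signs, through pointwise convergence of characteristic
functions. -/
lemma tendsto_integral_signWalk (φ : BoundedContinuousFunction ℝ ℝ) :
    Tendsto (fun n : ℕ => ∫ x, φ x ∂signWalk (√n)⁻¹ n) atTop
      (𝓝 (∫ x, φ x ∂gaussianReal 0 1)) := by
  have h := (ProbabilityMeasure.tendsto_iff_tendsto_charFun
    (μ := fun n : ℕ => (⟨signWalk (√n)⁻¹ n, inferInstance⟩ : ProbabilityMeasure ℝ))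
    (μ₀ := ⟨gaussianReal 0 1, inferInstance⟩)).2 fun t => ?_
  · exact ProbabilityMeasure.tendsto_iff_forall_integral_tendsto.1 h φ
  · have := tendsto_charFun_inv_sqrt_mul_pow (P := signMeasure 1) (X := id) aemeasurable_id
      (by simp [integral_signMeasure]) (by norm_num [integral_signMeasure]) t
    simp only [Measure.map_id] at this
    simpa [charFun_signWalk, charFun_gaussianReal, neg_div] using this

lemma tendsto_integral_signWalk_of_bound {φ : ℝ → ℝ} (hφ : Continuous φ) {B : ℝ}
    (hB : ∀ x, |φ x| ≤ B) :
    Tendsto (fun n : ℕ => ∫ x, φ x ∂signWalk (√n)⁻¹ n) atTop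
      (𝓝 (∫ x, φ x ∂gaussianReal 0 1)) :=
  tendsto_integral_signWalk (BoundedContinuousFunction.ofNormedAddCommGroup φ hφ B hB)

/-- The walk inequality with h = n^(-1/2), in the limit. The Lipschitz bound on T' controls the
error between the slope T(x+h) - T(x-h) = 2hT'(ξ) and the endpoint values of T', an error of order h
that vanishes after summing n·h² = 1. -/
lemma entropy_gaussianReal_sq_le_of_lipschitz {T T' : ℝ → ℝ} (hT : ∀ x, HasDerivAt T (T' x) x)
    {B : ℝ} (hTB : ∀ x, |T x| ≤ B) (hTB' : ∀ x, |T' x| ≤ B) {K : ℝ} (hK : 0 ≤ K)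
    (hlip : ∀ x y, |T' x - T' y| ≤ K * |x - y|) :
    entropy (gaussianReal 0 1) (fun y => T y ^ 2) ≤ 4 * ∫ y, T' y ^ 2 ∂gaussianReal 0 1 := by
  have hTc : Continuous T := continuous_iff_continuousAt.2 fun x => (hT x).continuousAt
  have hTc' : Continuous T' := (LipschitzWith.of_dist_le_mul (K := ⟨K, hK⟩) fun x y =>
    hlip x y).continuous
  have hB0 : 0 ≤ B := (abs_nonneg _).trans (hTB 0)
  have hsq : ∀ x, T x ^ 2 ≤ B ^ 2 := fun x => sq_le_sq' (abs_le.1 (hTB x)).1 (abs_le.1 (hTB x)).2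
  have hsq' : ∀ x, T' x ^ 2 ≤ B ^ 2 := fun x =>
    sq_le_sq' (abs_le.1 (hTB' x)).1 (abs_le.1 (hTB' x)).2
  obtain ⟨C, -, hC⟩ := exists_bound_mul_log (B ^ 2)
  have hent : Tendsto (fun n : ℕ => entropy (signWalk (√n)⁻¹ n) (fun y => T y ^ 2)) atTop
      (𝓝 (entropy (gaussianReal 0 1) (fun y => T y ^ 2))) := by
    refine Tendsto.sub (tendsto_integral_signWalk_of_bound
      (Real.continuous_mul_log.comp (hTc.pow 2)) (fun x => hC _ (sq_nonneg _) (hsq x)))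
      ((Real.continuous_mul_log.tendsto _).comp (tendsto_integral_signWalk_of_bound
      (hTc.pow 2) (B := B ^ 2) fun x => ?_))
    rw [abs_of_nonneg (sq_nonneg _)]; exact hsq x
  have hint : Tendsto (fun n : ℕ => ∫ y, T' y ^ 2 ∂signWalk (√n)⁻¹ n) atTop
      (𝓝 (∫ y, T' y ^ 2 ∂gaussianReal 0 1)) :=
    tendsto_integral_signWalk_of_bound (hTc'.pow 2) (B := B ^ 2) fun x => by
      rw [abs_of_nonneg (sq_nonneg _)]; exact hsq' x
  have hinv : Tendsto (fun n : ℕ => (√n)⁻¹) atTop (𝓝 0) :=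
    tendsto_inv_atTop_zero.comp (Real.tendsto_sqrt_atTop.comp tendsto_natCast_atTop_atTop)
  have hrhs : Tendsto (fun n : ℕ => 4 * (∫ y, T' y ^ 2 ∂signWalk (√n)⁻¹ n)
      + 16 * B * K * (√n)⁻¹) atTop (𝓝 (4 * ∫ y, T' y ^ 2 ∂gaussianReal 0 1)) := by
    simpa using (hint.const_mul 4).add (hinv.const_mul (16 * B * K))
  refine le_of_tendsto_of_tendsto hent hrhs ?_
  filter_upwards [eventually_ge_atTop 1] with n hn
  set h : ℝ := (√n)⁻¹ with hh
  have hnpos : (0 : ℝ) < n := by exact_mod_cast hn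
  have hpos : 0 < h := inv_pos.2 (Real.sqrt_pos.2 hnpos)
  have hnh : n * h ^ 2 = 1 := by
    rw [hh, inv_pow, Real.sq_sqrt hnpos.le, mul_inv_cancel₀ hnpos.ne']
  -- The term 4BKh bounds T'(ξ)² - T'(y)² for |ξ - y| ≤ 2h: a difference of at most 2Kh times a sum
  -- of at most 2B.
  set W : ℝ → ℝ := fun y => 4 * h ^ 2 * (T' y ^ 2 + 4 * B * K * h) with hW
  have hstep : ∀ x, (T (x + h) - T (x - h)) ^ 2 ≤ (W (x + h) + W (x - h)) / 2 := by
    intro x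
    obtain ⟨ξ, hξ, hξe⟩ := exists_hasDerivAt_eq_slope T T' (by linarith : x - h < x + h)
      hTc.continuousOn fun y _ => hT y
    rw [eq_div_iff (by linarith)] at hξe
    have hcmp : ∀ y, |ξ - y| ≤ 2 * h → T' ξ ^ 2 ≤ T' y ^ 2 + 4 * B * K * h := by
      intro y hy
      have h1 := (hlip ξ y).trans (mul_le_mul_of_nonneg_left hy hK)
      have h2 : |T' ξ + T' y| ≤ 2 * B := (abs_add_le _ _).trans (by linarith [hTB' ξ, hTB' y])
      have h3 : (T' ξ - T' y) * (T' ξ + T' y) ≤ (K * (2 * h)) * (2 * B) :=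
        (le_abs_self _).trans (by
          rw [abs_mul]; exact mul_le_mul h1 h2 (abs_nonneg _) (by positivity))
      nlinarith
    have c1 := hcmp (x + h) (abs_le.2 ⟨by linarith [hξ.1], by linarith [hξ.2]⟩)
    have c2 := hcmp (x - h) (abs_le.2 ⟨by linarith [hξ.1], by linarith [hξ.2]⟩)
    have : (T (x + h) - T (x - h)) ^ 2 = 4 * h ^ 2 * T' ξ ^ 2 := by rw [← hξe]; ring
    rw [this, hW]
    have h4 : 0 ≤ 4 * h ^ 2 := by positivity
    have := mul_le_mul_of_nonneg_left c1 h4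
    have := mul_le_mul_of_nonneg_left c2 h4
    simp only; linarith
  have hWB : ∀ x, |W x| ≤ max B (4 * h ^ 2 * (B ^ 2 + 4 * B * K * h)) := fun x => by
    rw [hW, abs_of_nonneg (by positivity)]
    exact le_max_of_le_right (mul_le_mul_of_nonneg_left (by linarith [hsq' x]) (by positivity))
  have hWm : Measurable W := by
    have := hTc'.measurable
    fun_prop
  refine (entropy_signWalk_sq_le n hTc.measurable hWm (fun x => (hTB x).trans (le_max_left _ _))
    hWB hstep).trans_eq ?_
  have hi : Integrable (fun y => T' y ^ 2) (signWalk h n) :=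
    integrable_of_measurable_of_abs_le (hTc'.measurable.pow_const 2) (B := B ^ 2) fun x => by
      rw [abs_of_nonneg (sq_nonneg _)]; exact hsq' x
  rw [hW, integral_const_mul, integral_add hi (integrable_const _)]
  simp only [integral_const, probReal_univ, one_smul]
  linear_combination (4 * (∫ y, T' y ^ 2 ∂signWalk h n) + 16 * B * K * h) * hnh

/-- The symmetric difference quotient. -/
def symmQuot (A : ℝ → ℝ) (ε x : ℝ) : ℝ := (A (x + ε) - A (x - ε)) / (2 * ε)

lemma tendsto_symmQuot {A : ℝ → ℝ} {a x : ℝ} (hA : HasDerivAt A a x) {ε : ℕ → ℝ}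
    (hpos : ∀ n, 0 < ε n) (hε : Tendsto ε atTop (𝓝 0)) :
    Tendsto (fun n => symmQuot A (ε n) x) atTop (𝓝 a) := by
  have hs := hasDerivAt_iff_tendsto_slope_zero.1 hA
  have h1 : Tendsto ε atTop (𝓝[≠] 0) :=
    tendsto_nhdsWithin_iff.2 ⟨hε, .of_forall fun n => (hpos n).ne'⟩
  have h2 : Tendsto (fun n => -ε n) atTop (𝓝[≠] 0) :=
    tendsto_nhdsWithin_iff.2 ⟨by simpa using hε.neg,
      .of_forall fun n => (neg_ne_zero.2 (hpos n).ne')⟩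
  have := ((hs.comp h1).add (hs.comp h2)).div_const 2
  rw [add_self_div_two] at this
  refine this.congr fun n => ?_
  have := (hpos n).ne'
  simp only [Function.comp, symmQuot, smul_eq_mul, ← sub_eq_add_neg]
  field_simp
  ring

lemma abs_symmQuot_le {A A' : ℝ → ℝ} (hA : ∀ x, HasDerivAt A (A' x) x) {B : ℝ}
    (hB : ∀ x, |A' x| ≤ B) {ε : ℝ} (hε : 0 < ε) (x : ℝ) : |symmQuot A ε x| ≤ B := by
  obtain ⟨ξ, -, h⟩ := exists_hasDerivAt_eq_slope A A' (by linarith : x - ε < x + ε)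
    (fun y _ => (hA y).continuousAt.continuousWithinAt) fun y _ => hA y
  rw [symmQuot, show 2 * ε = x + ε - (x - ε) by ring, ← h]
  exact hB ξ

lemma hasDerivAt_symmQuot {A A' : ℝ → ℝ} (hA : ∀ x, HasDerivAt A (A' x) x) (ε x : ℝ) :
    HasDerivAt (symmQuot A ε) (symmQuot A' ε x) x := by
  have h1 : HasDerivAt (fun y => A (y + ε)) (A' (x + ε)) x := (hA _).comp_add_const x ε
  have h2 : HasDerivAt (fun y => A (y - ε)) (A' (x - ε)) x := (hA _).comp_sub_const x ε
  exact (h1.sub h2).div_const _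

/-- A log-Sobolev inequality for the standard Gaussian law, with constant `2`. -/
theorem entropy_gaussianReal_sq_le {T T' : ℝ → ℝ} (hT : ∀ x, HasDerivAt T (T' x) x)
    {B : ℝ} (hTB : ∀ x, |T x| ≤ B) (hTB' : ∀ x, |T' x| ≤ B) :
    entropy (gaussianReal 0 1) (fun y => T y ^ 2) ≤ 4 * ∫ y, T' y ^ 2 ∂gaussianReal 0 1 := by
  have hTc : Continuous T := continuous_iff_continuousAt.2 fun x => (hT x).continuousAt
  have hB0 : 0 ≤ B := (abs_nonneg _).trans (hTB 0)
  have hsqle : ∀ a : ℝ, |a| ≤ B → a ^ 2 ≤ B ^ 2 := fun a h =>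
    sq_le_sq' (abs_le.1 h).1 (abs_le.1 h).2
  -- Averaging T over [x-ε, x+ε] is the symmetric quotient of its antiderivative. The average keeps
  -- both bounds, and its derivative is the symmetric quotient of T, which is (B/ε)-Lipschitz.
  set A : ℝ → ℝ := fun x => ∫ s in (0 : ℝ)..x, T s with hAdef
  have hA : ∀ x, HasDerivAt A (T x) x := fun x =>
    intervalIntegral.integral_hasDerivAt_right (hTc.intervalIntegrable _ _)
      hTc.stronglyMeasurable.stronglyMeasurableAtFilter hTc.continuousAt
  set ε : ℕ → ℝ := fun n => 1 / ((n : ℝ) + 1) with hε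
  have hpos : ∀ n, 0 < ε n := fun n => by positivity
  have hlim : Tendsto ε atTop (𝓝 0) := tendsto_one_div_add_atTop_nhds_zero_nat
  have hd : ∀ n x, HasDerivAt (symmQuot A (ε n)) (symmQuot T (ε n) x) x := fun n x =>
    hasDerivAt_symmQuot hA _ x
  have hc : ∀ n, Continuous (symmQuot A (ε n)) := fun n =>
    continuous_iff_continuousAt.2 fun x => (hd n x).continuousAt
  have hc' : ∀ n, Continuous (symmQuot T (ε n)) := fun n =>
    continuous_iff_continuousAt.2 fun x => (hasDerivAt_symmQuot hT _ x).continuousAt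
  refine le_of_tendsto_of_tendsto' (b := atTop) (f := fun n => entropy (gaussianReal 0 1)
    (fun y => symmQuot A (ε n) y ^ 2))
    (g := fun n => 4 * ∫ y, symmQuot T (ε n) y ^ 2 ∂gaussianReal 0 1) ?_ ?_ fun n => ?_
  · refine tendsto_entropy (fun n => (hc n).measurable.pow_const 2) (fun n z => sq_nonneg _)
      (fun n z => hsqle _ (abs_symmQuot_le hA hTB (hpos n) z))
      fun z => (tendsto_symmQuot (hA z) hpos hlim).pow 2
  · refine Tendsto.const_mul 4 (tendsto_integral_of_dominated_convergence (fun _ => B ^ 2)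
      (fun n => ((hc' n).measurable.pow_const 2).aestronglyMeasurable) (integrable_const _)
      (fun n => ae_of_all _ fun z => ?_)
      (ae_of_all _ fun z => (tendsto_symmQuot (hT z) hpos hlim).pow 2))
    rw [Real.norm_of_nonneg (sq_nonneg _)]
    exact hsqle _ (abs_symmQuot_le hT hTB' (hpos n) z)
  · refine entropy_gaussianReal_sq_le_of_lipschitz (hd n)
      (abs_symmQuot_le hA hTB (hpos n)) (abs_symmQuot_le hT hTB' (hpos n))
      (K := B / ε n) (div_nonneg hB0 (hpos n).le) fun x y => ?_
    have hl : ∀ x y, |T x - T y| ≤ B * |x - y| := fun x y => by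
      simpa using Convex.norm_image_sub_le_of_norm_hasDerivWithin_le (f := T) (f' := T') (C := B)
        (s := Set.univ) (fun z _ => (hT z).hasDerivWithinAt) (fun z _ => hTB' z) convex_univ
        (Set.mem_univ y) (Set.mem_univ x)
    have h1 := hl (x + ε n) (y + ε n)
    have h2 := hl (x - ε n) (y - ε n)
    rw [add_sub_add_right_eq_sub] at h1
    rw [sub_sub_sub_cancel_right] at h2
    rw [symmQuot, symmQuot, ← sub_div, abs_div, abs_of_pos (by linarith [hpos n] : 0 < 2 * ε n),
      div_le_iff₀ (by linarith [hpos n])]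
    have h3 : B / ε n * |x - y| * (2 * ε n) = 2 * (B * |x - y|) := by
      have := (hpos n).ne'
      field_simp
    rw [h3]
    calc _ = |(T (x + ε n) - T (y + ε n)) - (T (x - ε n) - T (y - ε n))| := by ring_nf
      _ ≤ _ := (abs_sub _ _).trans (by linarith)

end TamedKinetic
end

noncomputable section

open MeasureTheory ProbabilityTheory Filter Topology
open scoped ENNReal Matrix MatrixOrder

namespace TamedKinetic

/-! ### Log-Sobolev inequalities with a general energy form -/

section FormLSI

variable {F : Type*} [NormedAddCommGroup F] [InnerProductSpace ℝ F] [CompleteSpace F]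

lemma continuous_gradient_of_contDiff {f : F → ℝ} (hf : ContDiff ℝ 1 f) :
    Continuous (gradient f) :=
  (InnerProductSpace.toDual ℝ F).symm.continuous.comp (hf.continuous_fderiv (by simp))

lemma gradient_comp_add_const (f : F → ℝ) (y x : F) :
    gradient (fun z => f (z + y)) x = gradient f (x + y) := by
  simp only [gradient, fderiv_comp_add_right]

variable [MeasurableSpace F]

/-- The log-Sobolev inequality `Ent_μ(f²) ≤ 2 ∫ Q(∇f) dμ`. -/
def FormLSI (μ : Measure F) (Q : F → ℝ) : Prop :=
  ∀ f : F → ℝ, ContDiff ℝ 1 f → (∃ B : ℝ, ∀ z, |f z| ≤ B) → (∃ B : ℝ, ∀ z, ‖gradient f z‖ ≤ B) →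
    entropy μ (fun z => f z ^ 2) ≤ 2 * ∫ z, Q (gradient f z) ∂μ

lemma formLSI_iff_satisfiesLSI {μ : Measure F} {C : ℝ} :
    FormLSI μ (fun ξ => C * ‖ξ‖ ^ 2) ↔ SatisfiesLSI μ C := by
  simp only [FormLSI, SatisfiesLSI, integral_const_mul, mul_assoc]

/-- Convolution with `ν` adds the form `Q'` to the energy of any log-Sobolev inequality. -/
def AddsForm (ν : Measure F) (Q' : F → ℝ) : Prop :=
  ∀ (μ : Measure F) [IsProbabilityMeasure μ] (Q : F → ℝ), Continuous Q → FormLSI μ Q →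
    FormLSI (μ ∗ ν) (fun ξ => Q ξ + Q' ξ)

variable [BorelSpace F] [FiniteDimensional ℝ F]

lemma exists_bound_of_continuous {F : Type*} [NormedAddCommGroup F] [InnerProductSpace ℝ F]
    [FiniteDimensional ℝ F] {Q : F → ℝ} (hQ : Continuous Q) (B : ℝ) :
    ∃ D : ℝ, ∀ ξ, ‖ξ‖ ≤ B → |Q ξ| ≤ D := by
  have := FiniteDimensional.proper_real F
  obtain ⟨D, hD⟩ := (isCompact_closedBall (0 : F) B).exists_bound_of_continuousOn hQ.continuousOn
  exact ⟨D, fun ξ hξ => hD ξ (by simpa using hξ)⟩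

lemma integrable_form_gradient {μ : Measure F} [IsProbabilityMeasure μ] {Q : F → ℝ}
    (hQ : Continuous Q) {f : F → ℝ} (hf : ContDiff ℝ 1 f) {B : ℝ}
    (hB : ∀ z, ‖gradient f z‖ ≤ B) : Integrable (fun z => Q (gradient f z)) μ := by
  obtain ⟨D, hD⟩ := exists_bound_of_continuous hQ B
  exact integrable_of_measurable_of_abs_le
    (hQ.comp (continuous_gradient_of_contDiff hf)).measurable fun z => hD _ (hB z)

lemma FormLSI.mono {μ : Measure F} [IsProbabilityMeasure μ] {Q Q' : F → ℝ} (h : FormLSI μ Q)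
    (hQ : Continuous Q) (hQ' : Continuous Q') (hle : ∀ ξ, Q ξ ≤ Q' ξ) : FormLSI μ Q' := by
  intro f hf hb ⟨B, hB⟩
  refine (h f hf hb ⟨B, hB⟩).trans (mul_le_mul_of_nonneg_left ?_ zero_le_two)
  exact integral_mono (integrable_form_gradient hQ hf hB) (integrable_form_gradient hQ' hf hB)
    fun z => hle _

variable [SecondCountableTopology F]

lemma AddsForm.mono {ν : Measure F} [IsProbabilityMeasure ν] {Q Q' : F → ℝ} (h : AddsForm ν Q)
    (hQ : Continuous Q) (hQ' : Continuous Q') (hle : ∀ ξ, Q ξ ≤ Q' ξ) : AddsForm ν Q' := by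
  intro μ _ Q₀ hQ₀ hμ
  exact (h μ Q₀ hQ₀ hμ).mono (hQ₀.add hQ) (hQ₀.add hQ') fun ξ => add_le_add_right (hle ξ) _

lemma addsForm_dirac_zero : AddsForm (Measure.dirac (0 : F)) (fun _ => 0) := by
  intro μ _ Q hQ hμ
  simpa using hμ

lemma AddsForm.conv {ν₁ ν₂ : Measure F} [IsProbabilityMeasure ν₁] [IsProbabilityMeasure ν₂]
    {Q₁ Q₂ : F → ℝ} (h₁ : AddsForm ν₁ Q₁) (h₂ : AddsForm ν₂ Q₂) (hQ₁ : Continuous Q₁) :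
    AddsForm (ν₁ ∗ ν₂) (fun ξ => Q₁ ξ + Q₂ ξ) := by
  intro μ _ Q hQ hμ
  have := h₂ (μ ∗ ν₁) _ (hQ.add hQ₁) (h₁ μ Q hQ hμ)
  rw [Measure.conv_assoc] at this
  simpa only [Pi.add_apply, add_assoc] using this

/-- Adding an independent one-dimensional Gaussian in direction `e`. -/
lemma addsForm_gaussian_line (e : F) :
    AddsForm ((gaussianReal 0 1).map fun t : ℝ => t • e) (fun ξ => 2 * inner ℝ e ξ ^ 2) := by
  intro μ _ Q hQ hμ f hf ⟨A, hA⟩ ⟨B, hB⟩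
  have hem : Measurable fun t : ℝ => t • e := by fun_prop
  have : IsProbabilityMeasure ((gaussianReal 0 1).map fun t : ℝ => t • e) :=
    Measure.isProbabilityMeasure_map hem.aemeasurable
  set ν := (gaussianReal 0 1).map fun t : ℝ => t • e with hν
  have hfm : Measurable f := hf.continuous.measurable
  have hgc := continuous_gradient_of_contDiff hf
  have hQe : Continuous fun ξ : F => 2 * inner ℝ e ξ ^ 2 := by fun_prop
  have hsq : ∀ z, f z ^ 2 ≤ A ^ 2 := fun z => sq_le_sq' (abs_le.1 (hA z)).1 (abs_le.1 (hA z)).2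
  have i1 := integrable_form_gradient (μ := μ ∗ ν) hQ hf hB
  have i1' := integrable_form_gradient (μ := ν ∗ μ) hQ hf hB
  have i2 := integrable_form_gradient (μ := μ ∗ ν) hQe hf hB
  obtain ⟨C, -, hC⟩ := exists_bound_mul_log (A ^ 2)
  have hgm : Measurable fun p : F × F => f (p.1 + p.2) ^ 2 :=
    (hfm.comp measurable_add).pow_const 2
  -- For fixed y, the inequality for μ applied to the translate of f by y.
  have e1 : ∫ y, entropy μ (fun x => f (x + y) ^ 2) ∂ν
      ≤ 2 * ∫ z, Q (gradient f z) ∂(μ ∗ ν) := by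
    rw [Measure.conv_comm, integral_conv i1', ← integral_const_mul]
    refine integral_mono (integrable_of_measurable_of_abs_le (measurable_entropy_left hgm)
      fun y => abs_entropy_le ((hfm.comp (measurable_add_const y)).pow_const 2)
        (fun _ => sq_nonneg _) (fun _ => hsq _) hC)
      ((Integrable.integral_prod_left ((integrable_map_measure
        (hQ.comp hgc).aestronglyMeasurable (by fun_prop)).1 i1')).const_mul 2) fun y => ?_
    have := hμ (fun x => f (x + y)) (hf.comp (contDiff_id.add contDiff_const))
      ⟨A, fun z => hA _⟩ ⟨B, fun z => by rw [gradient_comp_add_const]; exact hB _⟩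
    simp only [gradient_comp_add_const] at this
    simpa only [add_comm] using this
  -- For fixed x, the one-dimensional inequality along the line x + te, where the derivative of f is
  -- ⟨e, ∇f⟩.
  have e2 : ∫ x, entropy ν (fun y => f (x + y) ^ 2) ∂μ
      ≤ 2 * ∫ z, 2 * inner ℝ e (gradient f z) ^ 2 ∂(μ ∗ ν) := by
    rw [integral_conv i2, ← integral_const_mul]
    refine integral_mono (integrable_of_measurable_of_abs_le (measurable_entropy_right hgm)
      fun y => abs_entropy_le ((hfm.comp (measurable_const_add y)).pow_const 2)
        (fun _ => sq_nonneg _) (fun _ => hsq _) hC)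
      ((Integrable.integral_prod_left ((integrable_map_measure
        (hQe.comp hgc).aestronglyMeasurable (by fun_prop)).1 i2)).const_mul 2) fun x => ?_
    have hd : ∀ t : ℝ, HasDerivAt (fun t : ℝ => f (x + t • e))
        (inner ℝ e (gradient f (x + t • e))) t := by
      intro t
      have h1 : HasDerivAt (fun t : ℝ => x + t • e) e t := by
        simpa using ((hasDerivAt_id t).smul_const e).const_add x
      have h2 := (hf.differentiable (by simp) (x + t • e)).hasFDerivAt.comp_hasDerivAt t h1
      rw [real_inner_comm, inner_gradient_left]
      exact h2
    have := entropy_gaussianReal_sq_le hd (B := max A (‖e‖ * B))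
      (fun t => (hA _).trans (le_max_left _ _))
      (fun t => ((abs_real_inner_le_norm _ _).trans
        (mul_le_mul_of_nonneg_left (hB _) (norm_nonneg _))).trans (le_max_right _ _))
    simp only
    rw [hν, entropy_map hem (g := fun y => f (x + y) ^ 2)
      ((hfm.comp (measurable_const_add x)).pow_const 2), integral_map hem.aemeasurable
      (by
        refine Continuous.aestronglyMeasurable ?_
        exact hQe.comp (hgc.comp (continuous_const_add x))), integral_const_mul]
    linarith
  have := entropy_conv_le (μ := μ) (ν := ν) (hfm.pow_const 2) (fun z => sq_nonneg _) hsq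
  rw [integral_add i1 i2]
  linarith

/-- Adding an independent planar Gaussian vector mapped linearly into `F`. -/
lemma addsForm_gaussian_plane {S : Matrix (Fin 2) (Fin 2) ℝ} (hS : S.PosSemidef) (u₀ u₁ : F) :
    AddsForm ((multivariateGaussian 0 S).map
      fun z : EuclideanSpace ℝ (Fin 2) => z 0 • u₀ + z 1 • u₁)
      (fun ξ => 2 * (S 0 0 * inner ℝ u₀ ξ ^ 2 + (S 0 1 + S 1 0) * (inner ℝ u₀ ξ * inner ℝ u₁ ξ)
        + S 1 1 * inner ℝ u₁ ξ ^ 2)) := by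
  -- The rows of B split the planar Gaussian into two independent Gaussians carried by lines; a
  -- degenerate S is allowed.
  obtain ⟨B, hB⟩ : ∃ B : Matrix (Fin 2) (Fin 2) ℝ, S = B.transpose * B := by
    obtain ⟨B, hB⟩ := CStarAlgebra.nonneg_iff_eq_star_mul_self.1 (Matrix.nonneg_iff_posSemidef.2 hS)
    exact ⟨B, by
      rw [hB, Matrix.star_eq_conjTranspose, Matrix.conjTranspose_eq_transpose_of_trivial]⟩
  have hSB : ∀ i j, S i j = B 0 i * B 0 j + B 1 i * B 1 j := fun i j => by
    rw [hB, Matrix.mul_apply, Fin.sum_univ_two]; rfl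
  set e : Fin 2 → F := fun i => B i 0 • u₀ + B i 1 • u₁ with he
  have hQ : ∀ ξ, S 0 0 * inner ℝ u₀ ξ ^ 2 + (S 0 1 + S 1 0) * (inner ℝ u₀ ξ * inner ℝ u₁ ξ)
        + S 1 1 * inner ℝ u₁ ξ ^ 2 = inner ℝ (e 0) ξ ^ 2 + inner ℝ (e 1) ξ ^ 2 := fun ξ => by
    simp only [he, inner_add_left, real_inner_smul_left, hSB]
    ring
  have hm : ∀ e : F, Measurable fun t : ℝ => t • e := fun e => by fun_prop
  have hp : ∀ e : F, IsProbabilityMeasure ((gaussianReal 0 1).map fun t : ℝ => t • e) := fun e =>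
    Measure.isProbabilityMeasure_map (hm e).aemeasurable
  have hcf : ∀ e t : F, charFun ((gaussianReal 0 1).map fun t : ℝ => t • e) t
      = Complex.exp (-(inner ℝ e t ^ 2 : ℝ) / 2) := fun e t => by
    rw [charFun_apply, integral_map (hm e).aemeasurable (by fun_prop)]
    have := charFun_gaussianReal (μ := 0) (v := 1) (inner ℝ e t)
    rw [charFun_apply_real] at this
    simp only [real_inner_smul_left]
    push_cast at this ⊢
    simp only [mul_comm (inner ℝ e t : ℂ)] at this
    rw [this]
    congr 1
    simp
    ring
  have hlm : Measurable fun z : EuclideanSpace ℝ (Fin 2) => z 0 • u₀ + z 1 • u₁ := by fun_prop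
  have hpm : IsProbabilityMeasure ((multivariateGaussian 0 S).map
      fun z : EuclideanSpace ℝ (Fin 2) => z 0 • u₀ + z 1 • u₁) :=
    Measure.isProbabilityMeasure_map hlm.aemeasurable
  have hlaw : (multivariateGaussian 0 S).map
      (fun z : EuclideanSpace ℝ (Fin 2) => z 0 • u₀ + z 1 • u₁)
      = ((gaussianReal 0 1).map fun t : ℝ => t • e 0) ∗
        ((gaussianReal 0 1).map fun t : ℝ => t • e 1) := by
    refine Measure.ext_of_charFun (funext fun t => ?_)
    rw [charFun_conv, hcf, hcf, ← Complex.exp_add, charFun_apply,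
      integral_map hlm.aemeasurable (by fun_prop)]
    have := charFun_multivariateGaussian (μ := 0) hS !₂[inner ℝ u₀ t, inner ℝ u₁ t]
    rw [charFun_apply] at this
    convert this using 1
    · refine integral_congr_ae (ae_of_all _ fun z => ?_)
      simp only [inner_add_left, real_inner_smul_left, PiLp.inner_apply, Fin.sum_univ_two]
      simp [mul_comm]
    · congr 1
      rw [← sub_eq_zero]
      simp only [inner_zero_right, Complex.ofReal_zero, zero_mul, zero_sub]
      have h1 := hQ t
      have h2 : (WithLp.ofLp !₂[inner ℝ u₀ t, inner ℝ u₁ t]) ⬝ᵥ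
          (S.mulVec (WithLp.ofLp !₂[inner ℝ u₀ t, inner ℝ u₁ t]))
          = inner ℝ (e 0) t ^ 2 + inner ℝ (e 1) t ^ 2 := by
        rw [← h1]
        simp [Matrix.mulVec, dotProduct, Fin.sum_univ_two]
        ring
      rw [h2]
      push_cast
      ring
  rw [hlaw]
  simp only [hQ, mul_add]
  exact (addsForm_gaussian_line (e 0)).conv (addsForm_gaussian_line (e 1)) (by fun_prop)

/-- Sums of independent variables. -/
lemma addsForm_sum {Ω ι : Type*} [MeasurableSpace Ω] {P : Measure Ω} [IsProbabilityMeasure P]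
    [DecidableEq ι] {Y : ι → Ω → F} (hY : ∀ i, Measurable (Y i)) (hind : iIndepFun Y P)
    {Q : ι → F → ℝ} (hQc : ∀ i, Continuous (Q i)) (h : ∀ i, AddsForm (P.map (Y i)) (Q i))
    (s : Finset ι) : AddsForm (P.map (∑ i ∈ s, Y i)) (fun ξ => ∑ i ∈ s, Q i ξ) := by
  have hp : ∀ i, IsProbabilityMeasure (P.map (Y i)) := fun i =>
    Measure.isProbabilityMeasure_map (hY i).aemeasurable
  induction s using Finset.induction_on with
  | empty =>
    have : P.map (0 : Ω → F) = Measure.dirac 0 := by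
      change P.map (fun _ => (0 : F)) = _
      simp [Measure.map_const]
    simpa [this] using addsForm_dirac_zero
  | insert i s hi ih =>
    have hs : Measurable (∑ j ∈ s, Y j) := by
      convert Finset.measurable_sum s fun j _ => hY j using 1
      ext ω
      simp
    have : IsProbabilityMeasure (P.map (∑ j ∈ s, Y j)) :=
      Measure.isProbabilityMeasure_map hs.aemeasurable
    simp only [Finset.sum_insert hi]
    rw [IndepFun.map_add_eq_map_conv_map (hY i) hs
      (hind.indepFun_finsetSum_of_notMem hY hi).symm]
    exact (h i).conv ih (hQc i)

end FormLSI
end TamedKinetic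
end

noncomputable section

open MeasureTheory ProbabilityTheory Filter Topology

namespace TamedKinetic

/-! ### Stability of the log-Sobolev inequality under Lipschitz maps -/

section Mollify

variable {F : Type*} [NormedAddCommGroup F] [InnerProductSpace ℝ F]
  [MeasurableSpace F] [BorelSpace F] [FiniteDimensional ℝ F]

/-- The mollification of `T` by a bump function. -/
def mollify (φ : ContDiffBump (0 : F)) (T : F → ℝ) : F → ℝ :=
  convolution (φ.normed Measure.addHaar) T (ContinuousLinearMap.lsmul ℝ ℝ) Measure.addHaar

variable (φ : ContDiffBump (0 : F)) {T : F → ℝ}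

lemma mollify_apply (z : F) :
    mollify φ T z = ∫ y, φ.normed Measure.addHaar y * T (z - y) ∂Measure.addHaar := rfl

lemma contDiff_mollify (hT : Continuous T) : ContDiff ℝ 1 (mollify φ T) :=
  φ.hasCompactSupport_normed.contDiff_convolution_left (n := 1) _ φ.contDiff_normed
    hT.locallyIntegrable

lemma integrable_normed_mul (hT : Continuous T) (z : F) :
    Integrable (fun y => φ.normed Measure.addHaar y * T (z - y)) Measure.addHaar :=
  Continuous.integrable_of_hasCompactSupport (by
    have := φ.continuous_normed (μ := Measure.addHaar)
    fun_prop) φ.hasCompactSupport_normed.mul_right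

lemma abs_integral_normed_mul_le {D : ℝ} {S : F → ℝ} (hD : ∀ y, ‖y‖ < φ.rOut → |S y| ≤ D) :
    |∫ y, φ.normed Measure.addHaar y * S y ∂Measure.addHaar| ≤ D := by
  have h := norm_integral_le_of_norm_le (μ := Measure.addHaar)
    (f := fun y => φ.normed Measure.addHaar y * S y)
    (g := fun y => φ.normed Measure.addHaar y * D) (φ.integrable_normed.mul_const D)
    (ae_of_all _ fun y => ?_)
  · rwa [integral_mul_const, φ.integral_normed, one_mul] at h
  · rw [norm_mul, Real.norm_of_nonneg (φ.nonneg_normed y)]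
    by_cases hy : ‖y‖ < φ.rOut
    · exact mul_le_mul_of_nonneg_left (hD y hy) (φ.nonneg_normed y)
    · have : φ.normed Measure.addHaar y = 0 := by
        rw [← Function.notMem_support, φ.support_normed_eq]
        simpa using hy
      simp [this]

lemma abs_mollify_le {B : ℝ} (hB : ∀ z, |T z| ≤ B) (z : F) : |mollify φ T z| ≤ B :=
  abs_integral_normed_mul_le φ fun _ _ => hB _

/-- Mollification averages translates, so it inherits the local Lipschitz constant. The radius
doubles: one `rOut` for the point near z, one for the shift. -/
lemma norm_gradient_mollify_le [CompleteSpace F] (hT : Continuous T) {D : ℝ} (hD : 0 ≤ D) {z : F}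
    (h : ∀ x ∈ Metric.ball z (2 * φ.rOut), ∀ y ∈ Metric.ball z (2 * φ.rOut),
      |T x - T y| ≤ D * ‖x - y‖) : ‖gradient (mollify φ T) z‖ ≤ D := by
  rw [gradient, LinearIsometryEquiv.norm_map]
  refine norm_fderiv_le_of_lip' ℝ hD ?_
  filter_upwards [Metric.ball_mem_nhds z φ.rOut_pos] with x hx
  rw [mollify_apply, mollify_apply,
    ← integral_sub (integrable_normed_mul φ hT x) (integrable_normed_mul φ hT z)]
  simp only [← mul_sub]
  refine abs_integral_normed_mul_le φ fun y hy => ?_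
  have hxz : ‖x - z‖ < φ.rOut := by simpa [dist_eq_norm] using hx
  have h1 : x - y ∈ Metric.ball z (2 * φ.rOut) := by
    rw [Metric.mem_ball, dist_eq_norm]
    calc ‖x - y - z‖ = ‖(x - z) - y‖ := by congr 1; abel
      _ ≤ ‖x - z‖ + ‖y‖ := norm_sub_le _ _
      _ < 2 * φ.rOut := by linarith
  have h2 : z - y ∈ Metric.ball z (2 * φ.rOut) := by
    rw [Metric.mem_ball, dist_eq_norm, sub_sub_cancel_left, norm_neg]
    linarith [φ.rOut_pos]
  simpa using h _ h1 _ h2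

end Mollify

section Lipschitz

variable {F : Type*} [NormedAddCommGroup F] [InnerProductSpace ℝ F] [CompleteSpace F]

lemma hasGradientAt_of_apply {f : F → ℝ} {f' : F →L[ℝ] ℝ} {g z : F} (h : HasFDerivAt f f' z)
    (hg : ∀ w, f' w = inner ℝ g w) : HasGradientAt f g z := by
  have : InnerProductSpace.toDual ℝ F g = f' := by
    ext w
    simp [hg]
  rw [hasGradientAt_iff_hasFDerivAt, this]
  exact h

/-- A chain rule for Φ merely Lipschitz: the ball around z is mapped into a convex ball on which f
is b-Lipschitz. -/
lemma abs_comp_sub_le_of_lipschitz {f : F → ℝ} (hf : Differentiable ℝ f) {Φ : F → F} {K : NNReal}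
    (hΦ : LipschitzWith K Φ) {z : F} {ρ b : ℝ} (hb : 0 ≤ b)
    (hbd : ∀ w, dist w (Φ z) ≤ K * ρ → ‖gradient f w‖ ≤ b) {x y : F}
    (hx : x ∈ Metric.ball z ρ) (hy : y ∈ Metric.ball z ρ) :
    |f (Φ x) - f (Φ y)| ≤ K * b * ‖x - y‖ := by
  have hmem : ∀ x ∈ Metric.ball z ρ, Φ x ∈ Metric.closedBall (Φ z) (K * ρ) := fun x hx =>
    (hΦ.dist_le_mul x z).trans (mul_le_mul_of_nonneg_left (Metric.mem_ball.1 hx).le K.2)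
  have h1 := Convex.norm_image_sub_le_of_norm_fderiv_le (𝕜 := ℝ) (f := f) (C := b)
    (s := Metric.closedBall (Φ z) (K * ρ)) (fun w _ => hf w)
    (fun w hw => by
      have := hbd w hw
      rwa [gradient, LinearIsometryEquiv.norm_map] at this)
    (convex_closedBall _ _) (hmem y hy) (hmem x hx)
  have h2 := hΦ.dist_le_mul x y
  rw [dist_eq_norm, dist_eq_norm] at h2
  calc _ ≤ b * ‖Φ x - Φ y‖ := h1
    _ ≤ b * (K * ‖x - y‖) := mul_le_mul_of_nonneg_left h2 hb
    _ = _ := by ring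

variable [MeasurableSpace F] [BorelSpace F]

/-- The constant of a log-Sobolev inequality on a nontrivial space is nonnegative. -/
lemma SatisfiesLSI.nonneg [Nontrivial F] {μ : Measure F} [IsProbabilityMeasure μ] {C : ℝ}
    (h : SatisfiesLSI μ C) : 0 ≤ C := by
  -- Testing with sin⟨e, z⟩ and cos⟨e, z⟩: the energies add up to 1 while both entropies are
  -- nonnegative.
  obtain ⟨e, he⟩ := exists_norm_eq F zero_le_one
  have hs : ∀ z, HasGradientAt (fun z : F => Real.sin (inner ℝ e z))
      (Real.cos (inner ℝ e z) • e) z := by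
    exact fun z => hasGradientAt_of_apply ((innerSL ℝ e).hasFDerivAt (x := z)).sin fun w => by
      simp [real_inner_smul_left]
  have hc : ∀ z, HasGradientAt (fun z : F => Real.cos (inner ℝ e z))
      (-Real.sin (inner ℝ e z) • e) z := by
    exact fun z => hasGradientAt_of_apply ((innerSL ℝ e).hasFDerivAt (x := z)).cos fun w => by
      simp [real_inner_smul_left]
  have hcd : ContDiff ℝ 1 fun z : F => (inner ℝ e z : ℝ) := (innerSL ℝ e).contDiff
  have h1 := h _ hcd.sin ⟨1, fun z => Real.abs_sin_le_one _⟩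
    ⟨1, fun z => by rw [(hs z).gradient, norm_smul, he, mul_one]; exact Real.abs_cos_le_one _⟩
  have h2 := h _ hcd.cos ⟨1, fun z => Real.abs_cos_le_one _⟩
    ⟨1, fun z => by
      rw [(hc z).gradient, norm_smul, he, mul_one, norm_neg]; exact Real.abs_sin_le_one _⟩
  have m1 : Measurable fun z : F => Real.sin (inner ℝ e z) ^ 2 :=
    (Real.continuous_sin.comp hcd.continuous).measurable.pow_const 2
  have m2 : Measurable fun z : F => Real.cos (inner ℝ e z) ^ 2 :=
    (Real.continuous_cos.comp hcd.continuous).measurable.pow_const 2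
  have n1 := entropy_nonneg (μ := μ) m1 (fun z => sq_nonneg _) (fun z => Real.sin_sq_le_one _)
  have n2 := entropy_nonneg (μ := μ) m2 (fun z => sq_nonneg _) (fun z => Real.cos_sq_le_one _)
  have i1 : Integrable (fun z : F => Real.sin (inner ℝ e z) ^ 2) μ :=
    integrable_of_measurable_of_abs_le m1 (B := 1) fun z => by
      rw [abs_of_nonneg (sq_nonneg _)]; exact Real.sin_sq_le_one _
  have i2 : Integrable (fun z : F => Real.cos (inner ℝ e z) ^ 2) μ :=
    integrable_of_measurable_of_abs_le m2 (B := 1) fun z => by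
      rw [abs_of_nonneg (sq_nonneg _)]; exact Real.cos_sq_le_one _
  simp only [fun z => (hs z).gradient, fun z => (hc z).gradient, norm_smul, he, mul_one,
    norm_neg, Real.norm_eq_abs, sq_abs] at h1 h2
  have hsum : (∫ z, Real.cos (inner ℝ e z) ^ 2 ∂μ) + ∫ z, Real.sin (inner ℝ e z) ^ 2 ∂μ = 1 := by
    rw [← integral_add i2 i1]; simp
  nlinarith

variable [FiniteDimensional ℝ F]

/-- Formally |∇(f∘Φ)| ≤ K|∇f|∘Φ. Since f∘Φ need not be C¹, it is mollified, and this bound is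
recovered pointwise in the limit from local Lipschitz constants. -/
theorem SatisfiesLSI.map_lipschitz {μ : Measure F} [IsProbabilityMeasure μ] {C : ℝ} (hC : 0 ≤ C)
    (h : SatisfiesLSI μ C) {Φ : F → F} {K : NNReal} (hΦ : LipschitzWith K Φ) :
    SatisfiesLSI (μ.map Φ) (K ^ 2 * C) := by
  intro f hf ⟨A, hA⟩ ⟨B, hB⟩
  have hB0 : 0 ≤ B := (norm_nonneg _).trans (hB 0)
  have hK0 : (0 : ℝ) ≤ K := K.2
  have hfd : Differentiable ℝ f := hf.differentiable (by simp)
  have hgc := continuous_gradient_of_contDiff hf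
  have hTc : Continuous fun z => f (Φ z) := hf.continuous.comp hΦ.continuous
  set r : ℕ → ℝ := fun n => 1 / ((n : ℝ) + 1) with hr
  have hrpos : ∀ n, 0 < r n := fun n => by positivity
  have hrlim : Tendsto r atTop (𝓝 0) := tendsto_one_div_add_atTop_nhds_zero_nat
  set φ : ℕ → ContDiffBump (0 : F) := fun n =>
    ⟨r n / 2, r n, half_pos (hrpos n), half_lt_self (hrpos n)⟩ with hφ
  have hφr : ∀ n, (φ n).rOut = r n := fun n => rfl
  set T : ℕ → F → ℝ := fun n => mollify (φ n) fun z => f (Φ z) with hT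
  have hTcd : ∀ n, ContDiff ℝ 1 (T n) := fun n => contDiff_mollify _ hTc
  have hTA : ∀ n z, |T n z| ≤ A := fun n z => abs_mollify_le _ (fun z => hA _) z
  have hTB : ∀ n z, ‖gradient (T n) z‖ ≤ K * B := fun n z =>
    norm_gradient_mollify_le _ hTc (mul_nonneg hK0 hB0) fun x hx y hy =>
      abs_comp_sub_le_of_lipschitz hfd hΦ hB0 (fun w _ => hB w) hx hy
  have hlim : ∀ z, Tendsto (fun n => T n z) atTop (𝓝 (f (Φ z))) := fun z =>
    ContDiffBump.convolution_tendsto_right_of_continuous (φ := φ) (g := fun z => f (Φ z))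
      (by simpa only [hφr] using hrlim) hTc z
  set b : F → ℝ := fun z => K * ‖gradient f (Φ z)‖ with hb
  have hbc : Continuous b := by
    have := hgc.comp hΦ.continuous
    exact continuous_const.mul this.norm
  have hb0 : ∀ z, 0 ≤ b z := fun z => by positivity
  have hbB : ∀ z, b z ≤ K * B := fun z => mul_le_mul_of_nonneg_left (hB _) hK0
  -- The gradients of the mollifications need not converge; only their limsup is at most b. Taking
  -- the maximum with b turns this into a genuine limit.
  have hmax : ∀ z, Tendsto (fun n => max ‖gradient (T n) z‖ (b z)) atTop (𝓝 (b z)) := by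
    intro z
    refine tendsto_order.2 ⟨fun a ha => .of_forall fun n => lt_max_of_lt_right ha, fun a ha => ?_⟩
    -- Division by K + 1 instead of K covers K = 0.
    set η : ℝ := (a - b z) / (K + 1) with hη
    have hηpos : 0 < η := div_pos (sub_pos.2 ha) (by positivity)
    obtain ⟨δ, hδ, hδb⟩ := Metric.continuousAt_iff.1 (hgc.continuousAt (x := Φ z)) η hηpos
    have hev : ∀ᶠ n in atTop, K * (2 * r n) < δ := by
      have : Tendsto (fun n => (K : ℝ) * (2 * r n)) atTop (𝓝 0) := by
        simpa using (hrlim.const_mul 2).const_mul (K : ℝ)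
      exact this.eventually_lt_const hδ
    filter_upwards [hev] with n hn
    refine max_lt ?_ ha
    have : ‖gradient (T n) z‖ ≤ K * (‖gradient f (Φ z)‖ + η) := by
      refine norm_gradient_mollify_le _ hTc (by positivity) fun x hx y hy =>
        abs_comp_sub_le_of_lipschitz hfd hΦ (by positivity) (fun w hw => ?_) hx hy
      have h1 := hδb (hw.trans_lt hn)
      rw [dist_eq_norm] at h1
      have := norm_sub_norm_le (gradient f w) (gradient f (Φ z))
      linarith
    have h2 : K * η < a - b z := by
      rw [hη, mul_div_assoc', div_lt_iff₀ (by positivity)]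
      nlinarith [sub_pos.2 ha]
    have h3 : b z = K * ‖gradient f (Φ z)‖ := rfl
    linarith [mul_add (K : ℝ) ‖gradient f (Φ z)‖ η]
  have hsqA : ∀ a : ℝ, |a| ≤ A → a ^ 2 ≤ A ^ 2 := fun a h =>
    sq_le_sq' (abs_le.1 h).1 (abs_le.1 h).2
  have hgm0 : Continuous fun z => ‖gradient f z‖ ^ 2 := hgc.norm.pow 2
  rw [entropy_map hΦ.continuous.measurable (g := fun z => f z ^ 2)
    (hf.continuous.measurable.pow_const 2), integral_map hΦ.continuous.measurable.aemeasurable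
    hgm0.aestronglyMeasurable]
  have hgm : ∀ n, Continuous fun z => ‖gradient (T n) z‖ := fun n =>
    (continuous_gradient_of_contDiff (hTcd n)).norm
  have hmB : ∀ n z, ‖max ‖gradient (T n) z‖ (b z) ^ 2‖ ≤ (K * B) ^ 2 := fun n z => by
    rw [Real.norm_of_nonneg (sq_nonneg _)]
    exact pow_le_pow_left₀ (le_max_of_le_right (hb0 z)) (max_le (hTB n z) (hbB z)) 2
  have hrhs : Tendsto (fun n => 2 * C * ∫ z, max ‖gradient (T n) z‖ (b z) ^ 2 ∂μ) atTop
      (𝓝 (2 * C * ∫ z, b z ^ 2 ∂μ)) := by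
    refine Tendsto.const_mul _ (tendsto_integral_of_dominated_convergence (fun _ => (K * B) ^ 2)
      (fun n => (((hgm n).max hbc).pow 2).aestronglyMeasurable) (integrable_const _)
      (fun n => ae_of_all _ (hmB n)) (ae_of_all _ fun z => (hmax z).pow 2))
  have hfin : entropy μ (fun z => f (Φ z) ^ 2) ≤ 2 * C * ∫ z, b z ^ 2 ∂μ := by
    refine le_of_tendsto_of_tendsto' (tendsto_entropy
      (fun n => (hTcd n).continuous.measurable.pow_const 2) (fun n z => sq_nonneg _)
      (fun n z => hsqA _ (hTA n z)) fun z => (hlim z).pow 2) hrhs fun n => ?_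
    refine (h (T n) (hTcd n) ⟨A, hTA n⟩ ⟨_, hTB n⟩).trans
      (mul_le_mul_of_nonneg_left ?_ (by positivity))
    refine integral_mono
      (integrable_of_measurable_of_abs_le ((hgm n).pow 2).measurable (B := (K * B) ^ 2) fun z => ?_)
      (integrable_of_measurable_of_abs_le (((hgm n).max hbc).pow 2).measurable (hmB n))
      fun z => pow_le_pow_left₀ (norm_nonneg _) (le_max_left _ _) 2
    rw [abs_of_nonneg (by positivity)]
    exact pow_le_pow_left₀ (norm_nonneg _) (hTB n z) 2
  refine hfin.trans_eq ?_
  simp only [hb, mul_pow, integral_const_mul]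
  ring

end Lipschitz
end TamedKinetic
end

noncomputable section

open MeasureTheory ProbabilityTheory Filter Topology

namespace TamedKinetic

/-! ### Monotone and cocoercive vector fields -/

section Cocoercive

variable {E : Type*} [NormedAddCommGroup E] [InnerProductSpace ℝ E]

/-- `b` is `m`-strongly monotone and `1/K`-cocoercive between `x` and `y`. -/
def MonoCoco (b : E → E) (m K : ℝ) (x y : E) : Prop :=
  m * ‖x - y‖ ^ 2 ≤ inner ℝ (b x - b y) (x - y) ∧
    ‖b x - b y‖ ^ 2 ≤ K * inner ℝ (b x - b y) (x - y)

/-- Cocoercivity constants add: the cross term obeys |A||B| ≤ √(αa·βb) ≤ (αb + βa)/2. -/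
lemma norm_add_sq_le_of_coco {A B Δ : E} {α β : ℝ} (hα : 0 ≤ α) (hβ : 0 ≤ β)
    (hA0 : 0 ≤ inner ℝ A Δ) (hB0 : 0 ≤ inner ℝ B Δ) (hA : ‖A‖ ^ 2 ≤ α * inner ℝ A Δ)
    (hB : ‖B‖ ^ 2 ≤ β * inner ℝ B Δ) : ‖A + B‖ ^ 2 ≤ (α + β) * inner ℝ (A + B) Δ := by
  set a := inner ℝ A Δ
  set b := inner ℝ B Δ
  have h1 : (‖A‖ * ‖B‖) ^ 2 ≤ ((α * b + β * a) / 2) ^ 2 := by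
    have := mul_le_mul hA hB (sq_nonneg _) (mul_nonneg hα hA0)
    nlinarith [sq_nonneg (α * b - β * a)]
  have h2 : ‖A‖ * ‖B‖ ≤ (α * b + β * a) / 2 := by
    have h0 : 0 ≤ (α * b + β * a) / 2 := by positivity
    exact le_of_sq_le_sq h1 h0
  have h3 := real_inner_le_norm A B
  rw [norm_add_sq_real, inner_add_left]
  nlinarith

/-- Expanding |RΔ + q|² and using |q|² ≤ R²|Δ|² leaves exactly 2R⟨RΔ + q, Δ⟩. No gradient structure
of q is needed. -/
lemma norm_sq_le_of_near_scalar {q Δ : E} {R : ℝ} (hR : 0 ≤ R) (hq : ‖q‖ ≤ R * ‖Δ‖) :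
    0 ≤ inner ℝ (R • Δ + q) Δ ∧ ‖R • Δ + q‖ ^ 2 ≤ 2 * R * inner ℝ (R • Δ + q) Δ := by
  have h1 := abs_le.1 (abs_real_inner_le_norm q Δ)
  have h2 := mul_le_mul_of_nonneg_right hq (norm_nonneg Δ)
  have h3 : ‖q‖ ^ 2 ≤ (R * ‖Δ‖) ^ 2 := pow_le_pow_left₀ (norm_nonneg _) hq 2
  have h4 : inner ℝ (R • Δ + q) Δ = R * ‖Δ‖ ^ 2 + inner ℝ q Δ := by
    rw [inner_add_left, real_inner_smul_left, real_inner_self_eq_norm_sq]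
  rw [h4]
  refine ⟨by nlinarith, ?_⟩
  rw [norm_add_sq_real, norm_smul, real_inner_smul_left, real_inner_comm q Δ,
    Real.norm_of_nonneg hR]
  nlinarith

/-- By Cauchy–Schwarz, monotonicity of a radial field reduces to that of its scalar profile. -/
lemma inner_radial_nonneg {y z : E} {α β : ℝ} (hα : 0 ≤ α) (hβ : 0 ≤ β)
    (h : 0 ≤ (α * ‖y‖ - β * ‖z‖) * (‖y‖ - ‖z‖)) :
    0 ≤ inner ℝ (α • y - β • z) (y - z) := by
  have h1 := real_inner_le_norm y z
  have h2 := mul_le_mul_of_nonneg_left h1 (add_nonneg hα hβ)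
  simp only [inner_sub_left, inner_sub_right, real_inner_smul_left, real_inner_self_eq_norm_sq,
    real_inner_comm y z]
  nlinarith

/-- If f(b) < f(a), choose a level c strictly between them that f does not take on S. At the last
time τ with f ≥ c one has f(τ) = c, so τ is not in S, yet f < c just after τ. -/
lemma monotone_of_locally_monotone {f : ℝ → ℝ} (hf : Continuous f) {S : Set ℝ} (hS : S.Finite)
    (hloc : ∀ τ ∉ S, ∃ ε > 0, ∀ b, τ < b → b < τ + ε → f τ ≤ f b) : Monotone f := by
  intro a b hab
  by_contra! hlt
  obtain ⟨c, hc, hcS⟩ := ((Set.Ioo_infinite hlt).sdiff (hS.image f)).nonempty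
  set A : Set ℝ := {x ∈ Set.Icc a b | c ≤ f x} with hA
  have hAcl : IsCompact A :=
    (isCompact_Icc).inter_right (isClosed_le continuous_const hf)
  have haA : a ∈ A := ⟨⟨le_rfl, hab⟩, hc.2.le⟩
  obtain ⟨τ, hτA, hτmax⟩ := hAcl.exists_isMaxOn ⟨a, haA⟩ continuous_id.continuousOn
  have hτb : τ < b := by
    rcases hτA.1.2.eq_or_lt with h | h
    · exact absurd hτA.2 (by rw [h]; exact not_le.2 hc.1)
    · exact h
  have hgt : ∀ x, τ < x → x ≤ b → f x < c := fun x hx hxb => by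
    by_contra! hcon
    exact absurd (hτmax (show x ∈ A from ⟨⟨hτA.1.1.trans hx.le, hxb⟩, hcon⟩)) (not_le.2 hx)
  have hle : f τ ≤ c := by
    refine ContinuousWithinAt.closure_le (s := Set.Ioo τ b) (f := f) (g := fun _ => c) ?_
      hf.continuousWithinAt continuousWithinAt_const fun x hx => (hgt x hx.1 hx.2.le).le
    rw [closure_Ioo hτb.ne]
    exact ⟨le_rfl, hτb.le⟩
  have heq : f τ = c := le_antisymm hle hτA.2
  obtain ⟨ε, hε, hmono⟩ := hloc τ fun hτS => hcS ⟨τ, hτS, heq⟩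
  have hx1 : τ < min b (τ + ε / 2) := lt_min hτb (by linarith)
  have := hmono _ hx1 ((min_le_right _ _).trans_lt (by linarith))
  have := hgt _ hx1 (min_le_left _ _)
  linarith

/-- Squaring gives a quadratic equation in τ; the second root comes from Vieta's formula. -/
lemma finite_setOf_norm_line_eq {y Δ : E} (hΔ : Δ ≠ 0) (ρ : ℝ) :
    {τ : ℝ | ‖y + τ • Δ‖ = ρ}.Finite := by
  rcases Set.eq_empty_or_nonempty {τ : ℝ | ‖y + τ • Δ‖ = ρ} with h | ⟨τ₀, h₀⟩
  · rw [h]; exact Set.finite_empty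
  · refine (Set.toFinite {τ₀, -2 * inner ℝ y Δ / ‖Δ‖ ^ 2 - τ₀}).subset fun τ hτ => ?_
    have hpos : ‖Δ‖ ^ 2 ≠ 0 := pow_ne_zero _ (norm_ne_zero_iff.2 hΔ)
    have hexp : ∀ τ : ℝ, ‖y + τ • Δ‖ ^ 2
        = ‖y‖ ^ 2 + 2 * τ * inner ℝ y Δ + τ ^ 2 * ‖Δ‖ ^ 2 := fun τ => by
      rw [norm_add_sq_real, norm_smul, real_inner_smul_right, mul_pow, Real.norm_eq_abs, sq_abs]
      ring
    have h1 : ‖y + τ • Δ‖ ^ 2 = ‖y + τ₀ • Δ‖ ^ 2 := by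
      rw [Set.mem_ofPred_eq] at hτ h₀
      rw [hτ, h₀]
    rw [hexp, hexp] at h1
    have h2 : (τ - τ₀) * (2 * inner ℝ y Δ + (τ + τ₀) * ‖Δ‖ ^ 2) = 0 := by linarith
    rcases mul_eq_zero.1 h2 with h | h
    · left; linarith
    · right
      rw [Set.mem_singleton_iff, eq_sub_iff_add_eq, eq_div_iff hpos]
      linarith

/-- Local strong monotonicity and cocoercivity off finitely many spheres is global. -/
lemma monoCoco_of_locally {b : E → E} (hb : Continuous b) {m K : ℝ} (hK : 0 < K) {ρs : Set ℝ}
    (hρs : ρs.Finite)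
    (hloc : ∀ x, ‖x‖ ∉ ρs → ∃ ε > 0, ∀ y ∈ Metric.ball x ε, ∀ z ∈ Metric.ball x ε,
      MonoCoco b m K y z) (x y : E) : MonoCoco b m K x y := by
  rcases eq_or_ne x y with rfl | hxy
  · simp [MonoCoco]
  set Δ := x - y with hΔ
  have hΔ0 : Δ ≠ 0 := sub_ne_zero.2 hxy
  set p : ℝ → E := fun τ => y + τ • Δ with hp
  have hpc : Continuous p := by fun_prop
  have hp0 : p 0 = y := by simp [hp]
  have hp1 : p 1 = x := by simp [hp, hΔ]
  have hS : {τ : ℝ | ‖p τ‖ ∈ ρs}.Finite := by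
    have : {τ : ℝ | ‖p τ‖ ∈ ρs} = ⋃ ρ ∈ ρs, {τ : ℝ | ‖y + τ • Δ‖ = ρ} := by
      ext τ; simp [hp]
    rw [this]
    exact hρs.biUnion fun ρ _ => finite_setOf_norm_line_eq hΔ0 ρ
  have hlocp : ∀ τ ∉ {τ : ℝ | ‖p τ‖ ∈ ρs}, ∃ ε > 0, ∀ s, τ < s → s < τ + ε →
      MonoCoco b m K (p s) (p τ) := by
    intro τ hτ
    obtain ⟨ε, hε, h⟩ := hloc (p τ) hτ
    obtain ⟨δ, hδ, hδ'⟩ := Metric.continuous_iff.1 hpc τ ε hε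
    refine ⟨δ, hδ, fun s h1 h2 => h _ (hδ' s ?_) _ (Metric.mem_ball_self hε)⟩
    rw [Real.dist_eq, abs_of_pos (by linarith)]
    linarith
  have hdiff : ∀ s τ, p s - p τ = (s - τ) • Δ := fun s τ => by
    simp only [hp, sub_smul]; abel
  constructor
  · have hmono : Monotone fun τ => inner ℝ (b (p τ)) Δ - m * ‖Δ‖ ^ 2 * τ := by
      refine monotone_of_locally_monotone ?_ hS fun τ hτ => ?_
      · exact ((hb.comp hpc).inner continuous_const).sub (continuous_const.mul continuous_id)
      · obtain ⟨ε, hε, h⟩ := hlocp τ hτ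
        refine ⟨ε, hε, fun s h1 h2 => ?_⟩
        have h3 := (h s h1 h2).1
        have hst : 0 < s - τ := sub_pos.2 h1
        rw [hdiff, norm_smul, real_inner_smul_right, Real.norm_of_nonneg hst.le,
          inner_sub_left] at h3
        have : (s - τ) * (m * ‖Δ‖ ^ 2 * (s - τ))
            ≤ (s - τ) * (inner ℝ (b (p s)) Δ - inner ℝ (b (p τ)) Δ) := by
          linarith [show m * ((s - τ) * ‖Δ‖) ^ 2 = (s - τ) * (m * ‖Δ‖ ^ 2 * (s - τ)) by ring]
        have := le_of_mul_le_mul_left this hst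
        linarith
    have := hmono zero_le_one
    simp only [hp0, hp1] at this
    rw [inner_sub_left]
    linarith
  -- Cocoercivity is quadratic in b, hence not additive along a segment. It is equivalent to this
  -- family of inequalities, each linear in b, and these can be summed.
  · have key : ∀ w : E, 0 ≤ inner ℝ (b x - b y) Δ - 2 * inner ℝ (b x - b y) w + K * ‖w‖ ^ 2 := by
      intro w
      have hmono : Monotone fun τ =>
          inner ℝ (b (p τ)) Δ - 2 * inner ℝ (b (p τ)) w + K * ‖w‖ ^ 2 * τ := by
        refine monotone_of_locally_monotone ?_ hS fun τ hτ => ?_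
        · have := hb.comp hpc
          exact ((this.inner continuous_const).sub
            (continuous_const.mul (this.inner continuous_const))).add
            (continuous_const.mul continuous_id)
        · obtain ⟨ε, hε, h⟩ := hlocp τ hτ
          refine ⟨ε, hε, fun s h1 h2 => ?_⟩
          have h3 := (h s h1 h2).2
          have hst : 0 < s - τ := sub_pos.2 h1
          have hKs : 0 < K * (s - τ) := mul_pos hK hst
          rw [hdiff, real_inner_smul_right] at h3
          have h4 : 0 ≤ ‖(b (p s) - b (p τ)) - (K * (s - τ)) • w‖ ^ 2 := sq_nonneg _
          rw [norm_sub_sq_real, norm_smul, real_inner_smul_right, Real.norm_of_nonneg hKs.le] at h4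
          have h5 : 0 ≤ (K * (s - τ)) * (inner ℝ (b (p s) - b (p τ)) Δ
              - 2 * inner ℝ (b (p s) - b (p τ)) w + K * (s - τ) * ‖w‖ ^ 2) := by
            linarith [show (K * (s - τ) * ‖w‖) ^ 2 = (K * (s - τ)) * (K * (s - τ) * ‖w‖ ^ 2) by
              ring]
          have h6 := nonneg_of_mul_nonneg_right h5 hKs
          simp only [inner_sub_left] at h6
          linarith
      have := hmono zero_le_one
      simp only [hp0, hp1] at this
      simp only [inner_sub_left]
      linarith
    -- The minimizer in w.
    have h1 := key (K⁻¹ • (b x - b y))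
    rw [real_inner_smul_right, real_inner_self_eq_norm_sq, norm_smul,
      Real.norm_of_nonneg (inv_nonneg.2 hK.le)] at h1
    have h2 : K * (inner ℝ (b x - b y) Δ - 2 * (K⁻¹ * ‖b x - b y‖ ^ 2)
        + K * (K⁻¹ * ‖b x - b y‖) ^ 2) = K * inner ℝ (b x - b y) Δ - ‖b x - b y‖ ^ 2 := by
      field_simp
      ring
    have := mul_nonneg hK.le h1
    linarith

variable [CompleteSpace E]

lemma hasDerivAt_line_of_hasGradientAt {φ : E → ℝ} {g y Δ : E} {τ : ℝ}
    (h : HasGradientAt φ g (y + τ • Δ)) :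
    HasDerivAt (fun τ : ℝ => φ (y + τ • Δ)) (inner ℝ g Δ) τ := by
  have h1 : HasDerivAt (fun t : ℝ => y + t • Δ) Δ τ := by
    simpa using ((hasDerivAt_id τ).smul_const Δ).const_add y
  exact (h.hasFDerivAt.comp_hasDerivAt τ h1).congr_deriv (by simp)

/-- First-order bounds for a function with monotone Lipschitz gradient on a ball. -/
lemma first_order_bounds {φ : E → ℝ} {G : E → E} {c : E} {ε K : ℝ}
    (hG : ∀ y ∈ Metric.ball c ε, HasGradientAt φ (G y) y)
    (hmono : ∀ y ∈ Metric.ball c ε, ∀ z ∈ Metric.ball c ε, 0 ≤ inner ℝ (G y - G z) (y - z))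
    (hlip : ∀ y ∈ Metric.ball c ε, ∀ z ∈ Metric.ball c ε, ‖G y - G z‖ ≤ K * ‖y - z‖)
    {y z : E} (hy : y ∈ Metric.ball c ε) (hz : z ∈ Metric.ball c ε) :
    φ y + inner ℝ (G y) (z - y) ≤ φ z ∧
      φ z ≤ φ y + inner ℝ (G y) (z - y) + K / 2 * ‖z - y‖ ^ 2 := by
  set Δ := z - y with hΔ
  have hmem : ∀ τ ∈ Set.Icc (0 : ℝ) 1, y + τ • Δ ∈ Metric.ball c ε := fun τ hτ =>
    (convex_ball c ε).add_smul_sub_mem hy hz hτ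
  have hd : ∀ τ ∈ Set.Icc (0 : ℝ) 1,
      HasDerivAt (fun τ : ℝ => φ (y + τ • Δ)) (inner ℝ (G (y + τ • Δ)) Δ) τ := fun τ hτ =>
    hasDerivAt_line_of_hasGradientAt (hG _ (hmem τ hτ))
  have hsub : ∀ τ : ℝ, y + τ • Δ - y = τ • Δ := fun τ => by abel
  have hlow : ∀ τ ∈ Set.Ioo (0 : ℝ) 1, inner ℝ (G y) Δ ≤ inner ℝ (G (y + τ • Δ)) Δ := by
    intro τ hτ
    have h := hmono _ (hmem τ ⟨hτ.1.le, hτ.2.le⟩) y hy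
    rw [hsub, real_inner_smul_right, inner_sub_left] at h
    linarith [nonneg_of_mul_nonneg_right h hτ.1]
  have hup : ∀ τ ∈ Set.Ioo (0 : ℝ) 1,
      inner ℝ (G (y + τ • Δ)) Δ ≤ inner ℝ (G y) Δ + K * τ * ‖Δ‖ ^ 2 := by
    intro τ hτ
    have h := hlip _ (hmem τ ⟨hτ.1.le, hτ.2.le⟩) y hy
    rw [hsub, norm_smul, Real.norm_of_nonneg hτ.1.le] at h
    have h2 := real_inner_le_norm (G (y + τ • Δ) - G y) Δ
    have h3 := mul_le_mul_of_nonneg_right h (norm_nonneg Δ)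
    rw [inner_sub_left] at h2
    nlinarith
  have e0 : φ (y + (0 : ℝ) • Δ) = φ y := by simp
  have e1 : φ (y + (1 : ℝ) • Δ) = φ z := by simp [hΔ]
  constructor
  · have hm : MonotoneOn (fun τ : ℝ => φ (y + τ • Δ) - inner ℝ (G y) Δ * τ) (Set.Icc 0 1) := by
      have hd' : ∀ τ ∈ Set.Icc (0 : ℝ) 1, HasDerivAt (fun τ : ℝ => φ (y + τ • Δ)
          - inner ℝ (G y) Δ * τ) (inner ℝ (G (y + τ • Δ)) Δ - inner ℝ (G y) Δ) τ := fun τ hτ => by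
        exact ((hd τ hτ).sub ((hasDerivAt_id τ).const_mul (inner ℝ (G y) Δ))).congr_deriv (by simp)
      refine monotoneOn_of_hasDerivWithinAt_nonneg (convex_Icc 0 1)
        (fun τ hτ => (hd' τ hτ).continuousAt.continuousWithinAt)
        (fun τ hτ => (hd' τ (interior_subset hτ)).hasDerivWithinAt) fun τ hτ => ?_
      rw [interior_Icc] at hτ
      linarith [hlow τ hτ]
    have := hm (Set.left_mem_Icc.2 zero_le_one) (Set.right_mem_Icc.2 zero_le_one) zero_le_one
    simp only [e0, e1] at this
    linarith
  · have hm : MonotoneOn (fun τ : ℝ => inner ℝ (G y) Δ * τ + K / 2 * ‖Δ‖ ^ 2 * τ ^ 2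
        - φ (y + τ • Δ)) (Set.Icc 0 1) := by
      have hd' : ∀ τ ∈ Set.Icc (0 : ℝ) 1, HasDerivAt (fun τ : ℝ => inner ℝ (G y) Δ * τ
          + K / 2 * ‖Δ‖ ^ 2 * τ ^ 2 - φ (y + τ • Δ))
          (inner ℝ (G y) Δ + K * τ * ‖Δ‖ ^ 2 - inner ℝ (G (y + τ • Δ)) Δ) τ := fun τ hτ => by
        have h1 := (hasDerivAt_id τ).const_mul (inner ℝ (G y) Δ)
        have h2 := (hasDerivAt_pow 2 τ).const_mul (K / 2 * ‖Δ‖ ^ 2)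
        refine ((h1.add h2).sub (hd τ hτ)).congr_deriv ?_
        push_cast
        ring
      refine monotoneOn_of_hasDerivWithinAt_nonneg (convex_Icc 0 1)
        (fun τ hτ => (hd' τ hτ).continuousAt.continuousWithinAt)
        (fun τ hτ => (hd' τ (interior_subset hτ)).hasDerivWithinAt) fun τ hτ => ?_
      rw [interior_Icc] at hτ
      linarith [hup τ hτ]
    have := hm (Set.left_mem_Icc.2 zero_le_one) (Set.right_mem_Icc.2 zero_le_one) zero_le_one
    simp only [e0, e1] at this
    linarith

/-- Local cocoercivity of the gradient of a convex function. -/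
lemma norm_sq_le_inner_of_gradient {φ : E → ℝ} {G : E → E} {c : E} {ε K : ℝ} (hK : 0 < K)
    (hG : ∀ y ∈ Metric.ball c (3 * ε), HasGradientAt φ (G y) y)
    (hmono : ∀ y ∈ Metric.ball c (3 * ε), ∀ z ∈ Metric.ball c (3 * ε),
      0 ≤ inner ℝ (G y - G z) (y - z))
    (hlip : ∀ y ∈ Metric.ball c (3 * ε), ∀ z ∈ Metric.ball c (3 * ε),
      ‖G y - G z‖ ≤ K * ‖y - z‖)
    {y z : E} (hy : y ∈ Metric.ball c ε) (hz : z ∈ Metric.ball c ε) :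
    ‖G y - G z‖ ^ 2 ≤ K * inner ℝ (G y - G z) (y - z) := by
  have hε : 0 < ε := dist_nonneg.trans_lt hy
  have hsub : Metric.ball c ε ⊆ Metric.ball c (3 * ε) := Metric.ball_subset_ball (by linarith)
  have half : ∀ y ∈ Metric.ball c ε, ∀ z ∈ Metric.ball c ε,
      φ z + inner ℝ (G z) (y - z) + 1 / (2 * K) * ‖G y - G z‖ ^ 2 ≤ φ y := by
    intro y hy z hz
    set D := G y - G z with hD
    -- The gradient step from y minimizing the quadratic upper bound at y minus the affine lower
    -- bound at z. Since |w - y| ≤ |y - z| < 2ε, it stays in the ball of radius 3ε.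
    set w := y - K⁻¹ • D with hw
    have hwy : w - y = -(K⁻¹ • D) := by rw [hw]; abel
    have hDle := hlip y (hsub hy) z (hsub hz)
    have hwm : w ∈ Metric.ball c (3 * ε) := by
      have h1 : ‖K⁻¹ • D‖ ≤ ‖y - z‖ := by
        rw [norm_smul, Real.norm_of_nonneg (inv_nonneg.2 hK.le), inv_mul_le_iff₀ hK]
        exact hDle
      have h2 : ‖y - z‖ ≤ dist y c + dist z c := by
        rw [← dist_eq_norm]; exact dist_triangle_right y z c
      have h3 : dist w y ≤ ‖y - z‖ := by rw [dist_eq_norm, hwy, norm_neg]; exact h1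
      have h4 := dist_triangle w y c
      rw [Metric.mem_ball] at hy hz ⊢
      linarith
    have h1 := (first_order_bounds hG hmono hlip (hsub hz) hwm).1
    have h2 := (first_order_bounds hG hmono hlip (hsub hy) hwm).2
    have hwz : w - z = (y - z) - K⁻¹ • D := by rw [hw]; abel
    rw [hwz, inner_sub_right, real_inner_smul_right] at h1
    rw [hwy, inner_neg_right, real_inner_smul_right, norm_neg, norm_smul,
      Real.norm_of_nonneg (inv_nonneg.2 hK.le)] at h2
    have h3 : K⁻¹ * inner ℝ (G y) D - K⁻¹ * inner ℝ (G z) D = K⁻¹ * ‖D‖ ^ 2 := by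
      rw [← mul_sub, ← inner_sub_left, real_inner_self_eq_norm_sq]
    have h4 : K / 2 * (K⁻¹ * ‖D‖) ^ 2 = K⁻¹ * ‖D‖ ^ 2 / 2 := by field_simp
    have h5 : 1 / (2 * K) * ‖D‖ ^ 2 = K⁻¹ * ‖D‖ ^ 2 / 2 := by field_simp
    linarith
  have h1 := half y hy z hz
  have h2 := half z hz y hy
  rw [norm_sub_rev (G z) (G y), ← neg_sub y z, inner_neg_right] at h2
  have h3 : 1 / (2 * K) * ‖G y - G z‖ ^ 2 + 1 / (2 * K) * ‖G y - G z‖ ^ 2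
      = K⁻¹ * ‖G y - G z‖ ^ 2 := by field_simp; ring
  have h4 : K⁻¹ * ‖G y - G z‖ ^ 2 ≤ inner ℝ (G y - G z) (y - z) := by
    rw [inner_sub_left]; linarith
  rwa [inv_mul_le_iff₀ hK] at h4

/-- A Lipschitz, strongly monotone field that has a potential near `x` is cocoercive near `x`. -/
lemma monoCoco_near_of_potential {φ : E → ℝ} {b : E → E} {m M K : ℝ} (hm : 0 ≤ m) (hM : 0 < M)
    (hMK : M ≤ K) (hlip : ∀ y z, ‖b y - b z‖ ≤ M * ‖y - z‖) {U : Set E} (hU : IsOpen U)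
    (hG : ∀ y ∈ U, HasGradientAt φ (b y) y)
    (hmono : ∀ y ∈ U, ∀ z ∈ U, m * ‖y - z‖ ^ 2 ≤ inner ℝ (b y - b z) (y - z)) {x : E}
    (hx : x ∈ U) :
    ∃ ε > 0, ∀ y ∈ Metric.ball x ε, ∀ z ∈ Metric.ball x ε, MonoCoco b m K y z := by
  obtain ⟨ε, hε, hsub⟩ := Metric.isOpen_iff.1 hU x hx
  have hsub3 : ∀ y ∈ Metric.ball x (3 * (ε / 3)), y ∈ U := fun y hy => hsub (by
    rwa [mul_div_cancel₀ _ (by norm_num)] at hy)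
  have hsub1 : ∀ y ∈ Metric.ball x (ε / 3), y ∈ U := fun y hy =>
    hsub (Metric.ball_subset_ball (by linarith) hy)
  have h0 : ∀ y ∈ U, ∀ z ∈ U, 0 ≤ inner ℝ (b y - b z) (y - z) := fun y hy z hz =>
    (mul_nonneg hm (sq_nonneg _)).trans (hmono y hy z hz)
  refine ⟨ε / 3, by positivity, fun y hy z hz => ⟨hmono y (hsub1 y hy) z (hsub1 z hz), ?_⟩⟩
  refine (norm_sq_le_inner_of_gradient hM (fun y hy => hG y (hsub3 y hy))
    (fun y hy z hz => h0 y (hsub3 y hy) z (hsub3 z hz)) (fun y _ z _ => hlip y z) hy hz).trans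
    (mul_le_mul_of_nonneg_right hMK (h0 y (hsub1 y hy) z (hsub1 z hz)))

end Cocoercive
end TamedKinetic
end

noncomputable section

open MeasureTheory ProbabilityTheory Filter Topology

namespace TamedKinetic

/-! ### The tamed drift -/

lemma cutoffT_nonneg (r ρ : ℝ) : 0 ≤ cutoffT r ρ := by
  unfold cutoffT; split_ifs <;> linarith

lemma cutoffT_le_one (r ρ : ℝ) : cutoffT r ρ ≤ 1 := by
  unfold cutoffT; split_ifs <;> linarith

lemma cutoffT_eq_zero {r ρ : ℝ} (h : r ≤ ρ) : cutoffT r ρ = 0 := by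
  unfold cutoffT; split_ifs <;> linarith

lemma abs_cutoffT_sub_le (r a b : ℝ) : |cutoffT r a - cutoffT r b| ≤ |a - b| := by
  rw [abs_le]
  unfold cutoffT
  split_ifs <;> constructor <;> cases abs_cases (a - b) <;> linarith

lemma abs_cutoffS_le_one {r ρ : ℝ} (hr : 0 < r) : |cutoffS r ρ| ≤ 1 := by
  rw [abs_le]
  unfold cutoffS
  split_ifs with h1 h2 h3
  · constructor <;> linarith
  · constructor <;> linarith
  · constructor <;> linarith
  · rw [not_le] at h3
    exact ⟨by linarith [div_nonneg hr.le (hr.trans h3).le],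
      (div_le_one (hr.trans h3)).2 h3.le⟩

lemma abs_cutoffS_sub_le {r ρ ρ' : ℝ} (h : ρ ≤ ρ') (h' : ρ' ≤ r) :
    |cutoffS r ρ' - cutoffS r ρ| ≤ ρ' - ρ := by
  rw [abs_le]
  unfold cutoffS
  split_ifs <;> constructor <;> linarith

/-- The weight by the smaller radius is what appears in s(y)y - s(x)x = s(y)(y - x) + (s(y) -
s(x))x. -/
lemma abs_cutoffS_sub_mul_le {r ρ ρ' : ℝ} (hr : 0 < r) (h0 : 0 ≤ ρ) (h : ρ ≤ ρ') :
    |cutoffS r ρ' - cutoffS r ρ| * ρ ≤ (1 + r) * (ρ' - ρ) := by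
  have hout : ∀ x, r < x → cutoffS r x = r / x := fun x hx => by
    unfold cutoffS
    rw [if_neg (by linarith), if_neg (by linarith), if_neg (by linarith)]
  have hat : cutoffS r r = 1 := by
    unfold cutoffS
    rw [if_neg (by linarith), if_neg (by linarith), if_pos le_rfl]
  have hdiff : 0 ≤ ρ' - ρ := sub_nonneg.2 h
  rcases le_or_gt ρ' r with h1 | h1
  · calc _ ≤ (ρ' - ρ) * r :=
        mul_le_mul (abs_cutoffS_sub_le h h1) (h.trans h1) h0 hdiff
      _ ≤ _ := by linarith
  · have hρ' : 0 < ρ' := hr.trans h1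
    rcases lt_or_ge r ρ with h2 | h2
    · have hρ : 0 < ρ := hr.trans h2
      rw [hout _ h1, hout _ h2, abs_of_nonpos (sub_nonpos.2 (div_le_div_of_nonneg_left hr.le hρ h))]
      have e : -(r / ρ' - r / ρ) * ρ = (r / ρ') * (ρ' - ρ) := by field_simp; ring
      rw [e]
      have : r / ρ' ≤ 1 := (div_le_one hρ').2 h1.le
      exact mul_le_mul_of_nonneg_right (by linarith) hdiff
    · have a1 : |cutoffS r r - cutoffS r ρ| ≤ r - ρ := abs_cutoffS_sub_le h2 le_rfl
      have a2 : |cutoffS r ρ' - cutoffS r r| * r ≤ ρ' - r := by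
        rw [hout _ h1, hat, abs_of_nonpos (sub_nonpos.2 ((div_le_one hρ').2 h1.le))]
        have e : -(r / ρ' - 1) * r = (r / ρ') * (ρ' - r) := by field_simp; ring
        rw [e]
        have : r / ρ' ≤ 1 := (div_le_one hρ').2 h1.le
        calc _ ≤ 1 * (ρ' - r) := mul_le_mul_of_nonneg_right this (by linarith)
          _ = _ := one_mul _
      have a3 := abs_sub_le (cutoffS r ρ') (cutoffS r r) (cutoffS r ρ)
      calc _ ≤ |cutoffS r ρ' - cutoffS r ρ| * r := mul_le_mul_of_nonneg_left h2 (abs_nonneg _)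
        _ ≤ (|cutoffS r ρ' - cutoffS r r| + |cutoffS r r - cutoffS r ρ|) * r :=
          mul_le_mul_of_nonneg_right a3 hr.le
        _ ≤ (ρ' - r) + (r - ρ) * r := by
          rw [add_mul]; exact add_le_add a2 (mul_le_mul_of_nonneg_right a1 hr.le)
        _ ≤ _ := by nlinarith

/-! ### The tamed field region by region, its Lipschitz continuity, and gradients of radial
functions. -/

section Field

variable {E : Type*} [NormedAddCommGroup E] [InnerProductSpace ℝ E]

/-- The tamed drift with taming radius `r` and taming strength `R`. -/
def tamedField (h : E → E) (m r R : ℝ) (x : E) : E :=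
  cutoffT r ‖x‖ • (h x - m • x) + (R * cutoffS r ‖x‖) • x + m • x

variable {h : E → E} {m r R : ℝ}

lemma tamedField_of_lt {x : E} (hx : ‖x‖ < r - 2) : tamedField h m r R x = h x := by
  unfold tamedField cutoffT cutoffS
  rw [if_pos (by linarith), if_pos (by linarith)]
  simp

lemma tamedField_of_mem_inner {x : E} (h1 : r - 2 < ‖x‖) (h2 : ‖x‖ < r - 1) :
    tamedField h m r R x = h x + (R * (‖x‖ - (r - 2))) • x := by
  unfold tamedField cutoffT cutoffS
  rw [if_pos (by linarith), if_neg (by linarith), if_pos h2, one_smul,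
    show ‖x‖ - r + 2 = ‖x‖ - (r - 2) by ring]
  abel

lemma tamedField_of_mem_annulus {x : E} (h1 : r - 1 < ‖x‖) (h2 : ‖x‖ < r) :
    tamedField h m r R x = (r - ‖x‖) • (h x - m • x) + R • x + m • x := by
  unfold tamedField cutoffT cutoffS
  rw [if_neg (by linarith), if_pos h2, if_neg (by linarith), if_neg (by linarith),
    if_pos h2.le, mul_one]

lemma tamedField_of_norm_eq {x : E} (h1 : ‖x‖ = r) : tamedField h m r R x = (R + m) • x := by
  unfold tamedField cutoffT cutoffS
  rw [if_neg (by linarith), if_neg (by linarith), if_neg (by linarith), if_neg (by linarith),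
    if_pos h1.le, mul_one, zero_smul, zero_add, add_smul]

lemma tamedField_of_gt {x : E} (h1 : r < ‖x‖) :
    tamedField h m r R x = (R * r * ‖x‖⁻¹) • x + m • x := by
  unfold tamedField cutoffT cutoffS
  rw [if_neg (by linarith), if_neg (by linarith), if_neg (by linarith), if_neg (by linarith),
    if_neg (by linarith), zero_smul, zero_add, div_eq_mul_inv, mul_assoc]

/-- Only finiteness matters: it makes the infimum defining `lipConst` one over a nonempty set. -/
lemma exists_lipschitzWith_tamedField (hr : 0 < r) (hR : 0 ≤ R) (hm : 0 ≤ m)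
    (hgR : ∀ x, ‖x‖ < r → ‖h x - m • x‖ ≤ R) {G : ℝ} (hG : 0 ≤ G)
    (hgG : ∀ x y, ‖x‖ < r → ‖y‖ < r → ‖(h x - m • x) - (h y - m • y)‖ ≤ G * ‖x - y‖) :
    ∃ K : NNReal, LipschitzWith K (tamedField h m r R) := by
  have hT : ∀ x y : E, ‖cutoffT r ‖x‖ • (h x - m • x) - cutoffT r ‖y‖ • (h y - m • y)‖
      ≤ (G + R) * ‖x - y‖ := by
    have hlt : ∀ x y : E, ‖x‖ < r →
        ‖cutoffT r ‖x‖ • (h x - m • x) - cutoffT r ‖y‖ • (h y - m • y)‖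
          ≤ (G + R) * ‖x - y‖ := by
      intro x y hx
      have hn : |cutoffT r ‖x‖ - cutoffT r ‖y‖| ≤ ‖x - y‖ :=
        (abs_cutoffT_sub_le _ _ _).trans (abs_norm_sub_norm_le x y)
      have e : cutoffT r ‖x‖ • (h x - m • x) - cutoffT r ‖y‖ • (h y - m • y)
          = (cutoffT r ‖x‖ - cutoffT r ‖y‖) • (h x - m • x)
            + cutoffT r ‖y‖ • ((h x - m • x) - (h y - m • y)) := by
        simp only [sub_smul, smul_sub]; abel
      have b1 : ‖(cutoffT r ‖x‖ - cutoffT r ‖y‖) • (h x - m • x)‖ ≤ ‖x - y‖ * R := by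
        rw [norm_smul]; exact mul_le_mul hn (hgR x hx) (norm_nonneg _) (norm_nonneg _)
      have b2 : ‖cutoffT r ‖y‖ • ((h x - m • x) - (h y - m • y))‖ ≤ G * ‖x - y‖ := by
        rw [norm_smul, Real.norm_of_nonneg (cutoffT_nonneg _ _)]
        rcases lt_or_ge ‖y‖ r with hy | hy
        · calc _ ≤ 1 * (G * ‖x - y‖) := mul_le_mul (cutoffT_le_one _ _) (hgG x y hx hy)
                (norm_nonneg _) zero_le_one
            _ = _ := one_mul _
        · rw [cutoffT_eq_zero hy, zero_mul]; positivity
      rw [e]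
      refine (norm_add_le _ _).trans ?_
      linarith
    intro x y
    rcases lt_or_ge ‖x‖ r with hx | hx
    · exact hlt x y hx
    rcases lt_or_ge ‖y‖ r with hy | hy
    · rw [norm_sub_rev, norm_sub_rev x y]; exact hlt y x hy
    · rw [cutoffT_eq_zero hx, cutoffT_eq_zero hy]
      simp only [zero_smul, sub_zero, norm_zero]; positivity
  have hS : ∀ x y : E, ‖cutoffS r ‖x‖ • x - cutoffS r ‖y‖ • y‖ ≤ (2 + r) * ‖x - y‖ := by
    have hle : ∀ x y : E, ‖x‖ ≤ ‖y‖ →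
        ‖cutoffS r ‖y‖ • y - cutoffS r ‖x‖ • x‖ ≤ (2 + r) * ‖y - x‖ := by
      intro x y hxy
      have e : cutoffS r ‖y‖ • y - cutoffS r ‖x‖ • x
          = cutoffS r ‖y‖ • (y - x) + (cutoffS r ‖y‖ - cutoffS r ‖x‖) • x := by
        simp only [sub_smul, smul_sub]; abel
      have b1 : ‖cutoffS r ‖y‖ • (y - x)‖ ≤ ‖y - x‖ := by
        rw [norm_smul]
        calc _ ≤ 1 * ‖y - x‖ :=
              mul_le_mul_of_nonneg_right (abs_cutoffS_le_one hr) (norm_nonneg _)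
          _ = _ := one_mul _
      have b2 : ‖(cutoffS r ‖y‖ - cutoffS r ‖x‖) • x‖ ≤ (1 + r) * ‖y - x‖ := by
        rw [norm_smul]
        exact (abs_cutoffS_sub_mul_le hr (norm_nonneg x) hxy).trans
          (mul_le_mul_of_nonneg_left (norm_sub_norm_le _ _) (by linarith))
      rw [e]
      refine (norm_add_le _ _).trans ?_
      linarith
    intro x y
    rcases le_total ‖x‖ ‖y‖ with hxy | hxy
    · rw [norm_sub_rev, norm_sub_rev x y]; exact hle x y hxy
    · exact hle y x hxy
  refine ⟨((G + R) + R * (2 + r) + m).toNNReal, LipschitzWith.of_dist_le_mul fun x y => ?_⟩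
  rw [dist_eq_norm, dist_eq_norm, Real.coe_toNNReal _ (by positivity)]
  have e : tamedField h m r R x - tamedField h m r R y
      = (cutoffT r ‖x‖ • (h x - m • x) - cutoffT r ‖y‖ • (h y - m • y))
        + R • (cutoffS r ‖x‖ • x - cutoffS r ‖y‖ • y) + m • (x - y) := by
    unfold tamedField
    simp only [smul_sub, smul_smul]; abel
  have n2 : ‖R • (cutoffS r ‖x‖ • x - cutoffS r ‖y‖ • y)‖ ≤ R * ((2 + r) * ‖x - y‖) := by
    rw [norm_smul, Real.norm_of_nonneg hR]; exact mul_le_mul_of_nonneg_left (hS x y) hR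
  have n3 : ‖m • (x - y)‖ = m * ‖x - y‖ := by rw [norm_smul, Real.norm_of_nonneg hm]
  rw [e]
  refine (norm_add₃_le).trans ?_
  linarith [hT x y]

/-- On the sphere of radius r the field is (R + m)·id; two antipodal points are compared. -/
lemma add_le_of_tamedField_lipschitz [Nontrivial E] (hr : 0 < r) (hRm : 0 ≤ R + m) {M : ℝ}
    (hlip : ∀ y z, ‖tamedField h m r R y - tamedField h m r R z‖ ≤ M * ‖y - z‖) : R + m ≤ M := by
  obtain ⟨e, he⟩ := exists_norm_eq E hr.le
  have h1 := hlip e (-e)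
  rw [tamedField_of_norm_eq he, tamedField_of_norm_eq (by rw [norm_neg, he]), ← smul_sub,
    norm_smul, Real.norm_of_nonneg hRm] at h1
  refine le_of_mul_le_mul_right h1 ?_
  rw [sub_neg_eq_add, ← two_smul ℝ e, norm_smul, he]
  exact mul_pos (by norm_num) hr

variable [CompleteSpace E]

lemma hasGradientAt_norm {x : E} (hx : x ≠ 0) : HasGradientAt (fun y : E => ‖y‖) (‖x‖⁻¹ • x) x := by
  have h1 : HasFDerivAt (fun y : E => ‖y‖ ^ 2) (2 • (innerSL ℝ x)) x :=
    (hasStrictFDerivAt_norm_sq x).hasFDerivAt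
  have h2 := h1.sqrt (pow_ne_zero 2 (norm_ne_zero_iff.2 hx))
  have h3 : (fun y : E => √(‖y‖ ^ 2)) = fun y : E => ‖y‖ := by
    ext y; exact Real.sqrt_sq (norm_nonneg y)
  rw [h3] at h2
  refine hasGradientAt_of_apply h2 fun w => ?_
  have := norm_ne_zero_iff.2 hx
  simp [real_inner_smul_left, Real.sqrt_sq (norm_nonneg x)]
  field_simp

lemma hasGradientAt_norm_sq_half (x : E) : HasGradientAt (fun y : E => ‖y‖ ^ 2 / 2) x x := by
  have h1 : HasFDerivAt (fun y : E => ‖y‖ ^ 2) (2 • (innerSL ℝ x)) x :=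
    (hasStrictFDerivAt_norm_sq x).hasFDerivAt
  have h2 : HasFDerivAt (fun y : E => ‖y‖ ^ 2 / 2) ((2⁻¹ : ℝ) • (2 • (innerSL ℝ x))) x := by
    simpa only [div_eq_inv_mul] using h1.const_mul (2⁻¹ : ℝ)
  refine hasGradientAt_of_apply h2 fun w => ?_
  simp

lemma hasGradientAt_combination {φ₁ φ₂ φ₃ : E → ℝ} {g₁ g₂ g₃ x : E} (h₁ : HasGradientAt φ₁ g₁ x)
    (h₂ : HasGradientAt φ₂ g₂ x) (h₃ : HasGradientAt φ₃ g₃ x) (a b c : ℝ) :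
    HasGradientAt (fun y => a * φ₁ y + b * φ₂ y + c * φ₃ y) (a • g₁ + b • g₂ + c • g₃) x := by
  refine hasGradientAt_of_apply (((h₁.hasFDerivAt.const_mul a).add
    (h₂.hasFDerivAt.const_mul b)).add (h₃.hasFDerivAt.const_mul c)) fun w => ?_
  simp [inner_add_left, real_inner_smul_left]

lemma hasGradientAt_norm_cube {x : E} (hx : x ≠ 0) :
    HasGradientAt (fun y : E => ‖y‖ ^ 3 / 3) (‖x‖ • x) x := by
  have h1 := ((hasGradientAt_norm hx).hasFDerivAt.pow 3).const_mul (3⁻¹ : ℝ)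
  have h2 : (fun y : E => 3⁻¹ * ‖y‖ ^ 3) = fun y : E => ‖y‖ ^ 3 / 3 := by
    ext y; ring
  rw [h2] at h1
  refine hasGradientAt_of_apply h1 fun w => ?_
  have := norm_ne_zero_iff.2 hx
  simp [real_inner_smul_left]
  field_simp

end Field
end TamedKinetic
end

noncomputable section

open MeasureTheory ProbabilityTheory Filter Topology

namespace TamedKinetic

/-! ### Strong monotonicity and cocoercivity of the tamed field. -/

section Field

variable {E : Type*} [NormedAddCommGroup E] [InnerProductSpace ℝ E] [CompleteSpace E]
  {u : E → ℝ} {m r R M : ℝ}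

/-- In the annulus `r - 1 < ‖x‖ < r` the tamed drift is not a gradient, but it is the sum of a
positive multiple of a convex gradient, a small perturbation of `R • id`, and `m • id`. -/
lemma monoCoco_tamedField_annulus (hm : 0 < m) (hR : 0 ≤ R) (hRM : R + m ≤ M)
    (hu : Differentiable ℝ u)
    (hmono : ∀ x y, 2 * m * ‖x - y‖ ^ 2 ≤ inner ℝ (gradient u x - gradient u y) (x - y))
    (hgR : ∀ x, ‖x‖ < r → ‖gradient u x - m • x‖ ≤ R)
    (hlip : ∀ y z, ‖tamedField (gradient u) m r R y - tamedField (gradient u) m r R z‖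
      ≤ M * ‖y - z‖) {x : E} (h1 : r - 1 < ‖x‖) (h2 : ‖x‖ < r) :
    ∃ ε > 0, ∀ y ∈ Metric.ball x ε, ∀ z ∈ Metric.ball x ε,
      MonoCoco (tamedField (gradient u) m r R) m (7 * M) y z := by
  have hM : 0 < M := by linarith
  set b := tamedField (gradient u) m r R with hb
  set g : E → E := fun y => gradient u y - m • y with hg
  set t₀ := r - ‖x‖ with ht₀
  have ht₀pos : 0 < t₀ := sub_pos.2 h2
  have hopen : IsOpen {y : E | r - 1 < ‖y‖ ∧ ‖y‖ < r} :=
    (isOpen_lt continuous_const continuous_norm).inter (isOpen_lt continuous_norm continuous_const)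
  obtain ⟨ε₁, hε₁, hsub₁⟩ := Metric.isOpen_iff.1 hopen x ⟨h1, h2⟩
  -- The cutoff r - |y| then varies little: it is at least (17/20)t₀ on the ball of radius 3ε and at
  -- most (21/20)t₀ on that of radius ε.
  set ε := min (ε₁ / 3) (t₀ / 20) with hε
  have hεpos : 0 < ε := lt_min (by linarith) (by linarith)
  have hεt : ε ≤ t₀ / 20 := min_le_right _ _
  have hε3 : 3 * ε ≤ ε₁ := by linarith [min_le_left (ε₁ / 3) (t₀ / 20)]
  have hreg : ∀ y ∈ Metric.ball x (3 * ε), r - 1 < ‖y‖ ∧ ‖y‖ < r := fun y hy =>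
    hsub₁ (Metric.ball_subset_ball hε3 hy)
  have hsub : ∀ y ∈ Metric.ball x ε, y ∈ Metric.ball x (3 * ε) := fun y hy =>
    Metric.ball_subset_ball (by linarith) hy
  have hnorm : ∀ y δ, y ∈ Metric.ball x δ → |‖y‖ - ‖x‖| ≤ δ := fun y δ hy =>
    (abs_norm_sub_norm_le y x).trans (by rw [← dist_eq_norm]; exact (Metric.mem_ball.1 hy).le)
  set tb : E → E → ℝ := fun y z => ((r - ‖y‖) + (r - ‖z‖)) / 2 with htb
  -- A symmetric product rule: the mean of the cutoffs times the increment of g, plus the increment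
  -- of the cutoff times the mean of g. The second term is q, and |q| ≤ R|y - z|.
  set q : E → E → E := fun y z => (‖z‖ - ‖y‖) • ((2⁻¹ : ℝ) • (g y + g z)) with hq
  have hdec : ∀ y ∈ Metric.ball x (3 * ε), ∀ z ∈ Metric.ball x (3 * ε),
      b y - b z = tb y z • (g y - g z) + (R • (y - z) + q y z) + m • (y - z) := by
    intro y hy z hz
    rw [hb, tamedField_of_mem_annulus (hreg y hy).1 (hreg y hy).2,
      tamedField_of_mem_annulus (hreg z hz).1 (hreg z hz).2]
    change (r - ‖y‖) • g y + R • y + m • y - ((r - ‖z‖) • g z + R • z + m • z) = _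
    simp only [htb, hq]
    module
  have hqle : ∀ y ∈ Metric.ball x (3 * ε), ∀ z ∈ Metric.ball x (3 * ε),
      ‖q y z‖ ≤ R * ‖y - z‖ := by
    intro y hy z hz
    have a1 : ‖(2⁻¹ : ℝ) • (g y + g z)‖ ≤ R := by
      rw [norm_smul, Real.norm_of_nonneg (by norm_num)]
      have := norm_add_le (g y) (g z)
      have := hgR y (hreg y hy).2
      have := hgR z (hreg z hz).2
      simp only [hg] at *
      linarith
    have a2 : |‖z‖ - ‖y‖| ≤ ‖y - z‖ := by
      rw [norm_sub_rev]; exact abs_norm_sub_norm_le z y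
    rw [hq, norm_smul, mul_comm R]
    exact mul_le_mul a2 a1 (norm_nonneg _) (norm_nonneg _)
  have hgmono : ∀ y z, 0 ≤ inner ℝ (g y - g z) (y - z) := by
    intro y z
    have e : g y - g z = (gradient u y - gradient u z) - m • (y - z) := by
      simp only [hg, smul_sub]; abel
    rw [e, inner_sub_left, real_inner_smul_left, real_inner_self_eq_norm_sq]
    nlinarith [hmono y z, sq_nonneg ‖y - z‖]
  have htlow : ∀ y ∈ Metric.ball x (3 * ε), ∀ z ∈ Metric.ball x (3 * ε),
      17 / 20 * t₀ ≤ tb y z := fun y hy z hz => by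
    have := (abs_le.1 (hnorm y _ hy)).2
    have := (abs_le.1 (hnorm z _ hz)).2
    simp only [htb]; linarith
  have htup : ∀ y ∈ Metric.ball x ε, ∀ z ∈ Metric.ball x ε, tb y z ≤ 21 / 20 * t₀ :=
    fun y hy z hz => by
      have := (abs_le.1 (hnorm y _ hy)).1
      have := (abs_le.1 (hnorm z _ hz)).1
      simp only [htb]; linarith
  -- A Lipschitz constant of g recovered from that of the field: the mean cutoff times the increment
  -- of g is at most (M + R + (R + m))|y - z| ≤ 3M|y - z|. It blows up as t₀ → 0, but its product
  -- with the cutoff does not.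
  set K := 3 * M / (17 / 20 * t₀) with hK
  have hKpos : 0 < K := by positivity
  have hglip : ∀ y ∈ Metric.ball x (3 * ε), ∀ z ∈ Metric.ball x (3 * ε),
      ‖g y - g z‖ ≤ K * ‖y - z‖ := by
    intro y hy z hz
    have hl := htlow y hy z hz
    have htpos : 0 < tb y z := by linarith
    have e : tb y z • (g y - g z) = (b y - b z) - q y z - (R + m) • (y - z) := by
      rw [hdec y hy z hz, add_smul]; abel
    have n1 : tb y z * ‖g y - g z‖ ≤ 3 * M * ‖y - z‖ := by
      rw [← Real.norm_of_nonneg htpos.le, ← norm_smul, e]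
      refine (norm_sub_le _ _).trans ?_
      have a1 := norm_sub_le (b y - b z) (q y z)
      have a2 := hlip y z
      have a3 := hqle y hy z hz
      have a4 : ‖(R + m) • (y - z)‖ = (R + m) * ‖y - z‖ := by
        rw [norm_smul, Real.norm_of_nonneg (by linarith)]
      have a5 := norm_nonneg (y - z)
      rw [a4]
      nlinarith
    rw [hK, div_mul_eq_mul_div, le_div_iff₀ (by positivity)]
    calc _ ≤ ‖g y - g z‖ * tb y z := mul_le_mul_of_nonneg_left hl (norm_nonneg _)
      _ ≤ _ := by rw [mul_comm]; exact n1
  have hgrad : ∀ y, HasGradientAt (fun y => 1 * u y + (-m) * (‖y‖ ^ 2 / 2) + 0 * (0 : ℝ)) (g y) y :=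
    fun y => by
      have := hasGradientAt_combination (hu y).hasGradientAt (hasGradientAt_norm_sq_half y)
        (hasGradientAt_const y (0 : ℝ)) 1 (-m) 0
      convert this using 1
      simp only [hg]
      module
  refine ⟨ε, hεpos, fun y hy z hz => ?_⟩
  have hy3 := hsub y hy
  have hz3 := hsub z hz
  have hl := htlow y hy3 z hz3
  have htpos : 0 < tb y z := by linarith
  have hcoco := norm_sq_le_inner_of_gradient hKpos (fun y _ => hgrad y)
    (fun y _ z _ => hgmono y z) hglip hy hz
  have A0 : 0 ≤ inner ℝ (tb y z • (g y - g z)) (y - z) := by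
    rw [real_inner_smul_left]; exact mul_nonneg htpos.le (hgmono y z)
  have A1 : ‖tb y z • (g y - g z)‖ ^ 2 ≤ 4 * M * inner ℝ (tb y z • (g y - g z)) (y - z) := by
    -- (21/20)·3/(17/20) = 63/17 < 4.
    have htK : tb y z * K ≤ 4 * M := by
      rw [hK, mul_div_assoc', div_le_iff₀ (by positivity)]
      nlinarith [htup y hy z hz, mul_pos hM ht₀pos]
    calc ‖tb y z • (g y - g z)‖ ^ 2 = tb y z ^ 2 * ‖g y - g z‖ ^ 2 := by
          rw [norm_smul, mul_pow, Real.norm_of_nonneg htpos.le]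
      _ ≤ tb y z ^ 2 * (K * inner ℝ (g y - g z) (y - z)) :=
          mul_le_mul_of_nonneg_left hcoco (sq_nonneg _)
      _ = (tb y z * K) * inner ℝ (tb y z • (g y - g z)) (y - z) := by
          rw [real_inner_smul_left]; ring
      _ ≤ _ := mul_le_mul_of_nonneg_right htK A0
  obtain ⟨B0, B1⟩ := norm_sq_le_of_near_scalar hR (hqle y hy3 z hz3)
  have C0 : inner ℝ (m • (y - z)) (y - z) = m * ‖y - z‖ ^ 2 := by
    rw [real_inner_smul_left, real_inner_self_eq_norm_sq]
  have C0' : 0 ≤ inner ℝ (m • (y - z)) (y - z) := by rw [C0]; positivity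
  have C1 : ‖m • (y - z)‖ ^ 2 ≤ m * inner ℝ (m • (y - z)) (y - z) := by
    rw [C0, norm_smul, mul_pow, Real.norm_of_nonneg hm.le]; exact le_of_eq (by ring)
  have S1 := norm_add_sq_le_of_coco (by positivity) (by positivity) A0 B0 A1 B1
  have S0 : 0 ≤ inner ℝ (tb y z • (g y - g z) + (R • (y - z) + q y z)) (y - z) := by
    rw [inner_add_left]; exact add_nonneg A0 B0
  have S2 := norm_add_sq_le_of_coco (by positivity) hm.le S0 C0' S1 C1
  rw [← hdec y hy3 z hz3] at S2
  have S3 : inner ℝ (b y - b z) (y - z)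
      = inner ℝ (tb y z • (g y - g z) + (R • (y - z) + q y z)) (y - z) + m * ‖y - z‖ ^ 2 := by
    rw [hdec y hy3 z hz3, inner_add_left, C0]
  have S4 : m * ‖y - z‖ ^ 2 ≤ inner ℝ (b y - b z) (y - z) := by rw [S3]; linarith
  -- The constants add up to 4M + 2R + m ≤ 7M because R + m ≤ M.
  refine ⟨S4, S2.trans (mul_le_mul_of_nonneg_right (by linarith) (le_trans (by positivity) S4))⟩

/-- The tamed drift is strongly monotone and cocoercive. -/
theorem monoCoco_tamedField (hm : 0 < m) (hr : 0 < r) (hR : 0 ≤ R) (hRM : R + m ≤ M)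
    (hu : Differentiable ℝ u)
    (hmono : ∀ x y, 2 * m * ‖x - y‖ ^ 2 ≤ inner ℝ (gradient u x - gradient u y) (x - y))
    (hgR : ∀ x, ‖x‖ < r → ‖gradient u x - m • x‖ ≤ R)
    (hlip : ∀ y z, ‖tamedField (gradient u) m r R y - tamedField (gradient u) m r R z‖
      ≤ M * ‖y - z‖) (x y : E) :
    MonoCoco (tamedField (gradient u) m r R) m (7 * M) x y := by
  have hM : 0 < M := by linarith
  have hcont : Continuous (tamedField (gradient u) m r R) :=
    (LipschitzWith.of_dist_le_mul (K := M.toNNReal) fun y z => by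
      rw [dist_eq_norm, dist_eq_norm, Real.coe_toNNReal _ hM.le]; exact hlip y z).continuous
  -- The spheres where the cutoffs change formula, together with the origin, where the norm is not
  -- differentiable. Small r, with r - 2 or r - 1 negative, is allowed.
  refine monoCoco_of_locally hcont (by positivity) (ρs := {0, r - 2, r - 1, r})
    (Set.toFinite _) (fun x hx => ?_) x y
  simp only [Set.mem_insert_iff, Set.mem_singleton_iff, not_or] at hx
  obtain ⟨hx0, hx2, hx1, hxr⟩ := hx
  have hne : ∀ y : E, 0 < ‖y‖ → y ≠ 0 := fun y hy => norm_pos_iff.1 hy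
  have hxpos : 0 < ‖x‖ := lt_of_le_of_ne (norm_nonneg x) (Ne.symm hx0)
  rcases lt_or_gt_of_ne hx2 with hlt2 | hgt2
  · refine monoCoco_near_of_potential (φ := u) (U := {y | ‖y‖ < r - 2}) hm.le hM (by linarith)
      hlip (isOpen_lt continuous_norm continuous_const) (fun y hy => ?_) (fun y hy z hz => ?_) hlt2
    · rw [tamedField_of_lt hy]; exact (hu y).hasGradientAt
    · rw [tamedField_of_lt hy, tamedField_of_lt hz]
      nlinarith [hmono y z, sq_nonneg ‖y - z‖]
  rcases lt_or_gt_of_ne hx1 with hlt1 | hgt1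
  · refine monoCoco_near_of_potential
      (φ := fun y => 1 * u y + R * (‖y‖ ^ 3 / 3) + (-(R * (r - 2))) * (‖y‖ ^ 2 / 2))
      (U := {y | (r - 2 < ‖y‖ ∧ ‖y‖ < r - 1) ∧ 0 < ‖y‖}) hm.le hM (by linarith) hlip
      (((isOpen_lt continuous_const continuous_norm).inter
        (isOpen_lt continuous_norm continuous_const)).inter
        (isOpen_lt continuous_const continuous_norm))
      (fun y hy => ?_) (fun y hy z hz => ?_) ⟨⟨hgt2, hlt1⟩, hxpos⟩
    · rw [tamedField_of_mem_inner hy.1.1 hy.1.2]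
      convert hasGradientAt_combination (hu y).hasGradientAt (hasGradientAt_norm_cube (hne y hy.2))
        (hasGradientAt_norm_sq_half y) 1 R (-(R * (r - 2))) using 1
      module
    · rw [tamedField_of_mem_inner hy.1.1 hy.1.2, tamedField_of_mem_inner hz.1.1 hz.1.2]
      have hrad := inner_radial_nonneg (y := y) (z := z) (α := ‖y‖ - (r - 2))
        (β := ‖z‖ - (r - 2)) (by linarith [hy.1.1]) (by linarith [hz.1.1]) (by
          have e : ((‖y‖ - (r - 2)) * ‖y‖ - (‖z‖ - (r - 2)) * ‖z‖) * (‖y‖ - ‖z‖)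
              = ((‖y‖ - (r - 2)) + ‖z‖) * (‖y‖ - ‖z‖) ^ 2 := by ring
          rw [e]
          exact mul_nonneg (by linarith [hy.1.1, norm_nonneg z]) (sq_nonneg _))
      have e : gradient u y + (R * (‖y‖ - (r - 2))) • y
          - (gradient u z + (R * (‖z‖ - (r - 2))) • z)
          = (gradient u y - gradient u z)
            + R • ((‖y‖ - (r - 2)) • y - (‖z‖ - (r - 2)) • z) := by module
      rw [e, inner_add_left, real_inner_smul_left]
      nlinarith [hmono y z, sq_nonneg ‖y - z‖, mul_nonneg hR hrad]
  rcases lt_or_gt_of_ne hxr with hltr | hgtr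
  · exact monoCoco_tamedField_annulus hm hR hRM hu hmono hgR hlip hgt1 hltr
  -- Outside the ball the field is the gradient of Rr|y| + m|y|²/2.
  · refine monoCoco_near_of_potential
      (φ := fun y => R * r * ‖y‖ + m * (‖y‖ ^ 2 / 2) + 0 * (0 : ℝ))
      (U := {y | r < ‖y‖}) hm.le hM (by linarith) hlip
      (isOpen_lt continuous_const continuous_norm) (fun y hy => ?_) (fun y hy z hz => ?_) hgtr
    · rw [tamedField_of_gt hy]
      convert hasGradientAt_combination (hasGradientAt_norm (hne y (hr.trans hy)))
        (hasGradientAt_norm_sq_half y) (hasGradientAt_const y (0 : ℝ)) (R * r) m 0 using 1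
      module
    · rw [tamedField_of_gt hy, tamedField_of_gt hz]
      have hy0 : 0 < ‖y‖ := hr.trans hy
      have hz0 : 0 < ‖z‖ := hr.trans hz
      have hrad := inner_radial_nonneg (y := y) (z := z) (α := ‖y‖⁻¹) (β := ‖z‖⁻¹)
        (by positivity) (by positivity) (by
          rw [inv_mul_cancel₀ hy0.ne', inv_mul_cancel₀ hz0.ne']; simp)
      have e : (R * r * ‖y‖⁻¹) • y + m • y - ((R * r * ‖z‖⁻¹) • z + m • z)
          = (R * r) • (‖y‖⁻¹ • y - ‖z‖⁻¹ • z) + m • (y - z) := by module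
      rw [e, inner_add_left, real_inner_smul_left, real_inner_smul_left,
        real_inner_self_eq_norm_sq]
      nlinarith [mul_nonneg (mul_nonneg hR hr.le) hrad]

end Field

/-! ### The tamed drift as an instance of the tamed field. -/

section Drift

variable {d : ℕ} {u : EuclideanSpace ℝ (Fin d) → ℝ} {m L l lam : ℝ}

lemma tameRadius_pos (hm : 0 < m) (hL : 0 < L) (hlam : 0 < lam) : 0 < tameRadius m L l lam :=
  mul_pos (by linarith) (Real.rpow_pos_of_pos (by positivity) _)

/-- The infimum is attained, since every difference quotient is a lower bound for the admissible
constants. -/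
lemma lipschitzWith_lipConst {f : EuclideanSpace ℝ (Fin d) → EuclideanSpace ℝ (Fin d)}
    (h : ∃ K : NNReal, LipschitzWith K f) : LipschitzWith (lipConst f) f := by
  refine LipschitzWith.of_dist_le_mul fun x y => ?_
  rcases (dist_nonneg (x := x) (y := y)).eq_or_lt with h0 | h0
  · rw [dist_eq_zero.1 h0.symm]; simp
  · rw [← div_le_iff₀ h0]
    have : (dist (f x) (f y) / dist x y).toNNReal ≤ lipConst f :=
      le_csInf h fun K hK => Real.toNNReal_le_iff_le_coe.2
        ((div_le_iff₀ h0).2 (LipschitzWith.dist_le_mul hK x y))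
    exact Real.toNNReal_le_iff_le_coe.1 this

theorem tamedDrift_properties (hd : 0 < d) (hu : Differentiable ℝ u) (hm : 0 < m) (hL : 0 < L)
    (hl : 0 < l) (hmono : StronglyMonotone (gradient u) m) (hpoly : PolyLipschitz (gradient u) L l)
    (hlam : 0 < lam) :
    LipschitzWith (lipConst (tamedDrift (gradient u) m L l lam)) (tamedDrift (gradient u) m L l lam)
      ∧ m ≤ lipConst (tamedDrift (gradient u) m L l lam)
      ∧ ∀ x y, MonoCoco (tamedDrift (gradient u) m L l lam) m
        (7 * lipConst (tamedDrift (gradient u) m L l lam)) x y := by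
  have hr : 0 < tameRadius m L l lam := tameRadius_pos hm hL hlam
  set r := tameRadius m L l lam with hrdef
  set R := supBall (shifted (gradient u) m) r with hRdef
  have hfield : tamedDrift (gradient u) m L l lam = tamedField (gradient u) m r R := rfl
  set G := L * (1 + r + r) ^ l + m with hGdef
  have hG : 0 ≤ G := by positivity
  have hgG : ∀ x y : EuclideanSpace ℝ (Fin d), ‖x‖ < r → ‖y‖ < r →
      ‖(gradient u x - m • x) - (gradient u y - m • y)‖ ≤ G * ‖x - y‖ := by
    intro x y hx hy
    have e : (gradient u x - m • x) - (gradient u y - m • y)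
        = (gradient u x - gradient u y) - m • (x - y) := by module
    have h1 := hpoly x y
    have h2 : (1 + ‖x‖ + ‖y‖) ^ l ≤ (1 + r + r) ^ l :=
      Real.rpow_le_rpow (by positivity) (by linarith) hl.le
    have h3 := mul_le_mul_of_nonneg_right (mul_le_mul_of_nonneg_left h2 hL.le)
      (norm_nonneg (x - y))
    rw [e]
    refine (norm_sub_le _ _).trans ?_
    rw [norm_smul, Real.norm_of_nonneg hm.le, hGdef, add_mul]
    linarith
  have hbdd : BddAbove ((fun x => ‖shifted (gradient u) m x‖) '' Metric.ball 0 r) := by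
    refine ⟨‖shifted (gradient u) m 0‖ + G * r, ?_⟩
    rintro _ ⟨x, hx, rfl⟩
    have hx' : ‖x‖ < r := by simpa using hx
    have h1 := hgG x 0 hx' (by simpa using hr)
    rw [sub_zero] at h1
    have h2 := norm_sub_norm_le (shifted (gradient u) m x) (shifted (gradient u) m 0)
    have h3 := mul_le_mul_of_nonneg_left hx'.le hG
    have h4 : ‖shifted (gradient u) m x - shifted (gradient u) m 0‖ ≤ G * ‖x‖ := h1
    simp only
    linarith
  have hgR : ∀ x, ‖x‖ < r → ‖gradient u x - m • x‖ ≤ R := fun x hx =>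
    le_csSup hbdd ⟨x, by simpa using hx, rfl⟩
  have hR : 0 ≤ R := (norm_nonneg _).trans (hgR 0 (by simpa using hr))
  have hLip := lipschitzWith_lipConst
    (exists_lipschitzWith_tamedField hr hR hm.le hgR hG hgG)
  rw [hfield]
  set M := lipConst (tamedField (gradient u) m r R) with hM
  have hlip : ∀ y z, ‖tamedField (gradient u) m r R y - tamedField (gradient u) m r R z‖
      ≤ M * ‖y - z‖ := fun y z => by
    simpa only [dist_eq_norm] using hLip.dist_le_mul y z
  have : Nonempty (Fin d) := ⟨⟨0, hd⟩⟩
  have hRM : R + m ≤ M := add_le_of_tamedField_lipschitz hr (by linarith) hlip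
  exact ⟨hLip, by linarith, monoCoco_tamedField hm hr hR hRM hu hmono hgR hlip⟩

end Drift
end TamedKinetic
end

noncomputable section

open MeasureTheory ProbabilityTheory Filter Topology

namespace TamedKinetic

/-! ### Contraction of the deterministic part of the scheme -/

/-- Here η = λγ, p = (1 - e^(-η))/2, κ = m/γ² and q is the drift increment over γ². With w = c - a
the change of |a|² + |c|² is -2p(1-p)|w|² + (2η² + 8p²)|q|² - 4η⟨q,a⟩ - 2(η + 2p - 4p²)⟨w,q⟩. The
first term pays for half of the cross term, and cocoercivity pays for everything quadratic in q. -/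
lemma contraction_estimate {E : Type*} [NormedAddCommGroup E] [InnerProductSpace ℝ E]
    {a c q : E} {p η κ : ℝ} (hη : 0 < η) (hη' : η ≤ 1 / 2) (hp : η / 3 ≤ p) (hp' : p ≤ η / 2)
    (hκ : 0 ≤ κ) (hκ' : κ ≤ 1 / 25) (hmono : κ * ‖a‖ ^ 2 ≤ inner ℝ q a)
    (hcoco : 25 * ‖q‖ ^ 2 ≤ 7 * inner ℝ q a) :
    ‖a + p • (c - a) - (η - 2 * p) • q‖ ^ 2 + ‖c - p • (c - a) - (η + 2 * p) • q‖ ^ 2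
      ≤ (1 - η * κ / 5) * (‖a‖ ^ 2 + ‖c‖ ^ 2) := by
  obtain ⟨w, rfl⟩ : ∃ w, c = a + w := ⟨c - a, by abel⟩
  have e1 : a + p • (a + w - a) - (η - 2 * p) • q = a + p • w - (η - 2 * p) • q := by module
  have e2 : a + w - p • (a + w - a) - (η + 2 * p) • q = a + (1 - p) • w - (η + 2 * p) • q := by
    module
  have hexp : ∀ s t : ℝ, ‖a + s • w - t • q‖ ^ 2 = ‖a‖ ^ 2 + s ^ 2 * ‖w‖ ^ 2 + t ^ 2 * ‖q‖ ^ 2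
      + 2 * s * inner ℝ a w - 2 * t * inner ℝ q a - 2 * s * t * inner ℝ w q := fun s t => by
    rw [norm_sub_sq_real, norm_add_sq_real, inner_add_left, norm_smul, norm_smul,
      real_inner_smul_right, real_inner_smul_right, real_inner_smul_right, real_inner_smul_left,
      mul_pow, mul_pow, Real.norm_eq_abs, Real.norm_eq_abs, sq_abs, sq_abs, real_inner_comm q a]
    ring
  have hc : ‖a + w‖ ^ 2 = ‖a‖ ^ 2 + 2 * inner ℝ a w + ‖w‖ ^ 2 := norm_add_sq_real a w
  have hwq := (abs_le.1 (abs_real_inner_le_norm w q)).1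
  have haw := real_inner_le_norm a w
  rw [e1, e2, hexp, hexp, hc]
  set A := ‖a‖
  set W := ‖w‖
  set Q := ‖q‖
  set aw := inner ℝ a w
  set aq := inner ℝ q a
  set wq := inner ℝ w q
  have haw' : 2 * aw ≤ A ^ 2 + W ^ 2 := by nlinarith [sq_nonneg (A - W)]
  -- Weights chosen so that the cross term costs (2/5)ηW², below the gain (1/2)ηW², and 10ηQ². The
  -- total 12ηQ² is at most 3.36η⟨q,a⟩, leaving 0.64η⟨q,a⟩ of the available 4η⟨q,a⟩.
  have hwq' : -wq ≤ W ^ 2 / 10 + 5 / 2 * Q ^ 2 := by nlinarith [sq_nonneg (W - 5 * Q)]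
  have hs0 : 0 ≤ η + 2 * p - 4 * p ^ 2 := by nlinarith
  have hs1 : η + 2 * p - 4 * p ^ 2 ≤ 2 * η := by nlinarith
  have hrhs : 0 ≤ W ^ 2 / 10 + 5 / 2 * Q ^ 2 := by positivity
  have t1 : -(2 * (η + 2 * p - 4 * p ^ 2) * wq) ≤ 4 * η * (W ^ 2 / 10 + 5 / 2 * Q ^ 2) := by
    have h1 := mul_le_mul_of_nonneg_left hwq' hs0
    have h2 := mul_le_mul_of_nonneg_right hs1 hrhs
    linarith
  have t2 : η / 2 * W ^ 2 ≤ 2 * p * (1 - p) * W ^ 2 :=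
    mul_le_mul_of_nonneg_right (by nlinarith) (sq_nonneg _)
  have t3 : (2 * η ^ 2 + 8 * p ^ 2) * Q ^ 2 ≤ 2 * η * Q ^ 2 :=
    mul_le_mul_of_nonneg_right (by nlinarith) (sq_nonneg _)
  have t4 : η * (25 * Q ^ 2) ≤ η * (7 * aq) := mul_le_mul_of_nonneg_left hcoco hη.le
  have t5 : η * (κ * A ^ 2) ≤ η * aq := mul_le_mul_of_nonneg_left hmono hη.le
  have t6 : η * κ / 5 * (2 * aw) ≤ η * κ / 5 * (A ^ 2 + W ^ 2) :=
    mul_le_mul_of_nonneg_left haw' (by positivity)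
  have t7 : η * κ * W ^ 2 ≤ η * (1 / 25) * W ^ 2 :=
    mul_le_mul_of_nonneg_right (mul_le_mul_of_nonneg_left hκ' hη.le) (sq_nonneg _)
  have t8 : 0 ≤ η * κ * A ^ 2 := by positivity
  have t9 : 0 ≤ η * W ^ 2 := by positivity
  linarith

section StepMap

variable {d : ℕ}

local notation "𝔼" => EuclideanSpace ℝ (Fin d)

/-- The deterministic part of one step of the scheme, in the coordinates `coordM`. -/
def stepMap (b : EuclideanSpace ℝ (Fin d) → EuclideanSpace ℝ (Fin d)) (γ lam : ℝ)
    (z : WithLp 2 (EuclideanSpace ℝ (Fin d) × EuclideanSpace ℝ (Fin d))) :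
    WithLp 2 (EuclideanSpace ℝ (Fin d) × EuclideanSpace ℝ (Fin d)) :=
  WithLp.toLp 2
    (z.fst + ((1 - Real.exp (-γ * lam)) / 2) • (z.snd - z.fst)
      - ((lam * γ - 2 * ((1 - Real.exp (-γ * lam)) / 2)) / γ ^ 2) • b z.fst,
     z.snd - ((1 - Real.exp (-γ * lam)) / 2) • (z.snd - z.fst)
      - ((lam * γ + 2 * ((1 - Real.exp (-γ * lam)) / 2)) / γ ^ 2) • b z.fst)

lemma lipschitzWith_stepMap {b : 𝔼 → 𝔼} {m M γ lam : ℝ} (hm : 0 < m) (hmM : m ≤ M)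
    (hb : ∀ x y, MonoCoco b m (7 * M) x y) (hγ : 0 < γ) (hγM : 25 * M ≤ γ ^ 2) (hlam : 0 < lam)
    (hlam' : lam * γ ≤ 1 / 2) :
    LipschitzWith (√(1 - lam * γ * (m / γ ^ 2) / 5)).toNNReal (stepMap b γ lam) := by
  have hM : 0 < M := hm.trans_le hmM
  have hη : 0 < lam * γ := mul_pos hlam hγ
  set p := (1 - Real.exp (-γ * lam)) / 2 with hp
  have hp1 : p ≤ lam * γ / 2 := by
    have := Real.add_one_le_exp (-γ * lam)
    rw [hp]; linarith
  have hp2 : lam * γ / 3 ≤ p := by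
    have h1 := Real.add_one_le_exp (lam * γ)
    have h2 : Real.exp (-γ * lam) ≤ (1 + lam * γ)⁻¹ := by
      rw [show -γ * lam = -(lam * γ) by ring, Real.exp_neg]
      exact inv_anti₀ (by linarith) (by linarith)
    -- This is where λγ ≤ 1/2 is sharp: (1 + x)(1 - 2x/3) ≥ 1 for 0 ≤ x ≤ 1/2.
    have h3 : (1 + lam * γ)⁻¹ ≤ 1 - 2 / 3 * (lam * γ) := by
      rw [inv_le_iff_one_le_mul₀ (by linarith)]
      nlinarith
    rw [hp]; linarith
  have hκ : 0 ≤ m / γ ^ 2 := by positivity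
  have hκ' : m / γ ^ 2 ≤ 1 / 25 := by
    rw [div_le_div_iff₀ (by positivity) (by norm_num)]; linarith
  have hρ : 0 ≤ 1 - lam * γ * (m / γ ^ 2) / 5 := by nlinarith
  refine LipschitzWith.of_dist_le_mul fun z z' => ?_
  rw [Real.coe_toNNReal _ (Real.sqrt_nonneg _), dist_eq_norm, dist_eq_norm]
  refine abs_le_of_sq_le_sq' ?_ (by positivity) |>.2
  rw [mul_pow, Real.sq_sqrt hρ, WithLp.prod_norm_sq_eq_of_L2, WithLp.prod_norm_sq_eq_of_L2]
  obtain ⟨h1, h2⟩ := hb z.fst z'.fst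
  have hγ2 : 0 < γ ^ 2 := by positivity
  have key := contraction_estimate (a := z.fst - z'.fst) (c := z.snd - z'.snd)
    (q := (γ ^ 2)⁻¹ • (b z.fst - b z'.fst)) hη hlam' hp2 hp1 hκ hκ'
    (by
      rw [real_inner_smul_left, div_mul_eq_mul_div, div_eq_inv_mul]
      exact mul_le_mul_of_nonneg_left h1 (by positivity))
    (by
      have h0 : 0 ≤ inner ℝ (b z.fst - b z'.fst) (z.fst - z'.fst) := le_trans (by positivity) h1
      rw [norm_smul, real_inner_smul_left, mul_pow, Real.norm_of_nonneg (by positivity)]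
      have h3 : 25 * ‖b z.fst - b z'.fst‖ ^ 2
          ≤ 7 * γ ^ 2 * inner ℝ (b z.fst - b z'.fst) (z.fst - z'.fst) := by nlinarith
      have h4 := mul_le_mul_of_nonneg_left h3 (by positivity : 0 ≤ ((γ ^ 2)⁻¹) ^ 2)
      have h5 : ((γ ^ 2)⁻¹) ^ 2 * (7 * γ ^ 2 * inner ℝ (b z.fst - b z'.fst) (z.fst - z'.fst))
          = 7 * ((γ ^ 2)⁻¹ * inner ℝ (b z.fst - b z'.fst) (z.fst - z'.fst)) := by
        field_simp
      linarith)
  refine le_trans (le_of_eq ?_) key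
  have f1 : (stepMap b γ lam z - stepMap b γ lam z').fst
      = z.fst - z'.fst + p • (z.snd - z'.snd - (z.fst - z'.fst))
        - (lam * γ - 2 * p) • (γ ^ 2)⁻¹ • (b z.fst - b z'.fst) := by
    change (z.fst + p • (z.snd - z.fst) - ((lam * γ - 2 * p) / γ ^ 2) • b z.fst)
      - (z'.fst + p • (z'.snd - z'.fst) - ((lam * γ - 2 * p) / γ ^ 2) • b z'.fst) = _
    module
  have f2 : (stepMap b γ lam z - stepMap b γ lam z').snd
      = z.snd - z'.snd - p • (z.snd - z'.snd - (z.fst - z'.fst))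
        - (lam * γ + 2 * p) • (γ ^ 2)⁻¹ • (b z.fst - b z'.fst) := by
    change (z.snd - p • (z.snd - z.fst) - ((lam * γ + 2 * p) / γ ^ 2) • b z.fst)
      - (z'.snd - p • (z'.snd - z'.fst) - ((lam * γ + 2 * p) / γ ^ 2) • b z'.fst) = _
    module
  rw [f1, f2]

/-- The noise of one step of the scheme, in the coordinates `coordM`. -/
def stepNoise (γ : ℝ) (ξ ξ' : EuclideanSpace ℝ (Fin d)) :
    WithLp 2 (EuclideanSpace ℝ (Fin d) × EuclideanSpace ℝ (Fin d)) :=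
  WithLp.toLp 2 (√(2 * γ) • ξ', √(2 * γ) • ξ' + (√(2 * γ) * (2 / γ)) • ξ)

lemma coordM_expScheme_succ {Ω : Type*} (b : 𝔼 → 𝔼) {γ lam : ℝ} (hγ : 0 < γ)
    (θ₀ V₀ : Ω → 𝔼) (Ξ Ξ' : ℕ → Ω → 𝔼) (n : ℕ) (ω : Ω) :
    coordM γ (expScheme b γ lam θ₀ V₀ Ξ Ξ' (n + 1) ω)
      = stepMap b γ lam (coordM γ (expScheme b γ lam θ₀ V₀ Ξ Ξ' n ω))
        + stepNoise γ (Ξ n ω) (Ξ' n ω) := by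
  set z := expScheme b γ lam θ₀ V₀ Ξ Ξ' n ω with hz
  have hs : expScheme b γ lam θ₀ V₀ Ξ Ξ' (n + 1) ω
      = (z.1 + psi1 γ lam • z.2 - psi2 γ lam • b z.1 + √(2 * γ) • Ξ' n ω,
     psi0 γ lam • z.2 - psi1 γ lam • b z.1 + √(2 * γ) • Ξ n ω) := rfl
  rw [hs]
  have hγ' := hγ.ne'
  have e1 : psi1 γ lam = ((1 - Real.exp (-γ * lam)) / 2) * (2 / γ) := by
    unfold psi1; field_simp
  have e2 : psi2 γ lam = (lam * γ - 2 * ((1 - Real.exp (-γ * lam)) / 2)) / γ ^ 2 := by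
    unfold psi2; ring
  have e3 : (2 / γ) * psi0 γ lam + psi1 γ lam
      = (1 - ((1 - Real.exp (-γ * lam)) / 2)) * (2 / γ) := by
    unfold psi0 psi1; field_simp; ring
  have e4 : (2 / γ) * psi1 γ lam + psi2 γ lam
      = (lam * γ + 2 * ((1 - Real.exp (-γ * lam)) / 2)) / γ ^ 2 := by
    unfold psi1 psi2; field_simp; ring
  set p := (1 - Real.exp (-γ * lam)) / 2 with hp
  refine WithLp.ofLp_injective 2 (Prod.ext ?_ ?_)
  · change z.1 + psi1 γ lam • z.2 - psi2 γ lam • b z.1 + √(2 * γ) • Ξ' n ω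
      = (z.1 + p • (z.1 + (2 / γ) • z.2 - z.1) - ((lam * γ - 2 * p) / γ ^ 2) • b z.1)
        + √(2 * γ) • Ξ' n ω
    rw [← e2, e1]
    module
  · change (z.1 + psi1 γ lam • z.2 - psi2 γ lam • b z.1 + √(2 * γ) • Ξ' n ω)
      + (2 / γ) • (psi0 γ lam • z.2 - psi1 γ lam • b z.1 + √(2 * γ) • Ξ n ω)
      = (z.1 + (2 / γ) • z.2 - p • (z.1 + (2 / γ) • z.2 - z.1)
        - ((lam * γ + 2 * p) / γ ^ 2) • b z.1)
        + (√(2 * γ) • Ξ' n ω + (√(2 * γ) * (2 / γ)) • Ξ n ω)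
    have e5 : (2 / γ) • psi0 γ lam • z.2 + psi1 γ lam • z.2 = ((1 - p) * (2 / γ)) • z.2 := by
      rw [← e3]; module
    have e6 : z.1 + psi1 γ lam • z.2 - psi2 γ lam • b z.1 + √(2 * γ) • Ξ' n ω
        + (2 / γ) • (psi0 γ lam • z.2 - psi1 γ lam • b z.1 + √(2 * γ) • Ξ n ω)
        = z.1 + ((2 / γ) • psi0 γ lam • z.2 + psi1 γ lam • z.2)
          - ((2 / γ) * psi1 γ lam + psi2 γ lam) • b z.1
          + (√(2 * γ) • Ξ' n ω + (√(2 * γ) * (2 / γ)) • Ξ n ω) := by module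
    rw [e6, e5, e4]
    module

lemma stepNoise_add (γ : ℝ) (ξ ξ' ζ ζ' : 𝔼) :
    stepNoise γ (ξ + ζ) (ξ' + ζ') = stepNoise γ ξ ξ' + stepNoise γ ζ ζ' := by
  refine WithLp.ofLp_injective 2 (Prod.ext ?_ ?_)
  · change √(2 * γ) • (ξ' + ζ') = √(2 * γ) • ξ' + √(2 * γ) • ζ'
    module
  · change √(2 * γ) • (ξ' + ζ') + (√(2 * γ) * (2 / γ)) • (ξ + ζ)
      = √(2 * γ) • ξ' + (√(2 * γ) * (2 / γ)) • ξ + (√(2 * γ) • ζ' + (√(2 * γ) * (2 / γ)) • ζ)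
    module

lemma stepNoise_zero (γ : ℝ) : stepNoise γ (0 : 𝔼) 0 = 0 := by
  simp [stepNoise]

lemma stepNoise_sum {ι : Type*} (γ : ℝ) (s : Finset ι) (ξ ξ' : ι → 𝔼) :
    stepNoise γ (∑ i ∈ s, ξ i) (∑ i ∈ s, ξ' i) = ∑ i ∈ s, stepNoise γ (ξ i) (ξ' i) := by
  classical
  induction s using Finset.induction_on with
  | empty => simp [stepNoise_zero]
  | insert i s hi ih => simp only [Finset.sum_insert hi, stepNoise_add, ih]

lemma stepNoise_smul_smul (γ x y : ℝ) (e : 𝔼) :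
    stepNoise γ (x • e) (y • e) = x • WithLp.toLp 2 ((0 : 𝔼), (√(2 * γ) * (2 / γ)) • e)
      + y • WithLp.toLp 2 (√(2 * γ) • e, √(2 * γ) • e) := by
  refine WithLp.ofLp_injective 2 (Prod.ext ?_ ?_)
  · change √(2 * γ) • (y • e) = x • (0 : 𝔼) + y • (√(2 * γ) • e)
    module
  · change √(2 * γ) • (y • e) + (√(2 * γ) * (2 / γ)) • (x • e)
      = x • ((√(2 * γ) * (2 / γ)) • e) + y • (√(2 * γ) • e)
    module

end StepMap

/-! ### The noise -/

section Noise

lemma continuous_psi0 (γ : ℝ) : Continuous (psi0 γ) := by unfold psi0; fun_prop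

lemma continuous_psi1 (γ : ℝ) : Continuous (psi1 γ) := by
  unfold psi1; exact Continuous.div_const (by fun_prop) γ

lemma psi0_mem {γ t : ℝ} (hγ : 0 < γ) (ht : 0 ≤ t) : 0 ≤ psi0 γ t ∧ psi0 γ t ≤ 1 :=
  ⟨(Real.exp_pos _).le, Real.exp_le_one_iff.2 (by nlinarith)⟩

lemma psi1_mem {γ t : ℝ} (hγ : 0 < γ) (ht : 0 ≤ t) : 0 ≤ psi1 γ t ∧ psi1 γ t ≤ t := by
  unfold psi1
  constructor
  · exact div_nonneg (sub_nonneg.2 (Real.exp_le_one_iff.2 (by nlinarith))) hγ.le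
  · rw [div_le_iff₀ hγ]
    linarith [Real.add_one_le_exp (-γ * t)]

/-- Writing the covariance form as an integral of squares gives both its positivity and its upper
bound. -/
lemma noiseCov_quadratic (γ lam x y : ℝ) :
    noiseCov γ lam 0 0 * x ^ 2 + (noiseCov γ lam 0 1 + noiseCov γ lam 1 0) * (x * y)
      + noiseCov γ lam 1 1 * y ^ 2 = ∫ t in (0 : ℝ)..lam, (psi0 γ t * x + psi1 γ t * y) ^ 2 := by
  have c0 := continuous_psi0 γ
  have c1 := continuous_psi1 γ
  have i00 : IntervalIntegrable (fun t => psi0 γ t * psi0 γ t) volume 0 lam :=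
    (c0.mul c0).intervalIntegrable _ _
  have i01 : IntervalIntegrable (fun t => psi0 γ t * psi1 γ t) volume 0 lam :=
    (c0.mul c1).intervalIntegrable _ _
  have i11 : IntervalIntegrable (fun t => psi1 γ t * psi1 γ t) volume 0 lam :=
    (c1.mul c1).intervalIntegrable _ _
  have e10 : noiseCov γ lam 1 0 = ∫ t in (0 : ℝ)..lam, psi0 γ t * psi1 γ t := by
    simp only [noiseCov, Matrix.of_apply, Matrix.cons_val_one, Matrix.cons_val_zero, mul_comm]
  have e : ∀ t, (psi0 γ t * x + psi1 γ t * y) ^ 2 = psi0 γ t * psi0 γ t * x ^ 2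
      + psi0 γ t * psi1 γ t * (2 * (x * y)) + psi1 γ t * psi1 γ t * y ^ 2 := fun t => by ring
  simp only [e]
  rw [intervalIntegral.integral_add ((i00.mul_const _).add (i01.mul_const _)) (i11.mul_const _),
    intervalIntegral.integral_add (i00.mul_const _) (i01.mul_const _),
    intervalIntegral.integral_mul_const, intervalIntegral.integral_mul_const,
    intervalIntegral.integral_mul_const, e10]
  simp only [noiseCov, Matrix.of_apply, Matrix.cons_val_one, Matrix.cons_val_zero]
  ring

lemma posSemidef_noiseCov {γ lam : ℝ} (hlam : 0 ≤ lam) : (noiseCov γ lam).PosSemidef := by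
  refine Matrix.PosSemidef.of_dotProduct_mulVec_nonneg ?_ fun x => ?_
  · ext i j
    fin_cases i <;> fin_cases j <;> simp [noiseCov, mul_comm]
  · have h := noiseCov_quadratic γ lam (x 0) (x 1)
    have h0 : 0 ≤ ∫ t in (0 : ℝ)..lam, (psi0 γ t * x 0 + psi1 γ t * x 1) ^ 2 :=
      intervalIntegral.integral_nonneg hlam fun t _ => sq_nonneg _
    rw [← h] at h0
    refine h0.trans_eq ?_
    simp only [dotProduct, Matrix.mulVec, Fin.sum_univ_two, Pi.star_apply, star_trivial]
    ring

lemma noiseCov_quadratic_le {γ lam : ℝ} (hγ : 0 < γ) (hlam : 0 ≤ lam) (x y : ℝ) :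
    ∫ t in (0 : ℝ)..lam, (psi0 γ t * x + psi1 γ t * y) ^ 2
      ≤ 2 * lam * (x ^ 2 + lam ^ 2 * y ^ 2) := by
  have c0 := continuous_psi0 γ
  have c1 := continuous_psi1 γ
  have h := intervalIntegral.integral_mono_on (μ := volume) hlam
    (f := fun t => (psi0 γ t * x + psi1 γ t * y) ^ 2)
    (g := fun _ => 2 * (x ^ 2 + lam ^ 2 * y ^ 2))
    (Continuous.intervalIntegrable (by fun_prop) _ _) (by simp) fun t ht => ?_
  · refine h.trans_eq ?_
    rw [intervalIntegral.integral_const, smul_eq_mul]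
    ring
  · obtain ⟨a0, a1⟩ := psi0_mem hγ ht.1
    obtain ⟨b0, b1⟩ := psi1_mem hγ ht.1
    have s0 : psi0 γ t ^ 2 ≤ 1 := by nlinarith
    have s1 : psi1 γ t ^ 2 ≤ lam ^ 2 := pow_le_pow_left₀ b0 (b1.trans ht.2) 2
    have k1 := mul_le_mul_of_nonneg_right s0 (sq_nonneg x)
    have k2 := mul_le_mul_of_nonneg_right s1 (sq_nonneg y)
    nlinarith [sq_nonneg (psi0 γ t * x - psi1 γ t * y)]

lemma addsForm_of_hasLaw {F Ω : Type*} [NormedAddCommGroup F] [InnerProductSpace ℝ F]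
    [CompleteSpace F] [MeasurableSpace F] [BorelSpace F] [FiniteDimensional ℝ F]
    [SecondCountableTopology F] [MeasurableSpace Ω] {P : Measure Ω}
    {S : Matrix (Fin 2) (Fin 2) ℝ} (hS : S.PosSemidef) {x y : Ω → ℝ}
    (h : HasLaw (fun ω => !₂[x ω, y ω]) (multivariateGaussian 0 S) P) (u₀ u₁ : F) :
    AddsForm (P.map fun ω => x ω • u₀ + y ω • u₁)
      (fun ξ => 2 * (S 0 0 * inner ℝ u₀ ξ ^ 2 + (S 0 1 + S 1 0) * (inner ℝ u₀ ξ * inner ℝ u₁ ξ)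
        + S 1 1 * inner ℝ u₁ ξ ^ 2)) := by
  have h1 := addsForm_gaussian_plane hS u₀ u₁
  rw [← h.map_eq, AEMeasurable.map_map_of_aemeasurable (by fun_prop) h.aemeasurable] at h1
  exact h1

lemma measurable_smul_add_smul {F : Type*} [NormedAddCommGroup F] [InnerProductSpace ℝ F]
    [MeasurableSpace F] [BorelSpace F] [SecondCountableTopology F] (u₀ u₁ : F) :
    Measurable fun p : ℝ × ℝ => p.1 • u₀ + p.2 • u₁ := by fun_prop

lemma addsForm_sum_of_hasLaw {F Ω ι : Type*} [NormedAddCommGroup F] [InnerProductSpace ℝ F]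
    [CompleteSpace F] [MeasurableSpace F] [BorelSpace F] [FiniteDimensional ℝ F]
    [SecondCountableTopology F] [MeasurableSpace Ω] {P : Measure Ω} [IsProbabilityMeasure P]
    [Fintype ι] {S : Matrix (Fin 2) (Fin 2) ℝ} (hS : S.PosSemidef) {x y : ι → Ω → ℝ}
    (hx : ∀ i, Measurable (x i)) (hy : ∀ i, Measurable (y i))
    (hind : iIndepFun (fun i ω => (x i ω, y i ω)) P)
    (h : ∀ i, HasLaw (fun ω => !₂[x i ω, y i ω]) (multivariateGaussian 0 S) P) (u₀ u₁ : ι → F) :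
    AddsForm (P.map fun ω => ∑ i, (x i ω • u₀ i + y i ω • u₁ i))
      (fun ξ => ∑ i, 2 * (S 0 0 * inner ℝ (u₀ i) ξ ^ 2
        + (S 0 1 + S 1 0) * (inner ℝ (u₀ i) ξ * inner ℝ (u₁ i) ξ)
        + S 1 1 * inner ℝ (u₁ i) ξ ^ 2)) := by
  classical
  have hYm : ∀ i, Measurable fun ω => x i ω • u₀ i + y i ω • u₁ i := fun i =>
    (measurable_smul_add_smul (u₀ i) (u₁ i)).comp ((hx i).prodMk (hy i))
  have hYind : iIndepFun (fun i ω => x i ω • u₀ i + y i ω • u₁ i) P :=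
    hind.comp (fun i (p : ℝ × ℝ) => p.1 • u₀ i + p.2 • u₁ i)
      (fun i => measurable_smul_add_smul (u₀ i) (u₁ i))
  have hsum := addsForm_sum hYm hYind (fun i => by fun_prop)
    (fun i => addsForm_of_hasLaw hS (h i) (u₀ i) (u₁ i)) Finset.univ
  have hfun : (∑ i, fun ω => x i ω • u₀ i + y i ω • u₁ i)
      = fun ω => ∑ i, (x i ω • u₀ i + y i ω • u₁ i) := by
    funext ω
    rw [Finset.sum_apply]
  rwa [hfun] at hsum

/-- One step of the scheme, as a function of the current state and the noise. -/
def schemeStep {E : Type*} [AddCommGroup E] [Module ℝ E] (b : E → E) (γ lam : ℝ) (z ξ : E × E) :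
    E × E :=
  (z.1 + psi1 γ lam • z.2 - psi2 γ lam • b z.1 + √(2 * γ) • ξ.2,
    psi0 γ lam • z.2 - psi1 γ lam • b z.1 + √(2 * γ) • ξ.1)

lemma measurable_schemeStep {E : Type*} [NormedAddCommGroup E] [InnerProductSpace ℝ E]
    [MeasurableSpace E] [BorelSpace E] [SecondCountableTopology E] {b : E → E}
    (hb : Measurable b) (γ lam : ℝ) :
    Measurable fun p : (E × E) × (E × E) => schemeStep b γ lam p.1 p.2 := by
  unfold schemeStep
  fun_prop

variable {d : ℕ} {Ω : Type*} [MeasurableSpace Ω] {P : Measure Ω}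
  {γ lam : ℝ} {θ₀ V₀ : Ω → EuclideanSpace ℝ (Fin d)} {Ξ Ξ' : ℕ → Ω → EuclideanSpace ℝ (Fin d)}

/-- The image of the coordinate vector `(1, 0)` in coordinate `i` under `stepNoise`. -/
def noiseVec₀ (γ : ℝ) (i : Fin d) :
    WithLp 2 (EuclideanSpace ℝ (Fin d) × EuclideanSpace ℝ (Fin d)) :=
  WithLp.toLp 2 (0, (√(2 * γ) * (2 / γ)) • EuclideanSpace.single i (1 : ℝ))

/-- The image of the coordinate vector `(0, 1)` in coordinate `i` under `stepNoise`. -/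
def noiseVec₁ (γ : ℝ) (i : Fin d) :
    WithLp 2 (EuclideanSpace ℝ (Fin d) × EuclideanSpace ℝ (Fin d)) :=
  WithLp.toLp 2 (√(2 * γ) • EuclideanSpace.single i (1 : ℝ),
    √(2 * γ) • EuclideanSpace.single i (1 : ℝ))

/-- The energy form of the noise in coordinate `i`. -/
def noiseForm (γ lam : ℝ) (i : Fin d)
    (ξ : WithLp 2 (EuclideanSpace ℝ (Fin d) × EuclideanSpace ℝ (Fin d))) : ℝ :=
  2 * (noiseCov γ lam 0 0 * inner ℝ (noiseVec₀ γ i) ξ ^ 2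
    + (noiseCov γ lam 0 1 + noiseCov γ lam 1 0)
      * (inner ℝ (noiseVec₀ γ i) ξ * inner ℝ (noiseVec₁ γ i) ξ)
    + noiseCov γ lam 1 1 * inner ℝ (noiseVec₁ γ i) ξ ^ 2)

lemma continuous_noiseForm (γ lam : ℝ) (i : Fin d) : Continuous (noiseForm γ lam i) := by
  have h0 : Continuous fun ξ => inner ℝ (noiseVec₀ γ i) ξ := continuous_const.inner continuous_id
  have h1 : Continuous fun ξ => inner ℝ (noiseVec₁ γ i) ξ := continuous_const.inner continuous_id
  unfold noiseForm
  exact continuous_const.mul (((continuous_const.mul (h0.pow 2)).add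
    (continuous_const.mul (h0.mul h1))).add (continuous_const.mul (h1.pow 2)))

/-- The velocity noise contributes 8/γ through (2/γ)²·2γ, and the position noise at most 1/γ because
λγ ≤ 1/2. Then 36 = 2·2·(8 + 1), one factor 2 from the Gaussian inequality and one from (a + b)² ≤
2a² + 2b². -/
lemma noiseForm_le (hγ : 0 < γ) (hlam : 0 < lam) (hlam' : lam * γ ≤ 1 / 2) (i : Fin d)
    (ξ : WithLp 2 (EuclideanSpace ℝ (Fin d) × EuclideanSpace ℝ (Fin d))) :
    noiseForm γ lam i ξ ≤ 36 * (lam / γ) * (ξ.fst i ^ 2 + ξ.snd i ^ 2) := by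
  have hin0 : inner ℝ (noiseVec₀ γ i) ξ = √(2 * γ) * (2 / γ) * ξ.snd i := by
    simp [noiseVec₀, WithLp.prod_inner_apply, real_inner_smul_left,
      EuclideanSpace.inner_single_left]
  have hin1 : inner ℝ (noiseVec₁ γ i) ξ = √(2 * γ) * (ξ.fst i + ξ.snd i) := by
    simp [noiseVec₁, WithLp.prod_inner_apply, real_inner_smul_left,
      EuclideanSpace.inner_single_left]
    ring
  have hs : √(2 * γ) ^ 2 = 2 * γ := Real.sq_sqrt (by positivity)
  rw [noiseForm, noiseCov_quadratic]
  refine (mul_le_mul_of_nonneg_left (noiseCov_quadratic_le hγ hlam.le _ _) zero_le_two).trans ?_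
  rw [hin0, hin1, mul_pow, mul_pow, mul_pow, hs]
  generalize ξ.fst i = s
  generalize ξ.snd i = t
  have e1 : 2 * γ * (2 / γ) ^ 2 * t ^ 2 = 8 / γ * t ^ 2 := by field_simp; ring
  have e2 : lam ^ 2 * (2 * γ * (s + t) ^ 2) ≤ 1 / γ * (s ^ 2 + t ^ 2) := by
    have h1 : lam ^ 2 * (2 * γ * (s + t) ^ 2) = 1 / γ * (2 * (lam * γ) ^ 2 * (s + t) ^ 2) := by
      field_simp
    rw [h1]
    refine mul_le_mul_of_nonneg_left ?_ (by positivity)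
    have h2 : (lam * γ) ^ 2 ≤ 1 / 4 := by nlinarith [mul_pos hlam hγ]
    nlinarith [sq_nonneg (s - t), mul_le_mul_of_nonneg_right h2 (sq_nonneg (s + t))]
  rw [e1]
  have e3 : 36 * (lam / γ) * (s ^ 2 + t ^ 2)
      = 2 * (2 * lam * (8 / γ * (s ^ 2 + t ^ 2) + 1 / γ * (s ^ 2 + t ^ 2))) := by
    field_simp; ring
  have e4 : 8 / γ * t ^ 2 ≤ 8 / γ * (s ^ 2 + t ^ 2) :=
    mul_le_mul_of_nonneg_left (by nlinarith [sq_nonneg s]) (by positivity)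
  rw [e3]
  refine mul_le_mul_of_nonneg_left (mul_le_mul_of_nonneg_left (by linarith) (by positivity))
    zero_le_two

lemma sum_stepNoise_coords (γ : ℝ) (ξ ξ' : EuclideanSpace ℝ (Fin d)) :
    ∑ i, (ξ i • noiseVec₀ γ i + ξ' i • noiseVec₁ γ i) = stepNoise γ ξ ξ' := by
  have hx : ∀ x : EuclideanSpace ℝ (Fin d), ∑ i, x i • EuclideanSpace.single i (1 : ℝ) = x :=
    fun x => by
      ext j
      simp [Finset.sum_apply, Pi.single_apply]
  have h1 : ∀ i, ξ i • noiseVec₀ γ i + ξ' i • noiseVec₁ γ i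
      = stepNoise γ (ξ i • EuclideanSpace.single i (1 : ℝ))
        (ξ' i • EuclideanSpace.single i (1 : ℝ)) := fun i =>
    (stepNoise_smul_smul γ (ξ i) (ξ' i) (EuclideanSpace.single i (1 : ℝ))).symm
  rw [Finset.sum_congr rfl fun i _ => h1 i, ← stepNoise_sum, hx, hx]

lemma measurable_stepNoise (γ : ℝ) (hin : IsSchemeInput P γ lam θ₀ V₀ Ξ Ξ') (n : ℕ) :
    Measurable fun ω => stepNoise γ (Ξ n ω) (Ξ' n ω) := by
  have hΞ := hin.measurable_Ξ n
  have hΞ' := hin.measurable_Ξ' n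
  have h1 : Measurable fun ω => √(2 * γ) • Ξ' n ω := by fun_prop
  have h2 : Measurable fun ω => (√(2 * γ) * (2 / γ)) • Ξ n ω := by fun_prop
  exact (WithLp.measurable_toLp 2 _).comp (h1.prodMk (h1.add h2))

lemma addsForm_stepNoise [IsProbabilityMeasure P] (hγ : 0 < γ) (hlam : 0 < lam)
    (hlam' : lam * γ ≤ 1 / 2) (hin : IsSchemeInput P γ lam θ₀ V₀ Ξ Ξ') (n : ℕ) :
    AddsForm (P.map fun ω => stepNoise γ (Ξ n ω) (Ξ' n ω))
      (fun ξ => 36 * (lam / γ) * ‖ξ‖ ^ 2) := by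
  have hΞ := hin.measurable_Ξ n
  have hΞ' := hin.measurable_Ξ' n
  have hsum := addsForm_sum_of_hasLaw (posSemidef_noiseCov (γ := γ) hlam.le)
    (x := fun i ω => Ξ n ω i) (y := fun i ω => Ξ' n ω i) (fun i => by fun_prop)
    (fun i => by fun_prop) (hin.indep_coords n) (hin.law_coords n) (noiseVec₀ γ) (noiseVec₁ γ)
  simp only [sum_stepNoise_coords] at hsum
  have : IsProbabilityMeasure (P.map fun ω => stepNoise γ (Ξ n ω) (Ξ' n ω)) :=
    Measure.isProbabilityMeasure_map (measurable_stepNoise γ hin n).aemeasurable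
  refine hsum.mono (continuous_finsetSum _ fun i _ => continuous_noiseForm γ lam i)
    (continuous_const.mul (continuous_norm.pow 2)) fun ξ => ?_
  refine (Finset.sum_le_sum fun i _ => noiseForm_le hγ hlam hlam' i ξ).trans_eq ?_
  rw [← Finset.mul_sum, Finset.sum_add_distrib, WithLp.prod_norm_sq_eq_of_L2,
    EuclideanSpace.real_norm_sq_eq, EuclideanSpace.real_norm_sq_eq]

/-! ### Independence -/

/-- Associativity of the product of the three laws. -/
lemma indepFun_prodMk_of_indepFun [IsProbabilityMeasure P] {α β δ : Type*}
    [MeasurableSpace α] [MeasurableSpace β] [MeasurableSpace δ] {X : Ω → α} {Y : Ω → β}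
    {Z : Ω → δ} (hX : Measurable X)
    (hY : Measurable Y) (hZ : Measurable Z) (h1 : IndepFun X (fun ω => (Y ω, Z ω)) P)
    (h2 : IndepFun Y Z P) : IndepFun (fun ω => (X ω, Y ω)) Z P := by
  have pX := Measure.isProbabilityMeasure_map (μ := P) hX.aemeasurable
  have pY := Measure.isProbabilityMeasure_map (μ := P) hY.aemeasurable
  have pZ := Measure.isProbabilityMeasure_map (μ := P) hZ.aemeasurable
  have e1 := (indepFun_iff_map_prod_eq_prod_map_map hX.aemeasurable
    (hY.prodMk hZ).aemeasurable).1 h1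
  have e2 := (indepFun_iff_map_prod_eq_prod_map_map hY.aemeasurable hZ.aemeasurable).1 h2
  have h3 : IndepFun X Y P := h1.comp measurable_id measurable_fst
  have e3 := (indepFun_iff_map_prod_eq_prod_map_map hX.aemeasurable hY.aemeasurable).1 h3
  refine (indepFun_iff_map_prod_eq_prod_map_map (hX.prodMk hY).aemeasurable hZ.aemeasurable).2 ?_
  rw [e3]
  rw [e2, ← Measure.prodAssoc_prod] at e1
  have e4 := congrArg (Measure.map MeasurableEquiv.prodAssoc.symm) e1
  rw [Measure.map_map MeasurableEquiv.prodAssoc.symm.measurable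
    MeasurableEquiv.prodAssoc.measurable, Measure.map_map MeasurableEquiv.prodAssoc.symm.measurable
    (hX.prodMk (hY.prodMk hZ))] at e4
  rw [MeasurableEquiv.symm_comp_self, Measure.map_id] at e4
  exact e4

/-- The n-th iterate involves only the noises of index below n; the noise of index n drives the next
step and is therefore independent of it. -/
lemma exists_measurable_expScheme {Ω : Type*}
    {b : EuclideanSpace ℝ (Fin d) → EuclideanSpace ℝ (Fin d)}
    (hb : Measurable b) (γ lam : ℝ) (θ₀ V₀ : Ω → EuclideanSpace ℝ (Fin d))
    (Ξ Ξ' : ℕ → Ω → EuclideanSpace ℝ (Fin d)) (n : ℕ) :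
    ∃ Ψ : (EuclideanSpace ℝ (Fin d) × EuclideanSpace ℝ (Fin d)) ×
        (Finset.range n → EuclideanSpace ℝ (Fin d) × EuclideanSpace ℝ (Fin d)) →
        EuclideanSpace ℝ (Fin d) × EuclideanSpace ℝ (Fin d), Measurable Ψ ∧
      ∀ ω, expScheme b γ lam θ₀ V₀ Ξ Ξ' n ω
        = Ψ ((θ₀ ω, V₀ ω), fun i => (Ξ i ω, Ξ' i ω)) := by
  induction n with
  | zero => exact ⟨Prod.fst, measurable_fst, fun ω => rfl⟩
  | succ n ih =>
    obtain ⟨Ψ, hΨ, h⟩ := ih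
    have hρm : Measurable fun x : (EuclideanSpace ℝ (Fin d) × EuclideanSpace ℝ (Fin d)) ×
        (Finset.range (n + 1) → EuclideanSpace ℝ (Fin d) × EuclideanSpace ℝ (Fin d)) =>
        Ψ (x.1, fun i => x.2 ⟨i, Finset.range_subset_range.2 n.le_succ i.2⟩) :=
      hΨ.comp (by fun_prop)
    have hlast : Measurable fun x : (EuclideanSpace ℝ (Fin d) × EuclideanSpace ℝ (Fin d)) ×
        (Finset.range (n + 1) → EuclideanSpace ℝ (Fin d) × EuclideanSpace ℝ (Fin d)) =>
        x.2 ⟨n, Finset.self_mem_range_succ n⟩ := by fun_prop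
    have hstep := measurable_schemeStep hb γ lam
    have hcomp := hstep.comp (hρm.prodMk hlast)
    refine ⟨_, hcomp, fun ω => ?_⟩
    change schemeStep b γ lam (expScheme b γ lam θ₀ V₀ Ξ Ξ' n ω) (Ξ n ω, Ξ' n ω) = _
    rw [h]
    rfl

lemma measurable_expScheme {b : EuclideanSpace ℝ (Fin d) → EuclideanSpace ℝ (Fin d)}
    (hb : Measurable b) (hin : IsSchemeInput P γ lam θ₀ V₀ Ξ Ξ') (n : ℕ) :
    Measurable (expScheme b γ lam θ₀ V₀ Ξ Ξ' n) := by
  obtain ⟨Ψ, hΨ, h⟩ := exists_measurable_expScheme hb γ lam θ₀ V₀ Ξ Ξ' n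
  rw [funext h]
  exact hΨ.comp ((hin.measurable_θ₀.prodMk hin.measurable_V₀).prodMk
    (measurable_pi_lambda _ fun i => (hin.measurable_Ξ i).prodMk (hin.measurable_Ξ' i)))

lemma indepFun_expScheme [IsProbabilityMeasure P]
    {b : EuclideanSpace ℝ (Fin d) → EuclideanSpace ℝ (Fin d)}
    (hb : Measurable b) (hin : IsSchemeInput P γ lam θ₀ V₀ Ξ Ξ') (n : ℕ) :
    IndepFun (expScheme b γ lam θ₀ V₀ Ξ Ξ' n) (fun ω => (Ξ n ω, Ξ' n ω)) P := by
  obtain ⟨Ψ, hΨ, h⟩ := exists_measurable_expScheme hb γ lam θ₀ V₀ Ξ Ξ' n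
  have hpm : ∀ i, Measurable fun ω => (Ξ i ω, Ξ' i ω) := fun i =>
    (hin.measurable_Ξ i).prodMk (hin.measurable_Ξ' i)
  have hYm : Measurable fun ω (i : Finset.range n) => (Ξ i ω, Ξ' i ω) :=
    measurable_pi_lambda _ fun i => hpm i
  have h1 : IndepFun (fun ω => (θ₀ ω, V₀ ω))
      (fun ω => ((fun i : Finset.range n => (Ξ i ω, Ξ' i ω)), (Ξ n ω, Ξ' n ω))) P :=
    hin.indep_init.comp (φ := id) (ψ := fun s : ℕ → EuclideanSpace ℝ (Fin d) ×
      EuclideanSpace ℝ (Fin d) => ((fun i : Finset.range n => s i), s n)) measurable_id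
      (by fun_prop)
  have h2 : IndepFun (fun ω (i : Finset.range n) => (Ξ i ω, Ξ' i ω))
      (fun ω => (Ξ n ω, Ξ' n ω)) P := by
    have := hin.indep_steps.indepFun_finset (Finset.range n) {n} (by simp) hpm
    exact this.comp measurable_id (measurable_pi_apply ⟨n, Finset.mem_singleton_self n⟩)
  have h3 := indepFun_prodMk_of_indepFun (hin.measurable_θ₀.prodMk hin.measurable_V₀) hYm (hpm n)
    h1 h2
  rw [funext h]
  exact h3.comp hΨ measurable_id

end Noise
end TamedKinetic
end

noncomputable section

open MeasureTheory ProbabilityTheory Filter Topology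

namespace TamedKinetic

/-! ### Propagation of the log-Sobolev constant and the main theorem. -/

section Main

variable {d : ℕ}

lemma measurable_coordM (γ : ℝ) : Measurable (coordM (d := d) γ) :=
  (WithLp.measurable_toLp 2 _).comp (by fun_prop)

lemma nontrivial_withLp_prod (hd : 0 < d) :
    Nontrivial (WithLp 2 (EuclideanSpace ℝ (Fin d) × EuclideanSpace ℝ (Fin d))) := by
  have : NeZero d := ⟨hd.ne'⟩
  have : Nontrivial (EuclideanSpace ℝ (Fin d)) := inferInstance
  infer_instance

variable {Ω : Type*} [MeasurableSpace Ω] {P : Measure Ω} [IsProbabilityMeasure P]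
  {γ lam m : ℝ} {M : NNReal} {b : EuclideanSpace ℝ (Fin d) → EuclideanSpace ℝ (Fin d)}
  {θ₀ V₀ : Ω → EuclideanSpace ℝ (Fin d)} {Ξ Ξ' : ℕ → Ω → EuclideanSpace ℝ (Fin d)}

lemma satisfiesLSI_expScheme_succ (hbm : Measurable b) (hγ : 0 < γ) (hlam : 0 < lam)
    (hlam' : lam * γ ≤ 1 / 2) {κ : NNReal} (hκ : LipschitzWith κ (stepMap b γ lam))
    (hin : IsSchemeInput P γ lam θ₀ V₀ Ξ Ξ') {n : ℕ} {C : ℝ} (hC : 0 ≤ C)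
    (h : SatisfiesLSI (P.map fun ω => coordM γ (expScheme b γ lam θ₀ V₀ Ξ Ξ' n ω)) C) :
    SatisfiesLSI (P.map fun ω => coordM γ (expScheme b γ lam θ₀ V₀ Ξ Ξ' (n + 1) ω))
      (κ ^ 2 * C + 36 * (lam / γ)) := by
  have hz := measurable_expScheme hbm hin n
  have hX : Measurable fun ω => coordM γ (expScheme b γ lam θ₀ V₀ Ξ Ξ' n ω) :=
    (measurable_coordM γ).comp hz
  have hS : Measurable (stepMap b γ lam) := hκ.continuous.measurable
  have hN := measurable_stepNoise γ hin n
  have hNm : Measurable fun p : EuclideanSpace ℝ (Fin d) × EuclideanSpace ℝ (Fin d) =>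
      stepNoise γ p.1 p.2 := by
    unfold stepNoise
    exact (WithLp.measurable_toLp 2 _).comp (by fun_prop)
  have hind : IndepFun
      (fun ω => stepMap b γ lam (coordM γ (expScheme b γ lam θ₀ V₀ Ξ Ξ' n ω)))
      (fun ω => stepNoise γ (Ξ n ω) (Ξ' n ω)) P :=
    (indepFun_expScheme hbm hin n).comp (hS.comp (measurable_coordM γ)) hNm
  have hmap : (P.map fun ω => coordM γ (expScheme b γ lam θ₀ V₀ Ξ Ξ' (n + 1) ω))
      = ((P.map fun ω => coordM γ (expScheme b γ lam θ₀ V₀ Ξ Ξ' n ω)).map (stepMap b γ lam))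
        ∗ (P.map fun ω => stepNoise γ (Ξ n ω) (Ξ' n ω)) := by
    rw [Measure.map_map hS hX]
    refine Eq.trans ?_ (hind.map_add_eq_map_conv_map (hS.comp hX) hN)
    congr 1
    funext ω
    exact coordM_expScheme_succ b hγ θ₀ V₀ Ξ Ξ' n ω
  have hp := Measure.isProbabilityMeasure_map (μ := P) hX.aemeasurable
  have hp' := Measure.isProbabilityMeasure_map
    (μ := P.map fun ω => coordM γ (expScheme b γ lam θ₀ V₀ Ξ Ξ' n ω)) hS.aemeasurable
  have h1 := formLSI_iff_satisfiesLSI.2 (h.map_lipschitz hC hκ)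
  have hcont : Continuous fun ξ : WithLp 2 (EuclideanSpace ℝ (Fin d) × EuclideanSpace ℝ (Fin d)) =>
      (κ ^ 2 * C) * ‖ξ‖ ^ 2 := continuous_const.mul (continuous_norm.pow 2)
  have h2 := addsForm_stepNoise hγ hlam hlam' hin n _ _ hcont h1
  rw [hmap, ← formLSI_iff_satisfiesLSI]
  simpa only [add_mul] using h2

/-- The exact solution of C' = ρC + 36λ/γ: an interpolation between C₀ and the fixed point 180/m. -/
lemma satisfiesLSI_expScheme (hbm : Measurable b) (hm : 0 < m) (hγ : 0 < γ) (hlam : 0 < lam)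
    (hlam' : lam * γ ≤ 1 / 2) {ρ : ℝ} (hρ : 0 ≤ ρ) (hρm : ρ = 1 - m * lam / (5 * γ))
    (hlip : LipschitzWith (√ρ).toNNReal (stepMap b γ lam))
    (hin : IsSchemeInput P γ lam θ₀ V₀ Ξ Ξ') {C₀ : ℝ} (hC₀ : 0 ≤ C₀)
    (h : SatisfiesLSI (P.map fun ω => coordM γ (θ₀ ω, V₀ ω)) C₀) (n : ℕ) :
    SatisfiesLSI (P.map fun ω => coordM γ (expScheme b γ lam θ₀ V₀ Ξ Ξ' n ω))
      (ρ ^ n * C₀ + (1 - ρ ^ n) * (180 / m)) := by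
  have hρ1 : ρ ≤ 1 := by
    rw [hρm]
    linarith [show 0 ≤ m * lam / (5 * γ) by positivity]
  induction n with
  | zero => simpa [expScheme] using h
  | succ n ih =>
    have hpow : ρ ^ n ≤ 1 := pow_le_one₀ hρ hρ1
    have hC : 0 ≤ ρ ^ n * C₀ + (1 - ρ ^ n) * (180 / m) :=
      add_nonneg (by positivity) (mul_nonneg (by linarith) (by positivity))
    have hs := satisfiesLSI_expScheme_succ hbm hγ hlam hlam' hlip hin hC ih
    have hsq : (((√ρ).toNNReal : NNReal) : ℝ) ^ 2 = ρ := by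
      rw [Real.coe_toNNReal _ (Real.sqrt_nonneg _), Real.sq_sqrt hρ]
    have e : 36 * (lam / γ) = (1 - ρ) * (180 / m) := by
      rw [hρm]
      field_simp
      ring
    convert hs using 1
    rw [hsq, e]
    ring

end Main

end TamedKinetic

end

open TamedKinetic in
theorem mainTheorem4 :
    ∃ c₀ : ℝ, 0 < c₀ ∧ ∃ K : ℝ, 0 ≤ K ∧
      ∀ (d : ℕ) (_hd : 0 < d) (u : EuclideanSpace ℝ (Fin d) → ℝ) (m L l : ℝ),
        Differentiable ℝ u → 0 < m → 0 < L → 0 < l →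
        StronglyMonotone (gradient u) m → PolyLipschitz (gradient u) L l →
      ∀ γ lam : ℝ, 0 < γ → 0 < lam →
        5 * √(lipConst (tamedDrift (gradient u) m L l lam)) ≤ γ → lam ≤ 1 / (2 * γ) →
      ∀ (Ω : Type*) [MeasurableSpace Ω] (P : Measure Ω) [IsProbabilityMeasure P]
        (θ₀ V₀ : Ω → EuclideanSpace ℝ (Fin d)) (Ξ Ξ' : ℕ → Ω → EuclideanSpace ℝ (Fin d)),
        IsSchemeInput P γ lam θ₀ V₀ Ξ Ξ' →
      ∀ C₀ : ℝ, SatisfiesLSI (P.map fun ω => coordM γ (θ₀ ω, V₀ ω)) C₀ →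
      ∀ n : ℕ, ∃ C : ℝ,
        C ≤ (1 - c₀ * m / γ * lam) ^ n * C₀ + 1 / (c₀ * m) + K * (lam * γ) ∧
        SatisfiesLSI
          (P.map fun ω => coordM γ
            (expScheme (tamedDrift (gradient u) m L l lam) γ lam θ₀ V₀ Ξ Ξ' n ω)) C := by
  -- The fixed point 180/m dictates c₀; the proved rate m/(5γ) is faster than needed.
  refine ⟨1 / 180, by norm_num, 0, le_rfl, ?_⟩
  intro d hd u m L l hu hm hL hl hmono hpoly γ lam hγ hlam hγM hlamγ Ω _ P _ θ₀ V₀ Ξ Ξ' hin C₀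
    hC₀ n
  obtain ⟨hb, hmM, hcoco⟩ := tamedDrift_properties hd hu hm hL hl hmono hpoly hlam
  set b := tamedDrift (gradient u) m L l lam
  have hγM' : 25 * (lipConst b : ℝ) ≤ γ ^ 2 := by
    have h := pow_le_pow_left₀ (by positivity) hγM 2
    rw [mul_pow, Real.sq_sqrt (NNReal.coe_nonneg _)] at h
    linarith
  have hlam' : lam * γ ≤ 1 / 2 := by
    rw [le_div_iff₀ (by positivity)] at hlamγ
    linarith
  have hρ : 1 - lam * γ * (m / γ ^ 2) / 5 = 1 - m * lam / (5 * γ) := by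
    field_simp
  have hlip := lipschitzWith_stepMap hm hmM hcoco hγ hγM' hlam hlam'
  rw [hρ] at hlip
  have hx : m * lam / (5 * γ) ≤ 1 := by
    rw [div_le_one (by positivity)]
    have h1 : 25 * m ≤ γ ^ 2 := by linarith
    have h2 : m * (lam * γ) ≤ m * (1 / 2) := mul_le_mul_of_nonneg_left hlam' hm.le
    have h3 : m * lam * γ ≤ 5 * γ * γ := by nlinarith
    exact le_of_mul_le_mul_right h3 hγ
  -- Positive dimension forces C₀ ≥ 0, which is needed to iterate and to weaken the contraction rate
  -- in front of C₀.
  have hnt := nontrivial_withLp_prod hd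
  have hC₀' : 0 ≤ C₀ := by
    have : IsProbabilityMeasure (P.map fun ω => coordM γ (θ₀ ω, V₀ ω)) :=
      Measure.isProbabilityMeasure_map
        ((measurable_coordM γ).comp (hin.measurable_θ₀.prodMk hin.measurable_V₀)).aemeasurable
    exact hC₀.nonneg
  have hpos : 0 ≤ m * lam / (5 * γ) := by positivity
  refine ⟨_, ?_, satisfiesLSI_expScheme hb.continuous.measurable hm hγ hlam hlam'
    (sub_nonneg.2 hx) rfl hlip hin hC₀' hC₀ n⟩
  have h1 : (1 - m * lam / (5 * γ)) ^ n ≤ (1 - 1 / 180 * m / γ * lam) ^ n := by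
    refine pow_le_pow_left₀ (sub_nonneg.2 hx) ?_ n
    have : 1 / 180 * m / γ * lam = m * lam / (5 * γ) / 36 := by field_simp; norm_num
    linarith
  have h2 := mul_le_mul_of_nonneg_right h1 hC₀'
  have h3 : 0 ≤ (1 - m * lam / (5 * γ)) ^ n * (180 / m) :=
    mul_nonneg (pow_nonneg (sub_nonneg.2 hx) n) (by positivity)
  have h4 : 1 / (1 / 180 * m) = 180 / m := by field_simp
  rw [h4]
  linarith
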